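/- Let $0<\alpha<1$, $\mathbb T=\mathbb R/2\pi\mathbb Z$, and consider the Majda--Biello system $$u_t+u_{xxx}+vv_x=0,\qquad v_t+\alpha v_{xxx}+(uv)_x=0,\qquad (u,v)|_{t=0}=(u_0,v_0),\qquad x\in\mathbb T,$$ for real-valued $u,v$. Put $$c_1=\tfrac12+\tfrac{\sqrt{-3+12\alpha^{-1}}}{6},\quad d_1=\tfrac{-3\alpha+\sqrt{3\alpha(4-\alpha)}}{2(1-\alpha)},\quad d_2=\tfrac{-3\alpha-\sqrt{3\alpha(4-\alpha)}}{2(1-\alpha)}.$$ A real number $\rho$ is of type $\nu>0$ if there is $K>0$ with $|\rho-\frac mn|\ge K|n|^{-2-\nu}$ for all integers $m$ and $n\neq0$. Its minimal type index is $\nu_\rho=\infty$ if $\rho\in\mathbb Q$, and $\nu_\rho=\inf\{\nu>0:\rho\text{ is of type }\nu\}\in[0,\infty]$ (with $\inf\emptyset=\infty$) if $\rho\notin\mathbb Q$. Let $s_0=\frac12+\frac12\max(\nu_{c_1},\nu_{d_1},\nu_{d_2})$. Let $s\in\mathbb R$ and let $\{(u_0,v_0)\in H^s(\mathbb T)\times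 H^s(\mathbb T):\int_{\mathbb T}u_0\,dx=0\}$, with the norm of $H^s\times H^s$ (where $\|f\|_{H^s}=\|(1+|n|)^s\widehat f(n)\|_{\ell^2_n}$), be the space of initial data. Let $U$ be an open neighbourhood of $0$ in this space, let $T>0$, and let $\Phi_t:U\to H^s(\mathbb T)\times H^s(\mathbb T)$, $|t|<T$, be the solution map of the system: for every pair of smooth data $(u_0,v_0)\in U$ there is a smooth solution $(u,v)$ on $(-T,T)\times\mathbb T$, and $\Phi_t(u_0,v_0)=(u(t),v(t))$. (A continuous $\Phi_t$ is thereby determined on all of $U$, smooth data being dense.) Fix $t$ with $0<|t|<T$. (a) If $\max(\nu_{c_1},\nu_{d_1},\nu_{d_2})>1$ and $\Phi_t$ is $C^2$ on $U$, then $s\ge1$. In particular, if any of $c_1,d_1,d_2$ is rational, then this maximum exceeds $1$, and $s\ge 1$ whenever $\Phi_t$ is $C^2$ on $U$. (b) If $\max(\nu_{c_1},\nu_{d_1},\nu_{d_2})\le1$ and $\Phi_t$ is $C^3$ on $U$, then $s\ge s_0$. -/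

import Mathlib

open scoped ContDiff ENNReal

noncomputable section

namespace MajdaBiello

/-! ### Diophantine type -/

/-- The real number `ρ` is of type `ν`: for some `K > 0`, `|ρ - m / n| ≥ K / |n| ^ (2 + ν)` for all
pairs of integers `(m, n)`, `n ≠ 0`. (Only used for `ν > 0`.) -/
def IsOfType (ρ ν : ℝ) : Prop :=
  ∃ K : ℝ, 0 < K ∧ ∀ m n : ℤ, n ≠ 0 → K / |(n : ℝ)| ^ (2 + ν) ≤ |ρ - (m : ℝ) / (n : ℝ)|

open Classical in
/-- The minimal type index `ν_ρ ∈ [0, ∞]`: it is `∞` for rational `ρ`, and otherwise the infimum of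
all `ν > 0` such that `ρ` is of type `ν` (so `∞` if there is no such `ν`). -/
def minimalTypeIndex (ρ : ℝ) : ℝ≥0∞ :=
  if ∃ q : ℚ, (q : ℝ) = ρ then ⊤
  else sInf {x : ℝ≥0∞ | ∃ ν : ℝ, 0 < ν ∧ IsOfType ρ ν ∧ x = ENNReal.ofReal ν}

/-- `c₁ = 1/2 + √(-3 + 12/α) / 6`. -/
def c₁ (α : ℝ) : ℝ := 1 / 2 + √(-3 + 12 * α⁻¹) / 6

/-- `d₁ = (-3α + √(3α(4 - α))) / (2(1 - α))`. -/
def d₁ (α : ℝ) : ℝ := (-3 * α + √(3 * α * (4 - α))) / (2 * (1 - α))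

/-- `d₂ = (-3α - √(3α(4 - α))) / (2(1 - α))`. -/
def d₂ (α : ℝ) : ℝ := (-3 * α - √(3 * α * (4 - α))) / (2 * (1 - α))

/-- `max (ν_{c₁}, ν_{d₁}, ν_{d₂})`. -/
def maxTypeIndex (α : ℝ) : ℝ≥0∞ :=
  max (minimalTypeIndex (c₁ α)) (max (minimalTypeIndex (d₁ α)) (minimalTypeIndex (d₂ α)))

/-! ### Sobolev spaces of real-valued periodic functions -/

/-- `⟨n⟩ = 1 + |n|`. -/
def jb (n : ℤ) : ℝ := 1 + |(n : ℝ)|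

lemma jb_pos (n : ℤ) : 0 < jb n := by unfold jb; positivity

/-- Fourier coefficients of the real-valued distributions in `H^s(𝕋)`: sequences `a` with
`a (-n) = conj (a n)` and `∑ (⟨n⟩^s |a n|)² < ∞`. -/
def sobolevSubmodule (s : ℝ) : Submodule ℝ (ℤ → ℂ) where
  carrier := {a | (∀ n, a (-n) = (starRingEnd ℂ) (a n)) ∧ Memℓp (fun n => (jb n ^ s) • a n) 2}
  zero_mem' := by
    refine ⟨fun n => by simp, ?_⟩
    have e : (fun n : ℤ => (jb n ^ s) • (0 : ℤ → ℂ) n) = 0 := by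
      funext n; simp
    rw [e]
    exact zero_memℓp
  add_mem' := by
    rintro a b ⟨ha, ha'⟩ ⟨hb, hb'⟩
    refine ⟨fun n => by simp [ha n, hb n], ?_⟩
    have h := ha'.add hb'
    have e : ((fun n => (jb n ^ s) • a n) + fun n => (jb n ^ s) • b n)
        = fun n => (jb n ^ s) • (a + b) n := by
      funext n; simp
    rwa [e] at h
  smul_mem' := by
    rintro c a ⟨ha, ha'⟩
    refine ⟨fun n => by simp [ha n], ?_⟩
    have h := ha'.const_smul c
    have e : (c • fun n => (jb n ^ s) • a n) = fun n => (jb n ^ s) • (c • a) n := by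
      funext n; simp; ring
    rwa [e] at h

/-- The Sobolev space `H^s(𝕋)`, `𝕋 = ℝ / 2πℤ`, `s ∈ ℝ`, of real-valued periodic distributions; a
periodic distribution `∑ a n e^{inx}` is identified with its Fourier coefficients `a : ℤ → ℂ`. -/
def Sobolev (s : ℝ) : Type := ↥(sobolevSubmodule s)

instance (s : ℝ) : AddCommGroup (Sobolev s) := inferInstanceAs (AddCommGroup ↥(sobolevSubmodule s))

instance (s : ℝ) : Module ℝ (Sobolev s) := inferInstanceAs (Module ℝ ↥(sobolevSubmodule s))

/-- The `n`-th Fourier coefficient of `f ∈ H^s(𝕋)`. -/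
def Sobolev.coeff {s : ℝ} (f : Sobolev s) (n : ℤ) : ℂ := f.1 n

/-- The linear embedding `f ↦ (⟨n⟩^s f̂(n))ₙ` of `H^s(𝕋)` into `ℓ²(ℤ)`. -/
def Sobolev.toLp (s : ℝ) : Sobolev s →ₗ[ℝ] lp (fun _ : ℤ => ℂ) 2 where
  toFun f := ⟨fun n => (jb n ^ s) • f.coeff n, f.2.2⟩
  map_add' f g := by
    ext n
    exact smul_add (jb n ^ s) (f.1 n) (g.1 n)
  map_smul' c f := by
    ext n
    exact smul_comm (jb n ^ s) c (f.1 n)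

lemma Sobolev.toLp_injective (s : ℝ) : Function.Injective (Sobolev.toLp s) := by
  intro f g h
  apply Subtype.ext
  funext n
  have h1 : (jb n ^ s) • f.1 n = (jb n ^ s) • g.1 n :=
    congrFun (congrArg (fun x : lp (fun _ : ℤ => ℂ) 2 => (x : ℤ → ℂ)) h) n
  exact smul_right_injective ℂ (Real.rpow_pos_of_pos (jb_pos n) s).ne' h1

/-- The norm of `H^s(𝕋)` is `‖⟨n⟩^s f̂(n)‖_{ℓ²}`. -/
instance (s : ℝ) : NormedAddCommGroup (Sobolev s) :=
  NormedAddCommGroup.induced (Sobolev s) (lp (fun _ : ℤ => ℂ) 2) (Sobolev.toLp s)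
    (Sobolev.toLp_injective s)

instance (s : ℝ) : NormedSpace ℝ (Sobolev s) :=
  NormedSpace.induced ℝ (Sobolev s) (lp (fun _ : ℤ => ℂ) 2) (Sobolev.toLp s)

lemma Sobolev.norm_sq_eq {s : ℝ} (f : Sobolev s) :
    ‖f‖ ^ 2 = ∑' n : ℤ, (jb n ^ s * ‖f.coeff n‖) ^ 2 := by
  have h : ‖f‖ = ‖Sobolev.toLp s f‖ := rfl
  have h2 := lp.norm_rpow_eq_tsum (p := 2) (by norm_num) (Sobolev.toLp s f)
  norm_num at h2
  rw [h, h2]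
  refine tsum_congr fun n => ?_
  have h3 : (Sobolev.toLp s f : ℤ → ℂ) n = (jb n ^ s) • f.coeff n := rfl
  rw [h3, norm_smul, Real.norm_of_nonneg (Real.rpow_pos_of_pos (jb_pos n) s).le]

/-- The space of initial data: pairs `(u₀, v₀) ∈ H^s(𝕋) × H^s(𝕋)` such that `u₀` has mean zero, with
the norm induced by `H^s × H^s`. -/
def Data (s : ℝ) : Submodule ℝ (Sobolev s × Sobolev s) where
  carrier := {w | w.1.coeff 0 = 0}
  zero_mem' := rfl
  add_mem' := by
    intro a b ha hb
    have h : (a + b).1.coeff 0 = a.1.coeff 0 + b.1.coeff 0 := rfl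
    simp only [Set.mem_ofPred_eq] at ha hb ⊢
    rw [h, ha, hb, add_zero]
  smul_mem' := by
    intro c a ha
    have h : (c • a).1.coeff 0 = c • a.1.coeff 0 := rfl
    simp only [Set.mem_ofPred_eq] at ha ⊢
    rw [h, ha, smul_zero]

/-! ### The Majda–Biello system and its solution map -/

/-- `f` (a real-valued function on the line) is smooth and `2π`-periodic. -/
def IsSmoothPeriodic (f : ℝ → ℝ) : Prop :=
  ContDiff ℝ ∞ f ∧ Function.Periodic f (2 * Real.pi)

/-- The element `a` of `H^s(𝕋)` is the `2π`-periodic function `f`: same Fourier coefficients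
`(2π)⁻¹ ∫₀^{2π} f(x) e^{-inx} dx`. -/
def Represents {s : ℝ} (a : Sobolev s) (f : ℝ → ℝ) : Prop :=
  ∀ n : ℤ, a.coeff n = fourierCoeffOn Real.two_pi_pos (fun x => (f x : ℂ)) n

/-- `(u, v)`, written `u t x`, `v t x`, is a smooth real-valued solution on `(-T, T) × 𝕋` of
`u_t + u_xxx + v v_x = 0`, `v_t + α v_xxx + (u v)_x = 0`. -/
structure IsSmoothSolution (α T : ℝ) (u v : ℝ → ℝ → ℝ) : Prop where
  smooth_u : ContDiffOn ℝ ∞ (fun p : ℝ × ℝ => u p.1 p.2) (Set.Ioo (-T) T ×ˢ Set.univ)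
  smooth_v : ContDiffOn ℝ ∞ (fun p : ℝ × ℝ => v p.1 p.2) (Set.Ioo (-T) T ×ˢ Set.univ)
  periodic_u : ∀ t ∈ Set.Ioo (-T) T, Function.Periodic (u t) (2 * Real.pi)
  periodic_v : ∀ t ∈ Set.Ioo (-T) T, Function.Periodic (v t) (2 * Real.pi)
  eq_u : ∀ t ∈ Set.Ioo (-T) T, ∀ x : ℝ,
    deriv (fun τ => u τ x) t + iteratedDeriv 3 (u t) x + v t x * deriv (v t) x = 0
  eq_v : ∀ t ∈ Set.Ioo (-T) T, ∀ x : ℝ,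
    deriv (fun τ => v τ x) t + α * iteratedDeriv 3 (v t) x + deriv (fun y => u t y * v t y) x = 0

/-- `Φ t`, `|t| < T`, is the solution map `(u₀, v₀) ↦ (u(t), v(t))` of the system on the set `U` of
initial data in `H^s × H^s` (`u₀` of mean zero): for smooth data in `U` there is a smooth solution on
`(-T, T)`, and `Φ t` maps the data to the value of that solution at time `t`.
Smooth solutions are determined by their data and smooth data are dense, so on an open set `U` this
determines every continuous `Φ t`; it is meaningful for every real `s`, also where products of
elements of `H^s` are undefined. -/
def IsSolutionMap (α s T : ℝ) (U : Set (Data s)) (Φ : ℝ → Data s → Sobolev s × Sobolev s) : Prop :=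
  ∀ w ∈ U, ∀ u₀ v₀ : ℝ → ℝ, IsSmoothPeriodic u₀ → IsSmoothPeriodic v₀ →
    Represents w.1.1 u₀ → Represents w.1.2 v₀ →
    ∃ u v : ℝ → ℝ → ℝ, IsSmoothSolution α T u v ∧ u 0 = u₀ ∧ v 0 = v₀ ∧
      ∀ t ∈ Set.Ioo (-T) T, Represents (Φ t w).1 (u t) ∧ Represents (Φ t w).2 (v t)

end MajdaBiello

end

open MajdaBiello

/-!
The proof expands the solution map at the origin. For smooth data `δ w` with finitely many Fourier
modes, Duhamel's formula (`mode_sub_eq_integral`) expresses each Fourier coefficient of the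
solution through Fourier coefficients of `v²` and `uv`, and conservation of the mean of `u² + v²`
(`IsSmoothSolution.mass_eq`) bounds these by `O(δ²)`. No well-posedness theory is needed: the mass
of the difference between the solution and `δ` times the linear wave depends, by conservation of
mass, on finitely many Fourier coefficients only (`SolutionFamily.remainder_eq`), so it is
`O(δ³)`; its `δ³` term vanishes because a nonnegative quantity cannot change sign with `δ`
(`isBigO_of_nonneg_of_cubic`), so it is `O(δ⁴)`. This yields the Taylor expansion in `δ` of each
Fourier coefficient, to second order for `u` and to third order for `v`
(`SolutionFamily.isBigO_mode_u_second`, `SolutionFamily.isBigO_mode_v_third`), whose coefficients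
are the Picard iterates. If `Φ_t` is `C²` or `C³`, its finite differences of second or third order
are `O(‖w‖²)` or `O(‖w‖³)` (`exists_norm_second_difference_le`,
`exists_norm_third_difference_le`), and the Picard iterates are bounded in `H^s`
(`IsSolutionMap.exists_second_le`, `IsSolutionMap.exists_third_le`).

These bounds are tested on data with the frequencies `±m` and `±(n - m)`. The resonance functions
`α m³ + α (n - m)³ - n³` of `v v → u` and `m³ + α (n - m)³ - α n³` of `u v → v` are `n³ f(m / n)`
for cubics `f` that vanish at `c₁`, respectively at `d₁` and `d₂`. If `m / n` approximates such a
root to within `n^{-2-ν}`, the resonance function is `O(n^{1-ν})` (`exists_nearResonant`). For `ν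
> 1` the second iterate at frequency `n` is then of size `n`, so that `n^s n ≲ n^{2s}` and `s ≥ 1`
(`one_le_of_second_le`). For `ν ≤ 1` the interaction followed by the reverse interaction
contributes `n²` times `∫₀ᵗ e^{-iθσ} ∫₀^σ e^{iθρ} dρ dσ` to the third iterate
(`thirdV_sub_pairInd`, `thirdV_polar`). This integral is never much smaller than `1 / (1 + |θ|)`
(`exists_le_norm_returnInt`), so the third iterate is of size `n^{1+ν}`, whence `n^s n^{1+ν} ≲
n^{3s}` and `s ≥ (1 + ν) / 2` (`le_of_third_le`). The required approximations exist by the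
definition of the minimal type index and, for `ν = 0`, by Dirichlet's theorem
(`approximable_zero`).
-/

namespace MajdaBiello

open MeasureTheory Set intervalIntegral

/-! ### Means over a period -/

lemma uIcc_zero_subset_Ioo {t T : ℝ} (ht : |t| < T) : uIcc 0 t ⊆ Ioo (-T) T := by
  rw [abs_lt] at ht
  intro τ hτ
  rcases le_total 0 t with h | h
  · rw [uIcc_of_le h] at hτ
    exact ⟨by linarith [hτ.1], by linarith [hτ.2]⟩
  · rw [uIcc_of_ge h] at hτ
    exact ⟨by linarith [hτ.1], by linarith [hτ.2]⟩

/-- The mean `(2π)⁻¹ ∫₀^{2π} f(x) dx`. -/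
noncomputable def periodMean {E : Type*} [NormedAddCommGroup E] [NormedSpace ℝ E] (f : ℝ → E) : E :=
  (2 * Real.pi)⁻¹ • ∫ x in (0 : ℝ)..(2 * Real.pi), f x

section PeriodMean

variable {E : Type*} [NormedAddCommGroup E] [NormedSpace ℝ E]

lemma periodMean_add {f g : ℝ → E} (hf : Continuous f) (hg : Continuous g) :
    periodMean (fun x => f x + g x) = periodMean f + periodMean g := by
  unfold periodMean
  rw [integral_add (hf.intervalIntegrable _ _) (hg.intervalIntegrable _ _), smul_add]

lemma periodMean_sub {f g : ℝ → E} (hf : Continuous f) (hg : Continuous g) :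
    periodMean (fun x => f x - g x) = periodMean f - periodMean g := by
  unfold periodMean
  rw [integral_sub (hf.intervalIntegrable _ _) (hg.intervalIntegrable _ _), smul_sub]

lemma periodMean_sum {ι : Type*} (S : Finset ι) {f : ι → ℝ → E} (hf : ∀ i ∈ S, Continuous (f i)) :
    periodMean (fun x => ∑ i ∈ S, f i x) = ∑ i ∈ S, periodMean (f i) := by
  unfold periodMean
  rw [integral_finsetSum fun i hi => (hf i hi).intervalIntegrable _ _, Finset.smul_sum]

lemma periodMean_const_mul {𝕜 : Type*} [RCLike 𝕜] (c : 𝕜) (f : ℝ → 𝕜) :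
    periodMean (fun x => c * f x) = c * periodMean f := by
  unfold periodMean
  rw [intervalIntegral.integral_const_mul, mul_smul_comm]

lemma periodMean_ofReal (f : ℝ → ℝ) :
    periodMean (fun x => (f x : ℂ)) = ((periodMean f : ℝ) : ℂ) := by
  unfold periodMean
  rw [intervalIntegral.integral_ofReal]
  simp

lemma periodMean_nonneg {f : ℝ → ℝ} (h : ∀ x, 0 ≤ f x) : 0 ≤ periodMean f := by
  unfold periodMean
  have := integral_nonneg (μ := volume) Real.two_pi_pos.le fun x _ => h x
  exact smul_nonneg (by positivity) this

lemma norm_periodMean_le {f : ℝ → E} {g : ℝ → ℝ} (hg : Continuous g) (h : ∀ x, ‖f x‖ ≤ g x) :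
    ‖periodMean f‖ ≤ periodMean g := by
  unfold periodMean
  rw [norm_smul, Real.norm_of_nonneg (by positivity), smul_eq_mul]
  gcongr
  exact norm_integral_le_of_norm_le Real.two_pi_pos.le (Filter.Eventually.of_forall fun x _ => h x)
    (hg.intervalIntegrable _ _)

lemma periodMean_eq_zero_of_hasDerivAt [CompleteSpace E] {f f' : ℝ → E}
    (hf : Function.Periodic f (2 * Real.pi)) (hd : ∀ x, HasDerivAt f (f' x) x)
    (hc : Continuous f') : periodMean f' = 0 := by
  unfold periodMean
  rw [integral_eq_sub_of_hasDerivAt (fun x _ => hd x) (hc.intervalIntegrable _ _)]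
  have := hf 0
  rw [zero_add] at this
  rw [this, sub_self, smul_zero]

lemma continuousOn_periodMean {T : ℝ} {F : ℝ → ℝ → E}
    (hF : ContinuousOn (fun p : ℝ × ℝ => F p.1 p.2) (Ioo (-T) T ×ˢ univ)) :
    ContinuousOn (fun τ => periodMean (F τ)) (Ioo (-T) T) := by
  unfold periodMean
  refine ContinuousOn.const_smul ?_ _
  rw [continuousOn_iff_continuous_domRestrict]
  refine continuous_parametric_intervalIntegral_of_continuous' (μ := volume)
    (f := fun (τ : Ioo (-T) T) x => F τ x) ?_ _ _
  rw [← continuousOn_univ]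
  refine hF.comp (f := fun q : Ioo (-T) T × ℝ => ((q.1 : ℝ), q.2)) (by fun_prop) ?_
  intro q _
  exact ⟨q.1.2, mem_univ _⟩

/-- Fundamental theorem of calculus in time for the mean over a period. -/
lemma periodMean_sub_eq_integral [CompleteSpace E] {T : ℝ} {F F' : ℝ → ℝ → E}
    (hd : ∀ τ ∈ Ioo (-T) T, ∀ x, HasDerivAt (fun τ => F τ x) (F' τ x) τ)
    (hF : ∀ τ ∈ Ioo (-T) T, Continuous (F τ))
    (hF' : ContinuousOn (fun p : ℝ × ℝ => F' p.1 p.2) (Ioo (-T) T ×ˢ univ))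
    {t : ℝ} (ht : |t| < T) :
    periodMean (F t) - periodMean (F 0) = ∫ τ in (0 : ℝ)..t, periodMean (F' τ) := by
  have hsub := uIcc_zero_subset_Ioo ht
  have h0 : (0 : ℝ) ∈ Ioo (-T) T := hsub left_mem_uIcc
  have h1 : t ∈ Ioo (-T) T := hsub right_mem_uIcc
  rw [← periodMean_sub (hF t h1) (hF 0 h0)]
  unfold periodMean
  rw [intervalIntegral.integral_smul]
  congr 1
  rw [intervalIntegral_intervalIntegral_swap]
  · refine integral_congr fun x _ => ?_
    refine (integral_eq_sub_of_hasDerivAt (fun τ hτ => hd τ (hsub hτ) x) ?_).symm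
    refine ContinuousOn.intervalIntegrable ?_
    refine hF'.comp (f := fun τ : ℝ => (τ, x)) (by fun_prop) ?_
    intro τ hτ
    exact ⟨hsub hτ, mem_univ _⟩
  · have hc : IsCompact (uIcc 0 t ×ˢ uIcc 0 (2 * Real.pi)) := isCompact_uIcc.prod isCompact_uIcc
    refine IntegrableOn.mono_set (ContinuousOn.integrableOn_compact hc (hF'.mono ?_)) ?_
    · exact prod_mono hsub (subset_univ _)
    · exact prod_mono uIoc_subset_uIcc uIoc_subset_uIcc

end PeriodMean

/-! ### Fourier modes of smooth solutions -/

/-- The plane wave `e^{-i(kx + βk³τ)}`; its conjugate solves `w_τ = -β w_xxx`. -/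
noncomputable def wave (β : ℝ) (k : ℤ) (τ x : ℝ) : ℂ :=
  Complex.exp (-(Complex.I * ((k * x + β * k ^ 3 * τ : ℝ) : ℂ)))

lemma norm_wave (β : ℝ) (k : ℤ) (τ x : ℝ) : ‖wave β k τ x‖ = 1 := by
  unfold wave
  rw [← mul_neg, ← Complex.ofReal_neg, mul_comm, Complex.norm_exp_ofReal_mul_I]

lemma continuous_wave (β : ℝ) (k : ℤ) : Continuous (fun p : ℝ × ℝ => wave β k p.1 p.2) := by
  unfold wave
  fun_prop

lemma continuous_wave_right (β : ℝ) (k : ℤ) (τ : ℝ) : Continuous (wave β k τ) := by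
  unfold wave
  fun_prop

lemma hasDerivAt_wave_left (β : ℝ) (k : ℤ) (τ x : ℝ) :
    HasDerivAt (fun τ => wave β k τ x) (-(Complex.I * (β * k ^ 3)) * wave β k τ x) τ := by
  unfold wave
  have h : HasDerivAt (fun τ : ℝ => (k * x + β * k ^ 3 * τ : ℝ)) (β * k ^ 3) τ := by
    simpa using ((hasDerivAt_id τ).const_mul (β * k ^ 3)).const_add (k * x : ℝ)
  refine ((h.ofReal_comp.const_mul Complex.I).neg).cexp.congr_deriv ?_
  simp only [Pi.neg_apply]
  push_cast
  ring

lemma hasDerivAt_wave_right (β : ℝ) (k : ℤ) (τ x : ℝ) :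
    HasDerivAt (wave β k τ) (-(Complex.I * k) * wave β k τ x) x := by
  unfold wave
  have h : HasDerivAt (fun x : ℝ => (k * x + β * k ^ 3 * τ : ℝ)) (k : ℝ) x := by
    simpa using ((hasDerivAt_id x).const_mul (k : ℝ)).add_const (β * k ^ 3 * τ : ℝ)
  refine ((h.ofReal_comp.const_mul Complex.I).neg).cexp.congr_deriv ?_
  simp only [Pi.neg_apply]
  push_cast
  ring

lemma periodic_wave (β : ℝ) (k : ℤ) (τ : ℝ) : Function.Periodic (wave β k τ) (2 * Real.pi) := by
  intro x
  unfold wave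
  rw [Complex.exp_eq_exp_iff_exists_int]
  refine ⟨-k, ?_⟩
  push_cast
  ring

/-- The `k`-th Fourier coefficient of `f`, in the frame in which the linear flow
`w_τ + β w_xxx = 0` is constant in the time `τ`. -/
noncomputable def mode (β : ℝ) (k : ℤ) (τ : ℝ) (f : ℝ → ℝ) : ℂ :=
  periodMean fun x => wave β k τ x * (f x : ℂ)

lemma mode_eq_fourierCoeffOn (β : ℝ) (k : ℤ) (τ : ℝ) (f : ℝ → ℝ) :
    mode β k τ f = Complex.exp (-(Complex.I * (β * k ^ 3 * τ : ℝ))) *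
      fourierCoeffOn Real.two_pi_pos (fun x => (f x : ℂ)) k := by
  rw [fourierCoeffOn_eq_integral]
  unfold mode periodMean
  rw [mul_smul_comm, ← intervalIntegral.integral_const_mul]
  simp only [sub_zero, one_div]
  congr 1
  refine integral_congr fun x _ => ?_
  simp only [smul_eq_mul]
  rw [← mul_assoc]
  congr 1
  rw [fourier_coe_apply]
  unfold wave
  rw [← Complex.exp_add]
  congr 1
  push_cast
  have : (Real.pi : ℂ) ≠ 0 := by exact_mod_cast Real.pi_ne_zero
  field_simp
  ring

lemma periodic_iteratedDeriv {f : ℝ → ℝ} {c : ℝ} (hf : Function.Periodic f c) (n : ℕ) :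
    Function.Periodic (iteratedDeriv n f) c := by
  intro x
  have h := congrFun (iteratedDeriv_comp_add_const n f c) x
  rw [← h]
  congr 1
  funext z
  exact hf z

lemma hasDerivAt_iteratedDeriv {f : ℝ → ℝ} (hf : ContDiff ℝ ∞ f) (n : ℕ) (x : ℝ) :
    HasDerivAt (iteratedDeriv n f) (iteratedDeriv (n + 1) f x) x := by
  rw [iteratedDeriv_succ]
  refine DifferentiableAt.hasDerivAt ?_
  exact hf.differentiable_iteratedDeriv n (by exact_mod_cast ENat.natCast_lt_top n) x

lemma continuous_iteratedDeriv_of_smooth {f : ℝ → ℝ} (hf : ContDiff ℝ ∞ f) (n : ℕ) :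
    Continuous (iteratedDeriv n f) :=
  hf.continuous_iteratedDeriv n (by exact_mod_cast le_top)

section Strip

variable {T : ℝ} {f : ℝ → ℝ → ℝ}

lemma contDiff_slice
    (hf : ContDiffOn ℝ ∞ (fun p : ℝ × ℝ => f p.1 p.2) (Ioo (-T) T ×ˢ univ))
    {τ : ℝ} (hτ : τ ∈ Ioo (-T) T) : ContDiff ℝ ∞ (f τ) := by
  rw [← contDiffOn_univ]
  exact hf.comp (f := fun x : ℝ => (τ, x)) (by fun_prop) fun x _ => ⟨hτ, mem_univ _⟩

lemma hasDerivAt_time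
    (hf : ContDiffOn ℝ ∞ (fun p : ℝ × ℝ => f p.1 p.2) (Ioo (-T) T ×ˢ univ))
    {τ : ℝ} (hτ : τ ∈ Ioo (-T) T) (x : ℝ) :
    HasDerivAt (fun τ => f τ x) (deriv (fun τ => f τ x) τ) τ := by
  refine DifferentiableAt.hasDerivAt ?_
  have h1 : ContDiffOn ℝ ∞ (fun τ => f τ x) (Ioo (-T) T) :=
    hf.comp (f := fun τ : ℝ => (τ, x)) (by fun_prop) fun τ hτ => ⟨hτ, mem_univ _⟩
  exact (h1.contDiffAt (isOpen_Ioo.mem_nhds hτ)).differentiableAt (by simp)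

lemma continuousOn_deriv_time
    (hf : ContDiffOn ℝ ∞ (fun p : ℝ × ℝ => f p.1 p.2) (Ioo (-T) T ×ˢ univ)) :
    ContinuousOn (fun p : ℝ × ℝ => deriv (fun τ => f τ p.2) p.1) (Ioo (-T) T ×ˢ univ) := by
  have ho : IsOpen (Ioo (-T) T ×ˢ (univ : Set ℝ)) := isOpen_Ioo.prod isOpen_univ
  have h1 := hf.continuousOn_fderiv_of_isOpen ho (by simp)
  have h2 : ContinuousOn (fun p : ℝ × ℝ => fderiv ℝ (fun p : ℝ × ℝ => f p.1 p.2) p (1, 0))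
      (Ioo (-T) T ×ˢ univ) := h1.clm_apply continuousOn_const
  refine h2.congr fun p hp => ?_
  have h3 : HasFDerivAt (fun p : ℝ × ℝ => f p.1 p.2)
      (fderiv ℝ (fun p : ℝ × ℝ => f p.1 p.2) p) p :=
    ((hf.contDiffAt (ho.mem_nhds hp)).differentiableAt (by simp)).hasFDerivAt
  have h4 : HasDerivAt (fun τ : ℝ => (τ, p.2)) ((1 : ℝ), (0 : ℝ)) p.1 :=
    (hasDerivAt_id _).prodMk (hasDerivAt_const _ _)
  exact (h3.comp_hasDerivAt (f := fun τ : ℝ => (τ, p.2)) p.1 h4).deriv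

/-- Duhamel's formula for the Fourier modes of a smooth solution of `f_t + β f_xxx + g_x = 0`. -/
lemma mode_sub_eq_integral {g : ℝ → ℝ → ℝ} {β : ℝ}
    (hf : ContDiffOn ℝ ∞ (fun p : ℝ × ℝ => f p.1 p.2) (Ioo (-T) T ×ˢ univ))
    (hfp : ∀ τ ∈ Ioo (-T) T, Function.Periodic (f τ) (2 * Real.pi))
    (hg : ∀ τ ∈ Ioo (-T) T, ContDiff ℝ ∞ (g τ))
    (hgp : ∀ τ ∈ Ioo (-T) T, Function.Periodic (g τ) (2 * Real.pi))
    (heq : ∀ τ ∈ Ioo (-T) T, ∀ x,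
      deriv (fun τ => f τ x) τ + β * iteratedDeriv 3 (f τ) x + deriv (g τ) x = 0)
    (k : ℤ) {t : ℝ} (ht : |t| < T) :
    mode β k t (f t) - mode β k 0 (f 0) =
      ∫ τ in (0 : ℝ)..t, -(Complex.I * k) * mode β k τ (g τ) := by
  have hsub := uIcc_zero_subset_Ioo ht
  unfold mode
  rw [periodMean_sub_eq_integral (F := fun τ x => wave β k τ x * (f τ x : ℂ))
    (F' := fun τ x => -(Complex.I * (β * k ^ 3)) * wave β k τ x * (f τ x : ℂ) +
      wave β k τ x * ((deriv (fun τ => f τ x) τ : ℝ) : ℂ)) _ _ _ ht]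
  · refine integral_congr fun τ hτ => ?_
    have hτ' := hsub hτ
    have hfs := contDiff_slice hf hτ'
    have hgs := hg τ hτ'
    have hw := continuous_wave_right β k τ
    have c1 := continuous_iteratedDeriv_of_smooth hfs 1
    have c2 := continuous_iteratedDeriv_of_smooth hfs 2
    have c3 := continuous_iteratedDeriv_of_smooth hfs 3
    have g1 := continuous_iteratedDeriv_of_smooth hgs 1
    have c0 := hfs.continuous
    have g0 := hgs.continuous
    rw [← periodMean_const_mul, ← sub_eq_zero, ← periodMean_sub]
    · -- the integrand is an exact derivative, found by moving three derivatives off `f_xxx`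
      refine periodMean_eq_zero_of_hasDerivAt
        (f := fun x => -(wave β k τ x * (β * (iteratedDeriv 2 (f τ) x +
          Complex.I * k * iteratedDeriv 1 (f τ) x + (Complex.I * k) ^ 2 * (f τ x : ℂ)) + g τ x)))
        ?_ ?_ ?_
      · intro x
        simp only
        rw [periodic_wave, periodic_iteratedDeriv (hfp τ hτ'),
          periodic_iteratedDeriv (hfp τ hτ'), hfp τ hτ', hgp τ hτ']
      · intro x
        have d0 : HasDerivAt (f τ) (iteratedDeriv 1 (f τ) x) x := by
          simpa using hasDerivAt_iteratedDeriv hfs 0 x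
        have d1 := hasDerivAt_iteratedDeriv hfs 1 x
        have d2 := hasDerivAt_iteratedDeriv hfs 2 x
        have e0 : HasDerivAt (g τ) (deriv (g τ) x) x :=
          (hgs.differentiable (by simp) x).hasDerivAt
        have h := ((hasDerivAt_wave_right β k τ x).mul
          ((((d2.ofReal_comp.add (d1.ofReal_comp.const_mul (Complex.I * k))).add
            (d0.ofReal_comp.const_mul ((Complex.I * k) ^ 2))).const_mul (β : ℂ)).add
              e0.ofReal_comp)).neg
        refine h.congr_deriv ?_
        have hx : deriv (fun τ => f τ x) τ
            = -(β * iteratedDeriv 3 (f τ) x) - deriv (g τ) x := by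
          linarith [heq τ hτ' x]
        rw [hx]
        have hI3 : Complex.I ^ 3 = -Complex.I := Complex.I_pow_three
        push_cast
        simp only [Pi.add_apply]
        ring_nf
        simp only [hI3]
        ring
      · have hdt : Continuous fun x => deriv (fun τ => f τ x) τ := by
          have : (fun x => deriv (fun τ => f τ x) τ)
              = fun x => -(β * iteratedDeriv 3 (f τ) x) - deriv (g τ) x := by
            funext x
            linarith [heq τ hτ' x]
          rw [this]
          simp only [iteratedDeriv_one] at g1
          fun_prop
        fun_prop
    · have hdt : Continuous fun x => deriv (fun τ => f τ x) τ := by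
        have : (fun x => deriv (fun τ => f τ x) τ)
            = fun x => -(β * iteratedDeriv 3 (f τ) x) - deriv (g τ) x := by
          funext x
          linarith [heq τ hτ' x]
        rw [this]
        simp only [iteratedDeriv_one] at g1
        fun_prop
      fun_prop
    · fun_prop
  · intro τ hτ x
    exact (hasDerivAt_wave_left β k τ x).mul (hasDerivAt_time hf hτ x).ofReal_comp
  · intro τ hτ
    have := (contDiff_slice hf hτ).continuous
    have := continuous_wave_right β k τ
    fun_prop
  · have h1 := hf.continuousOn
    have h2 := continuousOn_deriv_time hf
    have h3 := (continuous_wave β k).continuousOn (s := Ioo (-T) T ×ˢ univ)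
    fun_prop

end Strip

/-- The mean of `u² + v²` over a period is conserved by smooth solutions. -/
lemma IsSmoothSolution.mass_eq {α T : ℝ} {u v : ℝ → ℝ → ℝ} (h : IsSmoothSolution α T u v)
    {t : ℝ} (ht : |t| < T) :
    periodMean (fun x => u t x ^ 2 + v t x ^ 2) = periodMean (fun x => u 0 x ^ 2 + v 0 x ^ 2) := by
  have hsub := uIcc_zero_subset_Ioo ht
  rw [← sub_eq_zero, periodMean_sub_eq_integral (F := fun τ x => u τ x ^ 2 + v τ x ^ 2)
    (F' := fun τ x => 2 * u τ x * deriv (fun τ => u τ x) τ +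
      2 * v τ x * deriv (fun τ => v τ x) τ) _ _ _ ht]
  · rw [integral_congr (g := fun _ => (0 : ℝ)), intervalIntegral.integral_zero]
    intro τ hτ
    have hτ' := hsub hτ
    have hu := contDiff_slice h.smooth_u hτ'
    have hv := contDiff_slice h.smooth_v hτ'
    refine periodMean_eq_zero_of_hasDerivAt
      (f := fun x => -(2 * (u τ x * iteratedDeriv 2 (u τ) x) - iteratedDeriv 1 (u τ) x ^ 2 +
        α * (2 * (v τ x * iteratedDeriv 2 (v τ) x) - iteratedDeriv 1 (v τ) x ^ 2) +
          2 * (u τ x * v τ x ^ 2))) ?_ ?_ ?_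
    · intro x
      simp only
      rw [periodic_iteratedDeriv (h.periodic_u τ hτ'),
        periodic_iteratedDeriv (h.periodic_v τ hτ'),
        periodic_iteratedDeriv (h.periodic_u τ hτ'),
        periodic_iteratedDeriv (h.periodic_v τ hτ'), h.periodic_u τ hτ',
        h.periodic_v τ hτ']
    · intro x
      have a0 : HasDerivAt (u τ) (iteratedDeriv 1 (u τ) x) x := by
        simpa using hasDerivAt_iteratedDeriv hu 0 x
      have a1 := hasDerivAt_iteratedDeriv hu 1 x
      have a2 := hasDerivAt_iteratedDeriv hu 2 x
      have b0 : HasDerivAt (v τ) (iteratedDeriv 1 (v τ) x) x := by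
        simpa using hasDerivAt_iteratedDeriv hv 0 x
      have b1 := hasDerivAt_iteratedDeriv hv 1 x
      have b2 := hasDerivAt_iteratedDeriv hv 2 x
      have key := ((((a0.mul a2).const_mul 2).sub (a1.pow 2)).add
        ((((b0.mul b2).const_mul 2).sub (b1.pow 2)).const_mul α)).add
          ((a0.mul (b0.pow 2)).const_mul 2) |>.neg
      refine key.congr_deriv ?_
      have e1 := h.eq_u τ hτ' x
      have e2 := h.eq_v τ hτ' x
      have e3 : deriv (fun y => u τ y * v τ y) x
          = iteratedDeriv 1 (u τ) x * v τ x + u τ x * iteratedDeriv 1 (v τ) x := (a0.mul b0).deriv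
      rw [e3] at e2
      simp only [iteratedDeriv_one] at e2
      simp only [Pi.pow_apply, iteratedDeriv_one]
      norm_num
      linear_combination (-2 * u τ x) * e1 + (-2 * v τ x) * e2
    · have c1 : Continuous fun x => deriv (fun τ => u τ x) τ := by
        rw [← continuousOn_univ]
        exact (continuousOn_deriv_time h.smooth_u).comp (f := fun x : ℝ => (τ, x)) (by fun_prop)
          fun x _ => ⟨hτ', mem_univ _⟩
      have c2 : Continuous fun x => deriv (fun τ => v τ x) τ := by
        rw [← continuousOn_univ]
        exact (continuousOn_deriv_time h.smooth_v).comp (f := fun x : ℝ => (τ, x)) (by fun_prop)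
          fun x _ => ⟨hτ', mem_univ _⟩
      have c3 := hu.continuous
      have c4 := hv.continuous
      fun_prop
  · intro τ hτ x
    have key := ((hasDerivAt_time h.smooth_u hτ x).pow 2).add
      ((hasDerivAt_time h.smooth_v hτ x).pow 2)
    refine key.congr_deriv ?_
    simp
  · intro τ hτ
    have c3 := (contDiff_slice h.smooth_u hτ).continuous
    have c4 := (contDiff_slice h.smooth_v hτ).continuous
    fun_prop
  · have h1 := h.smooth_u.continuousOn
    have h2 := h.smooth_v.continuousOn
    have h3 := continuousOn_deriv_time h.smooth_u
    have h4 := continuousOn_deriv_time h.smooth_v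
    fun_prop

/-- Duhamel's formula for the Fourier modes of `u`. -/
lemma IsSmoothSolution.mode_u {α T : ℝ} {u v : ℝ → ℝ → ℝ} (h : IsSmoothSolution α T u v)
    (k : ℤ) {t : ℝ} (ht : |t| < T) :
    mode 1 k t (u t) - mode 1 k 0 (u 0) =
      ∫ τ in (0 : ℝ)..t, -(Complex.I * k / 2) * mode 1 k τ (fun x => v τ x ^ 2) := by
  rw [mode_sub_eq_integral (g := fun τ x => 1 / 2 * v τ x ^ 2) h.smooth_u h.periodic_u _ _ _ k ht]
  · refine integral_congr fun τ _ => ?_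
    simp only [mode]
    rw [show (fun x => wave 1 k τ x * ((1 / 2 * v τ x ^ 2 : ℝ) : ℂ))
      = fun x => (1 / 2 : ℂ) * (wave 1 k τ x * ((v τ x ^ 2 : ℝ) : ℂ)) by
        funext x; push_cast; ring]
    rw [periodMean_const_mul]
    ring
  · intro τ hτ
    have := contDiff_slice h.smooth_v hτ
    fun_prop
  · intro τ hτ x
    simp only
    rw [h.periodic_v τ hτ]
  · intro τ hτ x
    have d := ((contDiff_slice h.smooth_v hτ).differentiable (by simp) x).hasDerivAt
    have e : deriv (fun x => 1 / 2 * v τ x ^ 2) x = v τ x * deriv (v τ) x := by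
      have d' := (d.pow 2).const_mul (1 / 2 : ℝ)
      refine HasDerivAt.deriv (d'.congr_deriv ?_)
      simp
      ring
    rw [e, one_mul]
    exact h.eq_u τ hτ x

/-- Duhamel's formula for the Fourier modes of `v`. -/
lemma IsSmoothSolution.mode_v {α T : ℝ} {u v : ℝ → ℝ → ℝ} (h : IsSmoothSolution α T u v)
    (k : ℤ) {t : ℝ} (ht : |t| < T) :
    mode α k t (v t) - mode α k 0 (v 0) =
      ∫ τ in (0 : ℝ)..t, -(Complex.I * k) * mode α k τ (fun x => u τ x * v τ x) := by
  refine mode_sub_eq_integral (g := fun τ x => u τ x * v τ x) h.smooth_v h.periodic_v ?_ ?_ ?_ k ht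
  · intro τ hτ
    exact (contDiff_slice h.smooth_u hτ).mul (contDiff_slice h.smooth_v hτ)
  · intro τ hτ
    exact (h.periodic_u τ hτ).mul (h.periodic_v τ hτ)
  · intro τ hτ x
    exact h.eq_v τ hτ x

end MajdaBiello

namespace MajdaBiello

open MeasureTheory Set intervalIntegral

/-! ### Products with trigonometric polynomials -/

/-- The oscillation `e^{iθτ}`. -/
noncomputable def osc (θ τ : ℝ) : ℂ := Complex.exp (Complex.I * ((θ * τ : ℝ) : ℂ))

lemma norm_osc (θ τ : ℝ) : ‖osc θ τ‖ = 1 := by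
  rw [osc, mul_comm, Complex.norm_exp_ofReal_mul_I]

lemma continuous_osc (θ : ℝ) : Continuous (osc θ) := by
  unfold osc
  fun_prop

/-- The resonance function `βj³ + γl³ - δ(j+l)³` of the interaction of a `j`-mode of dispersion `β`
with an `l`-mode of dispersion `γ` into a mode of dispersion `δ`. -/
def res (β γ δ : ℝ) (j l : ℤ) : ℝ := β * j ^ 3 + γ * l ^ 3 - δ * (j + l) ^ 3

lemma wave_mul_wave (β γ δ : ℝ) (j k : ℤ) (τ x : ℝ) :
    wave δ k τ x * wave β (-j) τ x = osc (res β γ δ j (k - j)) τ * wave γ (k - j) τ x := by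
  unfold wave osc res
  rw [← Complex.exp_add, ← Complex.exp_add]
  congr 1
  push_cast
  ring

lemma mode_wave (β : ℝ) (k j : ℤ) (τ : ℝ) :
    periodMean (fun x => wave β k τ x * wave β (-j) τ x) = if k = j then 1 else 0 := by
  have h : ∀ x, wave β k τ x * wave β (-j) τ x
      = osc (res β 0 β j (k - j)) τ * wave 0 (k - j) 0 x := by
    intro x
    rw [wave_mul_wave β 0 β j k τ x]
    simp [wave]
  simp_rw [h]
  rw [periodMean_const_mul]
  split_ifs with hkj
  · subst hkj
    have h1 : wave 0 (k - k) 0 = fun _ => (1 : ℂ) := by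
      funext x; simp [wave]
    have h2 : osc (res β 0 β k (k - k)) τ = 1 := by simp [osc, res]
    have hpi : (Real.pi : ℂ) ≠ 0 := by exact_mod_cast Real.pi_ne_zero
    rw [h1, h2, periodMean]
    simp
    field_simp
  · have hne : (-(Complex.I * ((k - j : ℤ) : ℂ))) ≠ 0 := by
      rw [neg_ne_zero]
      refine mul_ne_zero Complex.I_ne_zero ?_
      exact_mod_cast sub_ne_zero.mpr hkj
    have h1 : periodMean (fun x => wave 0 (k - j) 0 x) = 0 := by
      have := periodMean_eq_zero_of_hasDerivAt (periodic_wave 0 (k - j) 0)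
        (hasDerivAt_wave_right 0 (k - j) 0)
        (continuous_const.mul (continuous_wave_right 0 (k - j) 0))
      rw [periodMean_const_mul] at this
      exact (mul_eq_zero.mp this).resolve_left hne
    rw [h1, mul_zero]

/-- The linear wave with profile `∑_{k ∈ S} a_k cos (kx)`. -/
noncomputable def cosPoly (S : Finset ℤ) (β : ℝ) (a : ℤ → ℝ) (τ x : ℝ) : ℝ :=
  ∑ k ∈ S, a k * Real.cos (k * x + β * k ^ 3 * τ)

/-- `a` is an even real sequence supported in the symmetric set `S`, so that
`∑_{k ∈ S} a_k cos (kx)` has Fourier coefficients `a`. -/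
structure IsEvenOn (S : Finset ℤ) (a : ℤ → ℝ) : Prop where
  symm : ∀ k ∈ S, -k ∈ S
  even : ∀ k, a (-k) = a k
  supp : ∀ k, k ∉ S → a k = 0

section CosPoly

variable {S : Finset ℤ} {a b : ℤ → ℝ} (β γ δ : ℝ)

lemma continuous_cosPoly (τ : ℝ) : Continuous (cosPoly S β a τ) := by
  unfold cosPoly
  fun_prop

lemma IsEvenOn.sum_neg (ha : IsEvenOn S a) (f : ℤ → ℂ) :
    ∑ k ∈ S, (a k : ℂ) * f (-k) = ∑ k ∈ S, (a k : ℂ) * f k := by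
  refine Finset.sum_nbij' (fun k => -k) (fun k => -k) (fun k hk => ha.symm k hk)
    (fun k hk => ha.symm k hk) (fun k _ => neg_neg k) (fun k _ => neg_neg k) fun k _ => ?_
  rw [ha.even]

lemma IsEvenOn.cosPoly_eq (ha : IsEvenOn S a) (τ x : ℝ) :
    (cosPoly S β a τ x : ℂ) = ∑ j ∈ S, (a j : ℂ) * wave β (-j) τ x := by
  have h : (cosPoly S β a τ x : ℂ)
      = (∑ j ∈ S, (a j : ℂ) * wave β (-j) τ x + ∑ j ∈ S, (a j : ℂ) * wave β j τ x) / 2 := by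
    unfold cosPoly
    rw [← Finset.sum_add_distrib, Finset.sum_div, Complex.ofReal_sum]
    refine Finset.sum_congr rfl fun j _ => ?_
    rw [Complex.ofReal_mul, Complex.ofReal_cos, Complex.cos]
    have e1 : wave β (-j) τ x = Complex.exp (((j * x + β * j ^ 3 * τ : ℝ) : ℂ) * Complex.I) := by
      unfold wave
      congr 1
      push_cast
      ring
    have e2 : wave β j τ x = Complex.exp (-((j * x + β * j ^ 3 * τ : ℝ) : ℂ) * Complex.I) := by
      unfold wave
      congr 1
      ring
    rw [e1, e2]
    ring
  rw [h, ha.sum_neg fun j => wave β j τ x]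
  ring

/-- Interaction of a mode with a trigonometric polynomial. -/
lemma IsEvenOn.mode_mul (ha : IsEvenOn S a) (k : ℤ) (τ : ℝ) {f : ℝ → ℝ} (hf : Continuous f) :
    mode δ k τ (fun x => cosPoly S β a τ x * f x)
      = ∑ j ∈ S, (a j : ℂ) * osc (res β γ δ j (k - j)) τ * mode γ (k - j) τ f := by
  unfold mode
  simp_rw [Complex.ofReal_mul, ha.cosPoly_eq]
  have h : (fun x => wave δ k τ x * ((∑ j ∈ S, (a j : ℂ) * wave β (-j) τ x) * (f x : ℂ)))
      = fun x => ∑ j ∈ S, ((a j : ℂ) * osc (res β γ δ j (k - j)) τ) *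
        (wave γ (k - j) τ x * (f x : ℂ)) := by
    funext x
    rw [Finset.sum_mul, Finset.mul_sum]
    refine Finset.sum_congr rfl fun j _ => ?_
    linear_combination ((a j : ℂ) * (f x : ℂ)) * wave_mul_wave β γ δ j k τ x
  rw [h, periodMean_sum]
  · simp_rw [periodMean_const_mul]
  · intro j _
    have := continuous_wave_right γ (k - j) τ
    fun_prop

lemma IsEvenOn.mode_cosPoly (ha : IsEvenOn S a) (k : ℤ) (τ : ℝ) :
    mode β k τ (cosPoly S β a τ) = a k := by
  unfold mode
  simp_rw [ha.cosPoly_eq, Finset.mul_sum, mul_left_comm]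
  rw [periodMean_sum]
  · simp_rw [periodMean_const_mul, mode_wave]
    simp only [mul_ite, mul_one, mul_zero, Finset.sum_ite_eq]
    split_ifs with hk
    · rfl
    · rw [ha.supp k hk]; simp
  · intro j _
    have := continuous_wave_right β k τ
    have := continuous_wave_right β (-j) τ
    fun_prop

lemma IsEvenOn.periodMean_mul (ha : IsEvenOn S a) (τ : ℝ) {f : ℝ → ℝ} (hf : Continuous f) :
    ((periodMean fun x => cosPoly S β a τ x * f x : ℝ) : ℂ)
      = ∑ k ∈ S, (a k : ℂ) * mode β k τ f := by
  rw [← periodMean_ofReal]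
  simp_rw [Complex.ofReal_mul, ha.cosPoly_eq]
  rw [← ha.sum_neg fun k => mode β k τ f]
  simp_rw [Finset.sum_mul, mul_assoc]
  rw [periodMean_sum]
  · simp_rw [periodMean_const_mul]
    rfl
  · intro j _
    have := continuous_wave_right β (-j) τ
    fun_prop

lemma IsEvenOn.periodMean_sq (ha : IsEvenOn S a) (τ : ℝ) :
    periodMean (fun x => cosPoly S β a τ x ^ 2) = ∑ k ∈ S, a k ^ 2 := by
  have h := ha.periodMean_mul β τ (continuous_cosPoly (S := S) (a := a) β τ)
  simp_rw [ha.mode_cosPoly] at h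
  have h2 : (fun x => cosPoly S β a τ x ^ 2)
      = fun x => cosPoly S β a τ x * cosPoly S β a τ x := by
    funext x; ring
  rw [h2]
  apply Complex.ofReal_injective
  rw [h]
  push_cast
  exact Finset.sum_congr rfl fun k _ => by ring

end CosPoly

section Mode

variable (β : ℝ) (k : ℤ) (τ : ℝ)

lemma mode_add {f g : ℝ → ℝ} (hf : Continuous f) (hg : Continuous g) :
    mode β k τ (fun x => f x + g x) = mode β k τ f + mode β k τ g := by
  unfold mode
  have := continuous_wave_right β k τ
  rw [← periodMean_add (by fun_prop) (by fun_prop)]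
  simp_rw [Complex.ofReal_add, mul_add]

lemma mode_const_mul (c : ℝ) (f : ℝ → ℝ) :
    mode β k τ (fun x => c * f x) = c * mode β k τ f := by
  unfold mode
  rw [← periodMean_const_mul]
  simp_rw [Complex.ofReal_mul, mul_left_comm]

lemma norm_mode_le {f g : ℝ → ℝ} (hg : Continuous g) (h : ∀ x, |f x| ≤ g x) :
    ‖mode β k τ f‖ ≤ periodMean g := by
  refine norm_periodMean_le hg fun x => ?_
  rw [norm_mul, norm_wave, one_mul, Complex.norm_real]
  exact h x

end Mode

end MajdaBiello

namespace MajdaBiello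

open MeasureTheory Set intervalIntegral Filter Topology Asymptotics

/-! ### Expansion of solutions in the size of the data -/

/-- Solutions `(u δ, v δ)` on `(-T, T)`, `|δ| < δ₀`, with the data `δ (∑ a_k cos kx, ∑ b_k cos
kx)`. -/
structure SolutionFamily (α T δ₀ : ℝ) (S : Finset ℤ) (a b : ℤ → ℝ) (u v : ℝ → ℝ → ℝ → ℝ) :
    Prop where
  pos : 0 < δ₀
  even_a : IsEvenOn S a
  even_b : IsEvenOn S b
  sol : ∀ δ, |δ| < δ₀ → IsSmoothSolution α T (u δ) (v δ)
  init_u : ∀ δ, |δ| < δ₀ → u δ 0 = fun x => δ * cosPoly S 1 a 0 x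
  init_v : ∀ δ, |δ| < δ₀ → v δ 0 = fun x => δ * cosPoly S α b 0 x

/-- The mean over a period of the squared distance of `(u, v)` from `δ` times the linear wave. -/
noncomputable def remainder (α : ℝ) (S : Finset ℤ) (a b : ℤ → ℝ) (u v : ℝ → ℝ → ℝ → ℝ)
    (δ τ : ℝ) : ℝ :=
  periodMean fun x => (u δ τ x - δ * cosPoly S 1 a τ x) ^ 2 + (v δ τ x - δ * cosPoly S α b τ x) ^ 2

lemma remainder_nonneg (α : ℝ) (S : Finset ℤ) (a b : ℤ → ℝ) (u v : ℝ → ℝ → ℝ → ℝ) (δ τ : ℝ) :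
    0 ≤ remainder α S a b u v δ τ :=
  periodMean_nonneg fun x => by positivity

/-- The second Picard iterate of `u`, as a Fourier mode in the frame of the linear flow. -/
noncomputable def secondU (α : ℝ) (S : Finset ℤ) (b : ℤ → ℝ) (k : ℤ) (τ : ℝ) : ℂ :=
  ∫ σ in (0 : ℝ)..τ, -(Complex.I * k / 2) *
    ∑ j ∈ S, (b j : ℂ) * osc (res α α 1 j (k - j)) σ * b (k - j)

/-- The second Picard iterate of `v`, as a Fourier mode in the frame of the linear flow. -/
noncomputable def secondV (α : ℝ) (S : Finset ℤ) (a b : ℤ → ℝ) (k : ℤ) (τ : ℝ) : ℂ :=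
  ∫ σ in (0 : ℝ)..τ, -(Complex.I * k) *
    ∑ j ∈ S, (a j : ℂ) * osc (res 1 α α j (k - j)) σ * b (k - j)

/-- The third Picard iterate of `v`, as a Fourier mode in the frame of the linear flow. -/
noncomputable def thirdV (α : ℝ) (S : Finset ℤ) (a b : ℤ → ℝ) (k : ℤ) (τ : ℝ) : ℂ :=
  ∫ σ in (0 : ℝ)..τ, -(Complex.I * k) *
    (∑ j ∈ S, (a j : ℂ) * osc (res 1 α α j (k - j)) σ * secondV α S a b (k - j) σ +
      ∑ j ∈ S, (b j : ℂ) * osc (res α 1 α j (k - j)) σ * secondU α S b (k - j) σ)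

lemma continuous_secondU (α : ℝ) (S : Finset ℤ) (b : ℤ → ℝ) (k : ℤ) :
    Continuous (secondU α S b k) := by
  unfold secondU
  have := continuous_osc
  exact continuous_primitive (fun _ _ => Continuous.intervalIntegrable (by fun_prop) _ _) _

lemma continuous_secondV (α : ℝ) (S : Finset ℤ) (a b : ℤ → ℝ) (k : ℤ) :
    Continuous (secondV α S a b k) := by
  unfold secondV
  have := continuous_osc
  exact continuous_primitive (fun _ _ => Continuous.intervalIntegrable (by fun_prop) _ _) _

/-- Integration in time preserves bounds that are uniform on a time interval containing `0`. -/
lemma isBigO_integral {t : ℝ} {F : ℝ × ℝ → ℂ} {n : ℕ}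
    (hF : F =O[𝓝 0 ×ˢ 𝓟 (uIcc 0 t)] fun p => p.1 ^ n) :
    (fun p : ℝ × ℝ => ∫ σ in (0 : ℝ)..p.2, F (p.1, σ)) =O[𝓝 0 ×ˢ 𝓟 (uIcc 0 t)]
      fun p => p.1 ^ n := by
  obtain ⟨C, hC0, hC⟩ := hF.exists_nonneg
  rw [isBigOWith_iff, eventually_prod_principal_iff] at hC
  refine IsBigO.of_bound (C * |t|) ?_
  rw [eventually_prod_principal_iff]
  filter_upwards [hC] with δ hδ τ hτ
  have hsub : uIoc 0 τ ⊆ uIcc 0 t :=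
    uIoc_subset_uIcc.trans (uIcc_subset_uIcc left_mem_uIcc hτ)
  have h1 := norm_integral_le_of_norm_le_const (a := 0) (b := τ)
    (f := fun σ => F (δ, σ)) (C := C * ‖δ ^ n‖) fun σ hσ => hδ σ (hsub hσ)
  refine h1.trans ?_
  have h2 : |τ - 0| ≤ |t| := by
    have := abs_sub_left_of_mem_uIcc hτ
    simpa using this
  calc C * ‖δ ^ n‖ * |τ - 0| ≤ C * ‖δ ^ n‖ * |t| := by gcongr
    _ = C * |t| * ‖δ ^ n‖ := by ring

/-- A nonnegative function of `δ` and `τ` that equals `c(τ) δ³` up to `O(δ⁴)` is itself `O(δ⁴)`: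
otherwise it would be negative for small `δ` of one of the signs. -/
lemma isBigO_of_nonneg_of_cubic {t : ℝ} {R : ℝ → ℝ → ℝ} {c : ℝ → ℝ}
    (hR : ∀ᶠ δ in 𝓝 (0 : ℝ), ∀ τ ∈ uIcc 0 t, 0 ≤ R δ τ)
    (h : (fun p : ℝ × ℝ => R p.1 p.2 - c p.2 * p.1 ^ 3) =O[𝓝 0 ×ˢ 𝓟 (uIcc 0 t)]
      fun p => p.1 ^ 4) :
    (fun p : ℝ × ℝ => R p.1 p.2) =O[𝓝 0 ×ˢ 𝓟 (uIcc 0 t)] fun p => p.1 ^ 4 := by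
  obtain ⟨C, hC0, hC⟩ := h.exists_nonneg
  rw [isBigOWith_iff, eventually_prod_principal_iff] at hC
  obtain ⟨ε, hε, hball⟩ := Metric.eventually_nhds_iff.mp (hC.and hR)
  have key : ∀ τ ∈ uIcc 0 t, ∀ δ : ℝ, 0 < δ → δ < ε → |c τ| ≤ C * δ := by
    intro τ hτ δ h0 h1
    have e1 := hball (y := δ) (by simpa [abs_of_pos h0] using h1)
    have e2 := hball (y := -δ) (by simpa [abs_of_pos h0] using h1)
    have f1 := e1.1 τ hτ
    have f2 := e2.1 τ hτ
    have g1 := e1.2 τ hτ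
    have g2 := e2.2 τ hτ
    simp only [Real.norm_eq_abs] at f1 f2
    rw [abs_of_nonneg (by positivity : 0 ≤ δ ^ 4)] at f1
    rw [abs_of_nonneg (by positivity : 0 ≤ (-δ) ^ 4)] at f2
    have f1' := (abs_le.mp f1).2
    have f2' := (abs_le.mp f2).2
    have h3 : 0 < δ ^ 3 := by positivity
    rw [abs_le]
    constructor
    · refine le_of_mul_le_mul_right ?_ h3
      nlinarith
    · refine le_of_mul_le_mul_right ?_ h3
      nlinarith
  have hc : ∀ τ ∈ uIcc 0 t, c τ = 0 := by
    intro τ hτ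
    rw [← abs_eq_zero]
    refine le_antisymm ?_ (abs_nonneg _)
    refine le_of_forall_pos_le_add fun η hη => ?_
    have hδ : 0 < min (ε / 2) (η / (C + 1)) := by positivity
    refine (key τ hτ _ hδ ((min_le_left _ _).trans_lt (by linarith))).trans ?_
    calc C * min (ε / 2) (η / (C + 1)) ≤ C * (η / (C + 1)) := by
          gcongr; exact min_le_right _ _
      _ ≤ 0 + η := by
          rw [zero_add, mul_div_assoc', div_le_iff₀ (by positivity)]
          nlinarith
  refine IsBigO.of_bound C ?_
  rw [eventually_prod_principal_iff]
  filter_upwards [hC] with δ hδ τ hτ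
  have := hδ τ hτ
  simpa [hc τ hτ] using this

namespace SolutionFamily

variable {α T δ₀ : ℝ} {S : Finset ℤ} {a b : ℤ → ℝ} {u v : ℝ → ℝ → ℝ → ℝ}

section Pointwise

variable (h : SolutionFamily α T δ₀ S a b u v) {δ τ : ℝ} (hδ : |δ| < δ₀) (hτ : |τ| < T)
include h hδ hτ

lemma continuous_u : Continuous (u δ τ) :=
  (contDiff_slice (h.sol δ hδ).smooth_u (abs_lt.mp hτ)).continuous

lemma continuous_v : Continuous (v δ τ) :=
  (contDiff_slice (h.sol δ hδ).smooth_v (abs_lt.mp hτ)).continuous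

lemma mass_eq : periodMean (fun x => u δ τ x ^ 2 + v δ τ x ^ 2)
    = δ ^ 2 * ∑ k ∈ S, (a k ^ 2 + b k ^ 2) := by
  rw [(h.sol δ hδ).mass_eq hτ, h.init_u δ hδ, h.init_v δ hδ]
  have h1 := continuous_cosPoly (S := S) (a := a) 1 0
  have h2 := continuous_cosPoly (S := S) (a := b) α 0
  simp_rw [mul_pow]
  rw [periodMean_add (by fun_prop) (by fun_prop), periodMean_const_mul, periodMean_const_mul,
    h.even_a.periodMean_sq, h.even_b.periodMean_sq, Finset.sum_add_distrib]
  ring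

/-- By conservation of mass, the remainder is controlled by finitely many Fourier modes. -/
lemma remainder_eq : (remainder α S a b u v δ τ : ℂ) =
    -(2 * δ) * ∑ k ∈ S, ((a k : ℂ) * (mode 1 k τ (u δ τ) - δ * a k) +
      (b k : ℂ) * (mode α k τ (v δ τ) - δ * b k)) := by
  have cu := h.continuous_u hδ hτ
  have cv := h.continuous_v hδ hτ
  have ca := continuous_cosPoly (S := S) (a := a) 1 τ
  have cb := continuous_cosPoly (S := S) (a := b) α τ
  have e1 : remainder α S a b u v δ τ
      = δ ^ 2 * ∑ k ∈ S, (a k ^ 2 + b k ^ 2)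
        - 2 * δ * periodMean (fun x => cosPoly S 1 a τ x * u δ τ x)
        - 2 * δ * periodMean (fun x => cosPoly S α b τ x * v δ τ x)
        + δ ^ 2 * ∑ k ∈ S, a k ^ 2 + δ ^ 2 * ∑ k ∈ S, b k ^ 2 := by
    rw [← h.mass_eq hδ hτ, ← h.even_a.periodMean_sq 1 τ, ← h.even_b.periodMean_sq α τ]
    simp_rw [← periodMean_const_mul]
    rw [← periodMean_sub (by fun_prop) (by fun_prop), ← periodMean_sub (by fun_prop) (by fun_prop),
      ← periodMean_add (by fun_prop) (by fun_prop), ← periodMean_add (by fun_prop) (by fun_prop)]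
    unfold remainder
    congr 1
    funext x
    ring
  rw [e1]
  push_cast
  rw [h.even_a.periodMean_mul 1 τ cu, h.even_b.periodMean_mul α τ cv]
  simp only [Finset.mul_sum, ← Finset.sum_sub_distrib, ← Finset.sum_add_distrib]
  refine Finset.sum_congr rfl fun k _ => ?_
  ring

lemma norm_mode_sq_le (k : ℤ) : ‖mode 1 k τ (fun x => v δ τ x ^ 2)‖ ≤
    (∑ k ∈ S, (a k ^ 2 + b k ^ 2)) * δ ^ 2 := by
  have cu := h.continuous_u hδ hτ
  have cv := h.continuous_v hδ hτ
  rw [mul_comm, ← h.mass_eq hδ hτ]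
  refine norm_mode_le _ _ _ (by fun_prop) fun x => ?_
  rw [abs_of_nonneg (by positivity)]
  nlinarith [sq_nonneg (u δ τ x)]

lemma norm_mode_mul_le (k : ℤ) : ‖mode α k τ (fun x => u δ τ x * v δ τ x)‖ ≤
    (∑ k ∈ S, (a k ^ 2 + b k ^ 2)) * δ ^ 2 := by
  have cu := h.continuous_u hδ hτ
  have cv := h.continuous_v hδ hτ
  rw [mul_comm, ← h.mass_eq hδ hτ]
  refine norm_mode_le _ _ _ (by fun_prop) fun x => ?_
  rw [abs_le]
  constructor <;> nlinarith [sq_nonneg (u δ τ x + v δ τ x), sq_nonneg (u δ τ x - v δ τ x),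
    sq_nonneg (u δ τ x), sq_nonneg (v δ τ x)]

/-- The nonlinearity `v²`, up to the remainder, in terms of finitely many Fourier modes of `v`. -/
lemma norm_mode_sq_sub_le (k : ℤ) : ‖mode 1 k τ (fun x => v δ τ x ^ 2) -
    ∑ j ∈ S, (b j : ℂ) * osc (res α α 1 j (k - j)) τ *
      (2 * δ * mode α (k - j) τ (v δ τ) - δ ^ 2 * b (k - j))‖ ≤ remainder α S a b u v δ τ := by
  have cu := h.continuous_u hδ hτ
  have cv := h.continuous_v hδ hτ
  have ca := continuous_cosPoly (S := S) (a := a) 1 τ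
  have cb := continuous_cosPoly (S := S) (a := b) α τ
  have e : mode 1 k τ (fun x => v δ τ x ^ 2) =
      mode 1 k τ (fun x => (v δ τ x - δ * cosPoly S α b τ x) ^ 2) +
        ∑ j ∈ S, (b j : ℂ) * osc (res α α 1 j (k - j)) τ *
          (2 * δ * mode α (k - j) τ (v δ τ) - δ ^ 2 * b (k - j)) := by
    have e1 : (fun x => v δ τ x ^ 2) = fun x => ((v δ τ x - δ * cosPoly S α b τ x) ^ 2 +
        (2 * δ) * (cosPoly S α b τ x * v δ τ x)) +
          (-δ ^ 2) * (cosPoly S α b τ x * cosPoly S α b τ x) := by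
      funext x; ring
    rw [e1, mode_add _ _ _ (by fun_prop) (by fun_prop), mode_add _ _ _ (by fun_prop) (by fun_prop),
      mode_const_mul, mode_const_mul, h.even_b.mode_mul α α 1 k τ cv,
      h.even_b.mode_mul α α 1 k τ cb]
    simp_rw [h.even_b.mode_cosPoly]
    rw [add_assoc, Finset.mul_sum, Finset.mul_sum, ← Finset.sum_add_distrib]
    congr 1
    refine Finset.sum_congr rfl fun j _ => ?_
    push_cast
    ring
  rw [e, add_sub_cancel_right]
  refine norm_mode_le _ _ _ (by fun_prop) fun x => ?_
  rw [abs_of_nonneg (by positivity)]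
  nlinarith [sq_nonneg (u δ τ x - δ * cosPoly S 1 a τ x)]

/-- The nonlinearity `uv`, up to the remainder, in terms of finitely many Fourier modes of `u` and
`v`. -/
lemma norm_mode_mul_sub_le (k : ℤ) : ‖mode α k τ (fun x => u δ τ x * v δ τ x) -
    (∑ j ∈ S, (a j : ℂ) * osc (res 1 α α j (k - j)) τ * (δ * mode α (k - j) τ (v δ τ)) +
      ∑ j ∈ S, (b j : ℂ) * osc (res α 1 α j (k - j)) τ *
        (δ * (mode 1 (k - j) τ (u δ τ) - δ * a (k - j))))‖ ≤ remainder α S a b u v δ τ := by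
  have cu := h.continuous_u hδ hτ
  have cv := h.continuous_v hδ hτ
  have ca := continuous_cosPoly (S := S) (a := a) 1 τ
  have cb := continuous_cosPoly (S := S) (a := b) α τ
  have e : mode α k τ (fun x => u δ τ x * v δ τ x) =
      mode α k τ (fun x => (u δ τ x - δ * cosPoly S 1 a τ x) *
        (v δ τ x - δ * cosPoly S α b τ x)) +
        (∑ j ∈ S, (a j : ℂ) * osc (res 1 α α j (k - j)) τ * (δ * mode α (k - j) τ (v δ τ)) +
          ∑ j ∈ S, (b j : ℂ) * osc (res α 1 α j (k - j)) τ *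
            (δ * (mode 1 (k - j) τ (u δ τ) - δ * a (k - j)))) := by
    have e1 : (fun x => u δ τ x * v δ τ x) = fun x => (((u δ τ x - δ * cosPoly S 1 a τ x) *
        (v δ τ x - δ * cosPoly S α b τ x) +
        δ * (cosPoly S 1 a τ x * v δ τ x)) + δ * (cosPoly S α b τ x * u δ τ x)) +
          (-δ ^ 2) * (cosPoly S α b τ x * cosPoly S 1 a τ x) := by
      funext x; ring
    rw [e1, mode_add _ _ _ (by fun_prop) (by fun_prop), mode_add _ _ _ (by fun_prop) (by fun_prop),
      mode_add _ _ _ (by fun_prop) (by fun_prop),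
      mode_const_mul, mode_const_mul, mode_const_mul, h.even_a.mode_mul 1 α α k τ cv,
      h.even_b.mode_mul α 1 α k τ cu, h.even_b.mode_mul α 1 α k τ ca]
    simp_rw [h.even_a.mode_cosPoly]
    rw [add_assoc, add_assoc, Finset.mul_sum, Finset.mul_sum, Finset.mul_sum,
      ← Finset.sum_add_distrib]
    congr 2
    · exact Finset.sum_congr rfl fun j _ => by ring
    · refine Finset.sum_congr rfl fun j _ => ?_
      push_cast
      ring
  rw [e, add_sub_cancel_right]
  refine norm_mode_le _ _ _ (by fun_prop) fun x => ?_
  rw [abs_le]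
  constructor <;> nlinarith [sq_nonneg (u δ τ x - δ * cosPoly S 1 a τ x),
    sq_nonneg (v δ τ x - δ * cosPoly S α b τ x),
    sq_nonneg (u δ τ x - δ * cosPoly S 1 a τ x + (v δ τ x - δ * cosPoly S α b τ x)),
    sq_nonneg (u δ τ x - δ * cosPoly S 1 a τ x - (v δ τ x - δ * cosPoly S α b τ x))]

lemma mode_u_sub (k : ℤ) : mode 1 k τ (u δ τ) - δ * a k =
    ∫ σ in (0 : ℝ)..τ, -(Complex.I * k / 2) * mode 1 k σ (fun x => v δ σ x ^ 2) := by
  rw [← (h.sol δ hδ).mode_u k hτ, h.init_u δ hδ, mode_const_mul]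
  congr 2
  rw [← h.even_a.mode_cosPoly 1 k 0]

lemma mode_v_sub (k : ℤ) : mode α k τ (v δ τ) - δ * b k =
    ∫ σ in (0 : ℝ)..τ, -(Complex.I * k) * mode α k σ (fun x => u δ σ x * v δ σ x) := by
  rw [← (h.sol δ hδ).mode_v k hτ, h.init_v δ hδ, mode_const_mul]
  congr 2
  rw [← h.even_b.mode_cosPoly α k 0]

lemma intervalIntegrable_mode_sq (k : ℤ) :
    IntervalIntegrable (fun σ => mode 1 k σ (fun x => v δ σ x ^ 2)) volume 0 τ := by
  have h1 : ContinuousOn (fun σ => mode 1 k σ (fun x => v δ σ x ^ 2)) (Ioo (-T) T) := by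
    refine continuousOn_periodMean ?_
    have h2 := (h.sol δ hδ).smooth_v.continuousOn
    have h3 := (continuous_wave 1 k).continuousOn (s := Ioo (-T) T ×ˢ univ)
    fun_prop
  exact (h1.mono (uIcc_zero_subset_Ioo hτ)).intervalIntegrable

lemma intervalIntegrable_mode_mul (k : ℤ) :
    IntervalIntegrable (fun σ => mode α k σ (fun x => u δ σ x * v δ σ x)) volume 0 τ := by
  have h1 : ContinuousOn (fun σ => mode α k σ (fun x => u δ σ x * v δ σ x)) (Ioo (-T) T) := by
    refine continuousOn_periodMean ?_
    have h0 := (h.sol δ hδ).smooth_u.continuousOn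
    have h2 := (h.sol δ hδ).smooth_v.continuousOn
    have h3 := (continuous_wave α k).continuousOn (s := Ioo (-T) T ×ˢ univ)
    fun_prop
  exact (h1.mono (uIcc_zero_subset_Ioo hτ)).intervalIntegrable

end Pointwise

end SolutionFamily

end MajdaBiello

namespace MajdaBiello

open MeasureTheory Set intervalIntegral Filter Topology Asymptotics

/-! ### Asymptotic expansions of the Fourier modes -/

lemma isBigO_sum_osc {t : ℝ} {S : Finset ℤ} {F : ℤ → ℝ × ℝ → ℂ} {n : ℕ} (a : ℤ → ℝ) (θ : ℤ → ℝ)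
    (hF : ∀ j ∈ S, F j =O[𝓝 0 ×ˢ 𝓟 (uIcc 0 t)] fun p => p.1 ^ n) :
    (fun p : ℝ × ℝ => ∑ j ∈ S, (a j : ℂ) * osc (θ j) p.2 * F j p)
      =O[𝓝 0 ×ˢ 𝓟 (uIcc 0 t)] fun p => p.1 ^ n := by
  refine IsBigO.fun_sum fun j hj => ?_
  have h1 : (fun p : ℝ × ℝ => (a j : ℂ) * osc (θ j) p.2)
      =O[𝓝 0 ×ˢ 𝓟 (uIcc 0 t)] fun _ => (1 : ℝ) :=
    IsBigO.of_bound |a j| (Eventually.of_forall fun p => by simp [norm_osc])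
  simpa using h1.mul (hF j hj)

lemma isBigO_const_mul_fst {t : ℝ} {F : ℝ × ℝ → ℂ} {n : ℕ} (c : ℂ)
    (hF : F =O[𝓝 0 ×ˢ 𝓟 (uIcc 0 t)] fun p => p.1 ^ n) :
    (fun p : ℝ × ℝ => c * p.1 * F p) =O[𝓝 0 ×ˢ 𝓟 (uIcc 0 t)] fun p => p.1 ^ (n + 1) := by
  have h2 : (fun p : ℝ × ℝ => c * (p.1 : ℂ)) =O[𝓝 0 ×ˢ 𝓟 (uIcc 0 t)] fun p => p.1 :=
    IsBigO.of_bound ‖c‖ (Eventually.of_forall fun p => by simp)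
  exact (h2.mul hF).congr_right fun p => by ring

namespace SolutionFamily

variable {α T δ₀ : ℝ} {S : Finset ℤ} {a b : ℤ → ℝ} {u v : ℝ → ℝ → ℝ → ℝ}
  (h : SolutionFamily α T δ₀ S a b u v) {t : ℝ} (ht : |t| < T)
include h ht

lemma eventually_small :
    ∀ᶠ p : ℝ × ℝ in 𝓝 0 ×ˢ 𝓟 (uIcc 0 t), |p.1| < δ₀ ∧ |p.2| < T := by
  rw [eventually_prod_principal_iff]
  filter_upwards [Metric.ball_mem_nhds (0 : ℝ) h.pos] with δ hδ τ hτ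
  exact ⟨by simpa using hδ, abs_lt.mpr (uIcc_zero_subset_Ioo ht hτ)⟩

lemma isBigO_mode_u (k : ℤ) :
    (fun p : ℝ × ℝ => mode 1 k p.2 (u p.1 p.2) - p.1 * a k)
      =O[𝓝 0 ×ˢ 𝓟 (uIcc 0 t)] fun p => p.1 ^ 2 := by
  have h1 : (fun p : ℝ × ℝ => -(Complex.I * k / 2) * mode 1 k p.2 (fun x => v p.1 p.2 x ^ 2))
      =O[𝓝 0 ×ˢ 𝓟 (uIcc 0 t)] fun p => p.1 ^ 2 := by
    refine IsBigO.const_mul_left (IsBigO.of_bound (∑ k ∈ S, (a k ^ 2 + b k ^ 2)) ?_) _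
    filter_upwards [h.eventually_small ht] with p hp
    simpa using h.norm_mode_sq_le hp.1 hp.2 k
  refine (isBigO_integral h1).congr' ?_ EventuallyEq.rfl
  filter_upwards [h.eventually_small ht] with p hp
  exact (h.mode_u_sub hp.1 hp.2 k).symm

lemma isBigO_mode_v (k : ℤ) :
    (fun p : ℝ × ℝ => mode α k p.2 (v p.1 p.2) - p.1 * b k)
      =O[𝓝 0 ×ˢ 𝓟 (uIcc 0 t)] fun p => p.1 ^ 2 := by
  have h1 : (fun p : ℝ × ℝ => -(Complex.I * k) * mode α k p.2 (fun x => u p.1 p.2 x * v p.1 p.2 x))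
      =O[𝓝 0 ×ˢ 𝓟 (uIcc 0 t)] fun p => p.1 ^ 2 := by
    refine IsBigO.const_mul_left (IsBigO.of_bound (∑ k ∈ S, (a k ^ 2 + b k ^ 2)) ?_) _
    filter_upwards [h.eventually_small ht] with p hp
    simpa using h.norm_mode_mul_le hp.1 hp.2 k
  refine (isBigO_integral h1).congr' ?_ EventuallyEq.rfl
  filter_upwards [h.eventually_small ht] with p hp
  exact (h.mode_v_sub hp.1 hp.2 k).symm

lemma isBigO_remainder_three :
    (fun p : ℝ × ℝ => (remainder α S a b u v p.1 p.2 : ℂ))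
      =O[𝓝 0 ×ˢ 𝓟 (uIcc 0 t)] fun p => p.1 ^ 3 := by
  have h1 : (fun p : ℝ × ℝ => ∑ k ∈ S, ((a k : ℂ) * (mode 1 k p.2 (u p.1 p.2) - p.1 * a k) +
      (b k : ℂ) * (mode α k p.2 (v p.1 p.2) - p.1 * b k)))
      =O[𝓝 0 ×ˢ 𝓟 (uIcc 0 t)] fun p => p.1 ^ 2 :=
    IsBigO.fun_sum fun k _ => ((h.isBigO_mode_u ht k).const_mul_left _).add
      ((h.isBigO_mode_v ht k).const_mul_left _)
  have h2 : (fun p : ℝ × ℝ => -(2 * (p.1 : ℂ))) =O[𝓝 0 ×ˢ 𝓟 (uIcc 0 t)] fun p => p.1 :=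
    IsBigO.of_bound 2 (Eventually.of_forall fun p => by simp)
  refine (h2.mul h1).congr' ?_ (Eventually.of_forall fun p => by ring)
  filter_upwards [h.eventually_small ht] with p hp
  exact (h.remainder_eq hp.1 hp.2).symm

/-- Second order expansion of `u`. -/
lemma isBigO_mode_u_second (k : ℤ) :
    (fun p : ℝ × ℝ => mode 1 k p.2 (u p.1 p.2) - p.1 * a k - p.1 ^ 2 * secondU α S b k p.2)
      =O[𝓝 0 ×ˢ 𝓟 (uIcc 0 t)] fun p => p.1 ^ 3 := by
  have h1 : (fun p : ℝ × ℝ => -(Complex.I * k / 2) * (mode 1 k p.2 (fun x => v p.1 p.2 x ^ 2) -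
      p.1 ^ 2 * ∑ j ∈ S, (b j : ℂ) * osc (res α α 1 j (k - j)) p.2 * b (k - j)))
      =O[𝓝 0 ×ˢ 𝓟 (uIcc 0 t)] fun p => p.1 ^ 3 := by
    refine IsBigO.const_mul_left ?_ _
    have e1 : (fun p : ℝ × ℝ => mode 1 k p.2 (fun x => v p.1 p.2 x ^ 2) -
        ∑ j ∈ S, (b j : ℂ) * osc (res α α 1 j (k - j)) p.2 *
          (2 * p.1 * mode α (k - j) p.2 (v p.1 p.2) - p.1 ^ 2 * b (k - j)))
        =O[𝓝 0 ×ˢ 𝓟 (uIcc 0 t)] fun p => p.1 ^ 3 := by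
      refine IsBigO.trans (IsBigO.of_bound 1 ?_) (h.isBigO_remainder_three ht)
      filter_upwards [h.eventually_small ht] with p hp
      rw [one_mul, Complex.norm_real, Real.norm_of_nonneg (remainder_nonneg ..)]
      exact h.norm_mode_sq_sub_le hp.1 hp.2 k
    have e2 := isBigO_sum_osc (S := S) b (fun j => res α α 1 j (k - j)) fun j _ =>
      isBigO_const_mul_fst 2 (h.isBigO_mode_v ht (k - j))
    refine (e1.add e2).congr_left fun p => ?_
    rw [sub_add, Finset.mul_sum, ← Finset.sum_sub_distrib]
    congr 1
    refine Finset.sum_congr rfl fun j _ => ?_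
    ring
  refine (isBigO_integral h1).congr' ?_ EventuallyEq.rfl
  filter_upwards [h.eventually_small ht] with p hp
  have hosc := continuous_osc
  rw [h.mode_u_sub hp.1 hp.2 k, secondU, ← intervalIntegral.integral_const_mul,
    ← integral_sub ((h.intervalIntegrable_mode_sq hp.1 hp.2 k).const_mul _)
      (Continuous.intervalIntegrable (by fun_prop) _ _)]
  refine integral_congr fun σ _ => ?_
  ring

/-- Second order expansion of `v`. -/
lemma isBigO_mode_v_second (k : ℤ) :
    (fun p : ℝ × ℝ => mode α k p.2 (v p.1 p.2) - p.1 * b k - p.1 ^ 2 * secondV α S a b k p.2)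
      =O[𝓝 0 ×ˢ 𝓟 (uIcc 0 t)] fun p => p.1 ^ 3 := by
  have h1 : (fun p : ℝ × ℝ => -(Complex.I * k) *
      (mode α k p.2 (fun x => u p.1 p.2 x * v p.1 p.2 x) -
      p.1 ^ 2 * ∑ j ∈ S, (a j : ℂ) * osc (res 1 α α j (k - j)) p.2 * b (k - j)))
      =O[𝓝 0 ×ˢ 𝓟 (uIcc 0 t)] fun p => p.1 ^ 3 := by
    refine IsBigO.const_mul_left ?_ _
    have e1 : (fun p : ℝ × ℝ => mode α k p.2 (fun x => u p.1 p.2 x * v p.1 p.2 x) -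
        (∑ j ∈ S, (a j : ℂ) * osc (res 1 α α j (k - j)) p.2 *
            (p.1 * mode α (k - j) p.2 (v p.1 p.2)) +
          ∑ j ∈ S, (b j : ℂ) * osc (res α 1 α j (k - j)) p.2 *
            (p.1 * (mode 1 (k - j) p.2 (u p.1 p.2) - p.1 * a (k - j)))))
        =O[𝓝 0 ×ˢ 𝓟 (uIcc 0 t)] fun p => p.1 ^ 3 := by
      refine IsBigO.trans (IsBigO.of_bound 1 ?_) (h.isBigO_remainder_three ht)
      filter_upwards [h.eventually_small ht] with p hp
      rw [one_mul, Complex.norm_real, Real.norm_of_nonneg (remainder_nonneg ..)]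
      exact h.norm_mode_mul_sub_le hp.1 hp.2 k
    have e2 := isBigO_sum_osc (S := S) a (fun j => res 1 α α j (k - j)) fun j _ =>
      isBigO_const_mul_fst 1 (h.isBigO_mode_v ht (k - j))
    have e3 := isBigO_sum_osc (S := S) b (fun j => res α 1 α j (k - j)) fun j _ =>
      isBigO_const_mul_fst 1 (h.isBigO_mode_u ht (k - j))
    refine ((e1.add e2).add e3).congr_left fun p => ?_
    have f2 : ∑ j ∈ S, (a j : ℂ) * osc (res 1 α α j (k - j)) p.2 * (1 * p.1 *
          (mode α (k - j) p.2 (v p.1 p.2) - p.1 * b (k - j)))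
        = ∑ j ∈ S, (a j : ℂ) * osc (res 1 α α j (k - j)) p.2 *
            (p.1 * mode α (k - j) p.2 (v p.1 p.2))
          - p.1 ^ 2 * ∑ j ∈ S, (a j : ℂ) * osc (res 1 α α j (k - j)) p.2 * b (k - j) := by
      rw [Finset.mul_sum, ← Finset.sum_sub_distrib]
      exact Finset.sum_congr rfl fun j _ => by ring
    simp_rw [f2, one_mul]
    ring
  refine (isBigO_integral h1).congr' ?_ EventuallyEq.rfl
  filter_upwards [h.eventually_small ht] with p hp
  have hosc := continuous_osc
  rw [h.mode_v_sub hp.1 hp.2 k, secondV, ← intervalIntegral.integral_const_mul,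
    ← integral_sub ((h.intervalIntegrable_mode_mul hp.1 hp.2 k).const_mul _)
      (Continuous.intervalIntegrable (by fun_prop) _ _)]
  refine integral_congr fun σ _ => ?_
  ring

/-- The bound on the remainder improves by one order: conservation of mass provides a `δ³` term,
which vanishes as the remainder is nonnegative for both signs of `δ`. -/
lemma isBigO_remainder_four :
    (fun p : ℝ × ℝ => (remainder α S a b u v p.1 p.2 : ℂ))
      =O[𝓝 0 ×ˢ 𝓟 (uIcc 0 t)] fun p => p.1 ^ 4 := by
  have h1 : (fun p : ℝ × ℝ => ∑ k ∈ S, ((a k : ℂ) *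
      (mode 1 k p.2 (u p.1 p.2) - p.1 * a k - p.1 ^ 2 * secondU α S b k p.2) +
      (b k : ℂ) * (mode α k p.2 (v p.1 p.2) - p.1 * b k - p.1 ^ 2 * secondV α S a b k p.2)))
      =O[𝓝 0 ×ˢ 𝓟 (uIcc 0 t)] fun p => p.1 ^ 3 :=
    IsBigO.fun_sum fun k _ => ((h.isBigO_mode_u_second ht k).const_mul_left _).add
      ((h.isBigO_mode_v_second ht k).const_mul_left _)
  have h2 := isBigO_const_mul_fst (-2) h1
  have h3 : (fun p : ℝ × ℝ => remainder α S a b u v p.1 p.2 -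
      (-2 * (∑ k ∈ S, ((a k : ℂ) * secondU α S b k p.2 + (b k : ℂ) * secondV α S a b k p.2)).re)
        * p.1 ^ 3) =O[𝓝 0 ×ˢ 𝓟 (uIcc 0 t)] fun p => p.1 ^ 4 := by
    refine IsBigO.trans (IsBigO.of_bound 1 ?_) h2
    filter_upwards [h.eventually_small ht] with p hp
    rw [one_mul]
    refine le_trans (le_of_eq ?_) (Complex.abs_re_le_norm _)
    rw [Real.norm_eq_abs]
    congr 1
    have e : -2 * (p.1 : ℂ) * ∑ k ∈ S, ((a k : ℂ) *
          (mode 1 k p.2 (u p.1 p.2) - p.1 * a k - p.1 ^ 2 * secondU α S b k p.2) +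
          (b k : ℂ) * (mode α k p.2 (v p.1 p.2) - p.1 * b k - p.1 ^ 2 * secondV α S a b k p.2))
        = (remainder α S a b u v p.1 p.2 : ℂ) - ((-2 * p.1 ^ 3 : ℝ) : ℂ) *
          ∑ k ∈ S, ((a k : ℂ) * secondU α S b k p.2 + (b k : ℂ) * secondV α S a b k p.2) := by
      rw [h.remainder_eq hp.1 hp.2, Finset.mul_sum, Finset.mul_sum, Finset.mul_sum,
        ← Finset.sum_sub_distrib]
      refine Finset.sum_congr rfl fun j _ => ?_
      push_cast
      ring
    rw [e, Complex.sub_re, Complex.ofReal_re, Complex.re_ofReal_mul]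
    ring
  have h4 := isBigO_of_nonneg_of_cubic (R := remainder α S a b u v) (t := t)
    (c := fun τ => -2 *
      (∑ k ∈ S, ((a k : ℂ) * secondU α S b k τ + (b k : ℂ) * secondV α S a b k τ)).re)
    (Eventually.of_forall fun δ τ _ => remainder_nonneg ..) h3
  exact IsBigO.trans (IsBigO.of_bound 1 (Eventually.of_forall fun p => by simp)) h4

/-- Third order expansion of `v`. -/
lemma isBigO_mode_v_third (k : ℤ) :
    (fun p : ℝ × ℝ => mode α k p.2 (v p.1 p.2) - p.1 * b k - p.1 ^ 2 * secondV α S a b k p.2 -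
      p.1 ^ 3 * thirdV α S a b k p.2) =O[𝓝 0 ×ˢ 𝓟 (uIcc 0 t)] fun p => p.1 ^ 4 := by
  have h1 : (fun p : ℝ × ℝ => -(Complex.I * k) *
      (mode α k p.2 (fun x => u p.1 p.2 x * v p.1 p.2 x) -
      p.1 ^ 2 * ∑ j ∈ S, (a j : ℂ) * osc (res 1 α α j (k - j)) p.2 * b (k - j) -
      p.1 ^ 3 * (∑ j ∈ S, (a j : ℂ) * osc (res 1 α α j (k - j)) p.2 * secondV α S a b (k - j) p.2 +
        ∑ j ∈ S, (b j : ℂ) * osc (res α 1 α j (k - j)) p.2 * secondU α S b (k - j) p.2)))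
      =O[𝓝 0 ×ˢ 𝓟 (uIcc 0 t)] fun p => p.1 ^ 4 := by
    refine IsBigO.const_mul_left ?_ _
    have e1 : (fun p : ℝ × ℝ => mode α k p.2 (fun x => u p.1 p.2 x * v p.1 p.2 x) -
        (∑ j ∈ S, (a j : ℂ) * osc (res 1 α α j (k - j)) p.2 *
            (p.1 * mode α (k - j) p.2 (v p.1 p.2)) +
          ∑ j ∈ S, (b j : ℂ) * osc (res α 1 α j (k - j)) p.2 *
            (p.1 * (mode 1 (k - j) p.2 (u p.1 p.2) - p.1 * a (k - j)))))
        =O[𝓝 0 ×ˢ 𝓟 (uIcc 0 t)] fun p => p.1 ^ 4 := by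
      refine IsBigO.trans (IsBigO.of_bound 1 ?_) (h.isBigO_remainder_four ht)
      filter_upwards [h.eventually_small ht] with p hp
      rw [one_mul, Complex.norm_real, Real.norm_of_nonneg (remainder_nonneg ..)]
      exact h.norm_mode_mul_sub_le hp.1 hp.2 k
    have e2 := isBigO_sum_osc (S := S) a (fun j => res 1 α α j (k - j)) fun j _ =>
      isBigO_const_mul_fst 1 (h.isBigO_mode_v_second ht (k - j))
    have e3 := isBigO_sum_osc (S := S) b (fun j => res α 1 α j (k - j)) fun j _ =>
      isBigO_const_mul_fst 1 (h.isBigO_mode_u_second ht (k - j))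
    refine ((e1.add e2).add e3).congr_left fun p => ?_
    have f2 : ∑ j ∈ S, (a j : ℂ) * osc (res 1 α α j (k - j)) p.2 * (1 * p.1 *
          (mode α (k - j) p.2 (v p.1 p.2) - p.1 * b (k - j) -
            p.1 ^ 2 * secondV α S a b (k - j) p.2))
        = ∑ j ∈ S, (a j : ℂ) * osc (res 1 α α j (k - j)) p.2 *
            (p.1 * mode α (k - j) p.2 (v p.1 p.2))
          - p.1 ^ 2 * ∑ j ∈ S, (a j : ℂ) * osc (res 1 α α j (k - j)) p.2 * b (k - j)
          - p.1 ^ 3 * ∑ j ∈ S, (a j : ℂ) * osc (res 1 α α j (k - j)) p.2 *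
            secondV α S a b (k - j) p.2 := by
      rw [Finset.mul_sum, Finset.mul_sum, ← Finset.sum_sub_distrib, ← Finset.sum_sub_distrib]
      exact Finset.sum_congr rfl fun j _ => by ring
    have f3 : ∑ j ∈ S, (b j : ℂ) * osc (res α 1 α j (k - j)) p.2 * (1 * p.1 *
          (mode 1 (k - j) p.2 (u p.1 p.2) - p.1 * a (k - j) - p.1 ^ 2 * secondU α S b (k - j) p.2))
        = ∑ j ∈ S, (b j : ℂ) * osc (res α 1 α j (k - j)) p.2 *
            (p.1 * (mode 1 (k - j) p.2 (u p.1 p.2) - p.1 * a (k - j)))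
          - p.1 ^ 3 * ∑ j ∈ S, (b j : ℂ) * osc (res α 1 α j (k - j)) p.2 *
            secondU α S b (k - j) p.2 := by
      rw [Finset.mul_sum, ← Finset.sum_sub_distrib]
      exact Finset.sum_congr rfl fun j _ => by ring
    rw [f2, f3]
    ring
  refine (isBigO_integral h1).congr' ?_ EventuallyEq.rfl
  filter_upwards [h.eventually_small ht] with p hp
  have hosc := continuous_osc
  have hU := continuous_secondU α S b
  have hV := continuous_secondV α S a b
  rw [h.mode_v_sub hp.1 hp.2 k, secondV, thirdV, ← intervalIntegral.integral_const_mul,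
    ← intervalIntegral.integral_const_mul,
    ← integral_sub ((h.intervalIntegrable_mode_mul hp.1 hp.2 k).const_mul _)
      (Continuous.intervalIntegrable (by fun_prop) _ _),
    ← integral_sub (((h.intervalIntegrable_mode_mul hp.1 hp.2 k).const_mul _).sub
      (Continuous.intervalIntegrable (by fun_prop) _ _))
      (Continuous.intervalIntegrable (by fun_prop) _ _)]
  refine integral_congr fun σ _ => ?_
  ring

end SolutionFamily

end MajdaBiello

namespace MajdaBiello

open MeasureTheory Set Filter Topology Asymptotics

/-! ### Finite differences of smooth maps -/

section Calculus

variable {E F : Type*} [NormedAddCommGroup E] [NormedSpace ℝ E] [NormedAddCommGroup F]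
  [NormedSpace ℝ F]

/-- The bound comes from a Lipschitz estimate for the derivative of `x ↦ f x + f (-x)`. -/
lemma exists_norm_second_difference_le {f : E → F} (hf : ContDiffAt ℝ 2 f 0) :
    ∃ C, 0 ≤ C ∧ ∀ᶠ x in 𝓝 (0 : E), ‖f x + f (-x) - (2 : ℝ) • f 0‖ ≤ C * ‖x‖ ^ 2 := by
  obtain ⟨K, s, hs, hK⟩ :=
    (hf.fderiv_right (m := 1) (by norm_num)).exists_lipschitzOnWith
  have hd : ∀ᶠ x in 𝓝 (0 : E), DifferentiableAt ℝ f x := by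
    filter_upwards [hf.eventually (by simp)] with x hx
    exact hx.differentiableAt (by simp)
  obtain ⟨ε, hε, hball⟩ := Metric.eventually_nhds_iff_ball.mp (hd.and hs)
  refine ⟨K * 2, by positivity, ?_⟩
  filter_upwards [Metric.ball_mem_nhds (0 : E) hε] with x hx
  rw [mem_ball_zero_iff] at hx
  have hin : ∀ y ∈ Metric.closedBall (0 : E) ‖x‖, y ∈ Metric.ball (0 : E) ε := fun y hy => by
    rw [mem_closedBall_zero_iff] at hy
    rw [mem_ball_zero_iff]
    exact hy.trans_lt hx
  have hneg : ∀ y ∈ Metric.closedBall (0 : E) ‖x‖, -y ∈ Metric.closedBall (0 : E) ‖x‖ :=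
    fun y hy => by simpa using hy
  have key := (convex_closedBall (0 : E) ‖x‖).norm_image_sub_le_of_norm_hasFDerivWithin_le
    (f := fun y => f y + f (-y)) (f' := fun y => fderiv ℝ f y - fderiv ℝ f (-y))
    (C := K * (2 * ‖x‖)) (x := 0) (y := x) ?_ ?_ (by simp) (by simp)
  · simp only [neg_zero, sub_zero] at key
    rw [two_smul]
    refine key.trans (le_of_eq (by ring))
  · intro y hy
    have h1 := (hball y (hin y hy)).1.hasFDerivAt
    have h2 := (hball (-y) (hin _ (hneg y hy))).1.hasFDerivAt
    have h3 := h1.add (h2.comp y (hasFDerivAt_id y).neg)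
    refine HasFDerivAt.hasFDerivWithinAt (h3.congr_fderiv ?_)
    ext z
    simp [sub_eq_add_neg]
  · intro y hy
    have h1 := hK.norm_sub_le (hball y (hin y hy)).2 (hball (-y) (hin _ (hneg y hy))).2
    refine h1.trans ?_
    gcongr
    rw [sub_neg_eq_add, ← two_smul ℝ, norm_smul, Real.norm_two]
    gcongr
    simpa using hy

/-- The combination of values is odd in `x` and annihilates linear maps; its derivative is a
combination of second differences of `fderiv ℝ f`. -/
lemma exists_norm_third_difference_le {f : E → F} (hf : ContDiffAt ℝ 3 f 0) :
    ∃ C, 0 ≤ C ∧ ∀ᶠ x in 𝓝 (0 : E),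
      ‖f ((2 : ℝ) • x) - f ((-2 : ℝ) • x) - (2 : ℝ) • (f x - f (-x))‖ ≤ C * ‖x‖ ^ 3 := by
  obtain ⟨C, hC0, hC⟩ :=
    exists_norm_second_difference_le (hf.fderiv_right (m := 2) (by norm_num))
  have hd : ∀ᶠ x in 𝓝 (0 : E), DifferentiableAt ℝ f x := by
    filter_upwards [hf.eventually (by simp)] with x hx
    exact hx.differentiableAt (by simp)
  obtain ⟨ε, hε, hball⟩ := Metric.eventually_nhds_iff_ball.mp (hd.and hC)
  refine ⟨10 * C, by positivity, ?_⟩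
  filter_upwards [Metric.ball_mem_nhds (0 : E) (half_pos hε)] with x hx
  rw [mem_ball_zero_iff] at hx
  have hin : ∀ y ∈ Metric.closedBall (0 : E) ‖x‖, ∀ c : ℝ, |c| ≤ 2 →
      c • y ∈ Metric.ball (0 : E) ε := fun y hy c hc => by
    rw [mem_closedBall_zero_iff] at hy
    rw [mem_ball_zero_iff, norm_smul, Real.norm_eq_abs]
    calc |c| * ‖y‖ ≤ 2 * ‖x‖ := by gcongr
      _ < ε := by linarith
  have hscale : ∀ y ∈ Metric.closedBall (0 : E) ‖x‖, ∀ c : ℝ, |c| ≤ 2 →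
      HasFDerivAt (fun y => f (c • y)) (c • fderiv ℝ f (c • y)) y := fun y hy c hc => by
    have h1 := (hball _ (hin y hy c hc)).1.hasFDerivAt
    have h2 := h1.comp y ((hasFDerivAt_id y).const_smul c)
    refine h2.congr_fderiv ?_
    ext z
    simp
  have key := (convex_closedBall (0 : E) ‖x‖).norm_image_sub_le_of_norm_hasFDerivWithin_le
    (f := fun y => f ((2 : ℝ) • y) - f ((-2 : ℝ) • y) -
      (2 : ℝ) • (f ((1 : ℝ) • y) - f ((-1 : ℝ) • y)))
    (f' := fun y => (2 : ℝ) • fderiv ℝ f ((2 : ℝ) • y) - (-2 : ℝ) • fderiv ℝ f ((-2 : ℝ) • y) -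
      (2 : ℝ) • ((1 : ℝ) • fderiv ℝ f ((1 : ℝ) • y) - (-1 : ℝ) • fderiv ℝ f ((-1 : ℝ) • y)))
    (C := 10 * C * ‖x‖ ^ 2) (x := 0) (y := x) ?_ ?_ (by simp) (by simp)
  · simp only [smul_zero, sub_self, sub_zero, one_smul, neg_smul] at key
    rw [neg_smul]
    refine key.trans (le_of_eq (by ring))
  · intro y hy
    exact (((hscale y hy 2 (by norm_num)).sub (hscale y hy (-2) (by norm_num))).sub
      (((hscale y hy 1 (by norm_num)).sub (hscale y hy (-1) (by norm_num))).const_smul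
        (2 : ℝ))).hasFDerivWithinAt
  · intro y hy
    have e1 := (hball _ (hin y hy 2 (by norm_num))).2
    have e2 := (hball _ (hin y hy 1 (by norm_num))).2
    have e : (2 : ℝ) • fderiv ℝ f ((2 : ℝ) • y) - (-2 : ℝ) • fderiv ℝ f ((-2 : ℝ) • y) -
        (2 : ℝ) • ((1 : ℝ) • fderiv ℝ f ((1 : ℝ) • y) - (-1 : ℝ) • fderiv ℝ f ((-1 : ℝ) • y))
        = (2 : ℝ) • (fderiv ℝ f ((2 : ℝ) • y) + fderiv ℝ f (-((2 : ℝ) • y)) -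
            (2 : ℝ) • fderiv ℝ f 0) -
          (2 : ℝ) • (fderiv ℝ f ((1 : ℝ) • y) + fderiv ℝ f (-((1 : ℝ) • y)) -
            (2 : ℝ) • fderiv ℝ f 0) := by
      rw [← neg_smul, ← neg_smul]
      module
    have hy' : ‖y‖ ≤ ‖x‖ := by simpa using hy
    rw [e]
    refine (norm_sub_le _ _).trans ?_
    rw [norm_smul, norm_smul, Real.norm_two]
    rw [norm_smul, Real.norm_two] at e1
    rw [one_smul] at e2 ⊢
    have h3 : ‖y‖ ^ 2 ≤ ‖x‖ ^ 2 := by gcongr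
    nlinarith

/-- If a quantity times `δⁿ` is at most `B δⁿ + D δⁿ⁺¹` for small `δ > 0`, it is at most `B`. -/
lemma le_of_eventually_mul_pow_le {M B D : ℝ} {n : ℕ}
    (h : ∀ᶠ δ in 𝓝 (0 : ℝ), M * |δ| ^ n ≤ B * |δ| ^ n + D * |δ| ^ (n + 1)) : M ≤ B := by
  have h1 : ∀ᶠ δ in 𝓝[>] (0 : ℝ), M ≤ B + D * δ := by
    filter_upwards [h.filter_mono nhdsWithin_le_nhds, self_mem_nhdsWithin] with δ hδ hpos
    have hpos' : 0 < δ := hpos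
    rw [abs_of_pos hpos'] at hδ
    refine le_of_mul_le_mul_right ?_ (pow_pos hpos' n)
    refine hδ.trans (le_of_eq (by ring))
  have h2 : Tendsto (fun δ : ℝ => B + D * δ) (𝓝[>] 0) (𝓝 B) := by
    have : Tendsto (fun δ : ℝ => B + D * δ) (𝓝 0) (𝓝 (B + D * 0)) :=
      Continuous.tendsto (by fun_prop) 0
    rw [mul_zero, add_zero] at this
    exact this.mono_left nhdsWithin_le_nhds
  exact ge_of_tendsto h2 h1

lemma tendsto_smul_zero (w : E) (c : ℝ) :
    Tendsto (fun δ : ℝ => c * δ) (𝓝 0) (𝓝 0) ∧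
      Tendsto (fun δ : ℝ => δ • w) (𝓝 0) (𝓝 0) := by
  constructor
  · have : Tendsto (fun δ : ℝ => c * δ) (𝓝 0) (𝓝 (c * 0)) := Continuous.tendsto (by fun_prop) 0
    simpa using this
  · have : Tendsto (fun δ : ℝ => δ • w) (𝓝 0) (𝓝 ((0 : ℝ) • w)) :=
      Continuous.tendsto (by fun_prop) 0
    simpa using this

/-- An asymptotic expansion of `δ ↦ ℓ (f (δ w))` transfers bounds on second differences of `f` to
the coefficient of `δ²`. -/
lemma norm_second_coeff_le {f : E → F} {C : ℝ}
    (hC : ∀ᶠ x in 𝓝 (0 : E), ‖f x + f (-x) - (2 : ℝ) • f 0‖ ≤ C * ‖x‖ ^ 2)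
    (ℓ : F →ₗ[ℝ] ℂ) (hℓ : ∀ y, ‖ℓ y‖ ≤ ‖y‖) (w : E) {c₁ c₂ : ℂ}
    (h : (fun δ : ℝ => ℓ (f (δ • w)) - δ * c₁ - δ ^ 2 * c₂) =O[𝓝 0] fun δ => δ ^ 3) :
    2 * ‖c₂‖ ≤ C * ‖w‖ ^ 2 := by
  obtain ⟨D, hD⟩ := h.bound
  have hD0 := hD.self_of_nhds
  refine le_of_eventually_mul_pow_le (D := 2 * D) (n := 2) ?_
  have hD' := (tendsto_smul_zero w (-1)).1.eventually hD
  filter_upwards [hD, hD', (tendsto_smul_zero w 1).2.eventually hC] with δ e1 e2 e3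
  have z : ℓ (f 0) = 0 := by
    simpa using hD0
  have e4 := (hℓ _).trans e3
  rw [map_sub, map_add, map_smul, z, smul_zero, sub_zero, ← neg_smul] at e4
  rw [neg_one_mul] at e2
  have e5 : (2 * δ ^ 2 : ℝ) * c₂ = (ℓ (f (δ • w)) + ℓ (f (-δ • w)))
      - (ℓ (f (δ • w)) - δ * c₁ - δ ^ 2 * c₂)
      - (ℓ (f (-δ • w)) - ((-δ : ℝ) : ℂ) * c₁ - ((-δ : ℝ) : ℂ) ^ 2 * c₂) := by
    push_cast; ring
  have e6 : ‖(2 * δ ^ 2 : ℝ) * c₂‖ = 2 * ‖c₂‖ * |δ| ^ 2 := by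
    rw [norm_mul, Complex.norm_real, Real.norm_of_nonneg (by positivity), sq_abs]; ring
  rw [← e6, e5]
  refine (norm_sub_le _ _).trans ((add_le_add ((norm_sub_le _ _).trans (add_le_add e4 e1)) e2).trans
    (le_of_eq ?_))
  rw [norm_smul]
  simp only [norm_pow, norm_neg, Real.norm_eq_abs]
  ring

/-- An asymptotic expansion of `δ ↦ ℓ (f (δ w))` transfers bounds on third differences of `f` to the
coefficient of `δ³`. -/
lemma norm_third_coeff_le {f : E → F} {C : ℝ}
    (hC : ∀ᶠ x in 𝓝 (0 : E),
      ‖f ((2 : ℝ) • x) - f ((-2 : ℝ) • x) - (2 : ℝ) • (f x - f (-x))‖ ≤ C * ‖x‖ ^ 3)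
    (ℓ : F →ₗ[ℝ] ℂ) (hℓ : ∀ y, ‖ℓ y‖ ≤ ‖y‖) (w : E) {c₁ c₂ c₃ : ℂ}
    (h : (fun δ : ℝ => ℓ (f (δ • w)) - δ * c₁ - δ ^ 2 * c₂ - δ ^ 3 * c₃) =O[𝓝 0] fun δ => δ ^ 4) :
    12 * ‖c₃‖ ≤ C * ‖w‖ ^ 3 := by
  obtain ⟨D, hD⟩ := h.bound
  refine le_of_eventually_mul_pow_le (D := 36 * D) (n := 3) ?_
  have hD1 := (tendsto_smul_zero w (-1)).1.eventually hD
  have hD2 := (tendsto_smul_zero w 2).1.eventually hD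
  have hD3 := (tendsto_smul_zero w (-2)).1.eventually hD
  filter_upwards [hD, hD1, hD2, hD3, (tendsto_smul_zero w 1).2.eventually hC]
    with δ e1 e2 e3 e4 e5
  have e6 := (hℓ _).trans e5
  rw [map_sub, map_sub, map_smul, map_sub, smul_smul, smul_smul, ← neg_smul] at e6
  rw [neg_one_mul] at e2
  have e7 : (12 * δ ^ 3 : ℝ) * c₃
      = (ℓ (f ((2 * δ) • w)) - ℓ (f ((-2 * δ) • w)) - (2 : ℝ) • (ℓ (f (δ • w)) - ℓ (f (-δ • w))))
      - ((ℓ (f ((2 * δ) • w)) - ((2 * δ : ℝ) : ℂ) * c₁ - ((2 * δ : ℝ) : ℂ) ^ 2 * c₂ -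
          ((2 * δ : ℝ) : ℂ) ^ 3 * c₃)
        - (ℓ (f ((-2 * δ) • w)) - ((-2 * δ : ℝ) : ℂ) * c₁ - ((-2 * δ : ℝ) : ℂ) ^ 2 * c₂ -
          ((-2 * δ : ℝ) : ℂ) ^ 3 * c₃)
        - 2 * ((ℓ (f (δ • w)) - δ * c₁ - δ ^ 2 * c₂ - δ ^ 3 * c₃)
          - (ℓ (f (-δ • w)) - ((-δ : ℝ) : ℂ) * c₁ - ((-δ : ℝ) : ℂ) ^ 2 * c₂ -
            ((-δ : ℝ) : ℂ) ^ 3 * c₃))) := by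
    rw [Complex.real_smul]
    push_cast; ring
  have e8 : ‖(12 * δ ^ 3 : ℝ) * c₃‖ = 12 * ‖c₃‖ * |δ| ^ 3 := by
    rw [norm_mul, Complex.norm_real, Real.norm_eq_abs, abs_mul, abs_pow]
    norm_num; ring
  rw [← e8, e7]
  refine (norm_sub_le _ _).trans ((add_le_add e6 ((norm_sub_le _ _).trans (add_le_add
    ((norm_sub_le _ _).trans (add_le_add e3 e4)) (le_of_eq (norm_mul _ _))))).trans ?_)
  have e9 := (norm_sub_le (ℓ (f (δ • w)) - δ * c₁ - δ ^ 2 * c₂ - δ ^ 3 * c₃)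
    (ℓ (f (-δ • w)) - ((-δ : ℝ) : ℂ) * c₁ - ((-δ : ℝ) : ℂ) ^ 2 * c₂ -
            ((-δ : ℝ) : ℂ) ^ 3 * c₃)).trans (add_le_add e1 e2)
  rw [norm_smul]
  simp only [norm_pow, norm_neg, Real.norm_eq_abs, abs_mul, abs_neg, abs_two,
    Complex.norm_ofNat] at e9 ⊢
  rw [show 3 + 1 = 4 from rfl]
  linarith

end Calculus

end MajdaBiello

namespace MajdaBiello

open MeasureTheory Set Filter Topology Asymptotics

/-! ### Bounds on the Picard iterates from smoothness of the solution map -/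

lemma norm_coeff_le {s : ℝ} (f : Sobolev s) (k : ℤ) : jb k ^ s * ‖f.coeff k‖ ≤ ‖f‖ := by
  have h := lp.norm_apply_le_norm (p := 2) (by norm_num) (Sobolev.toLp s f) k
  have h3 : (Sobolev.toLp s f : ℤ → ℂ) k = (jb k ^ s) • f.coeff k := rfl
  rwa [h3, norm_smul, Real.norm_of_nonneg (Real.rpow_pos_of_pos (jb_pos k) s).le] at h

section Data

variable {S : Finset ℤ} {a b : ℤ → ℝ}

/-- The even trigonometric polynomial with Fourier coefficients `a`, as an element of `H^s`. -/
noncomputable def evenSobolev (s : ℝ) (ha : IsEvenOn S a) : Sobolev s :=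
  ⟨fun n => (a n : ℂ), fun n => by simp [ha.even n], by
    rw [memℓp_gen_iff (by norm_num)]
    refine summable_of_ne_finset_zero (s := S) fun k hk => ?_
    simp [ha.supp k hk]⟩

lemma coeff_evenSobolev (s : ℝ) (ha : IsEvenOn S a) (k : ℤ) :
    (evenSobolev s ha).coeff k = a k := rfl

/-- The initial data with Fourier coefficients `a` and `b`. -/
noncomputable def evenData (s : ℝ) (ha : IsEvenOn S a) (hb : IsEvenOn S b) (ha0 : a 0 = 0) :
    Data s :=
  ⟨(evenSobolev s ha, evenSobolev s hb), by
    change (evenSobolev s ha).coeff 0 = 0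
    rw [coeff_evenSobolev, ha0, Complex.ofReal_zero]⟩

lemma norm_evenSobolev_le (s : ℝ) (ha : IsEvenOn S a) {B : ℝ} (hB : 0 ≤ B)
    (h : ∀ k ∈ S, jb k ^ s * |a k| ≤ B) : ‖evenSobolev s ha‖ ≤ √(S.card) * B := by
  refine le_of_sq_le_sq ?_ (by positivity)
  rw [Sobolev.norm_sq_eq, mul_pow, Real.sq_sqrt (by positivity),
    tsum_eq_sum (s := S) fun k hk => by rw [coeff_evenSobolev, ha.supp k hk]; simp]
  rw [← nsmul_eq_mul]
  refine Finset.sum_le_card_nsmul _ _ _ fun k hk => ?_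
  rw [coeff_evenSobolev, Complex.norm_real, Real.norm_eq_abs]
  have := (Real.rpow_pos_of_pos (jb_pos k) s).le
  exact pow_le_pow_left₀ (by positivity) (h k hk) 2

lemma norm_evenData_le (s : ℝ) (ha : IsEvenOn S a) (hb : IsEvenOn S b) (ha0 : a 0 = 0) {B : ℝ}
    (hB : 0 ≤ B) (h : ∀ k ∈ S, jb k ^ s * |a k| ≤ B) (h' : ∀ k ∈ S, jb k ^ s * |b k| ≤ B) :
    ‖evenData s ha hb ha0‖ ≤ √(S.card) * B :=
  max_le (norm_evenSobolev_le s ha hB h) (norm_evenSobolev_le s hb hB h')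

lemma isSmoothPeriodic_cosPoly (β δ : ℝ) :
    IsSmoothPeriodic fun x => δ * cosPoly S β a 0 x := by
  constructor
  · unfold cosPoly
    refine contDiff_const.mul (ContDiff.sum fun k _ => contDiff_const.mul ?_)
    exact Real.contDiff_cos.comp (by fun_prop)
  · intro x
    unfold cosPoly
    refine congrArg (δ * ·) (Finset.sum_congr rfl fun k _ => ?_)
    congr 1
    rw [← Real.cos_add_int_mul_two_pi (k * x + β * k ^ 3 * 0) k]
    congr 1
    ring

lemma fourierCoeffOn_eq_mode (β : ℝ) (k : ℤ) (t : ℝ) (f : ℝ → ℝ) :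
    fourierCoeffOn Real.two_pi_pos (fun x => (f x : ℂ)) k =
      osc (β * k ^ 3) t * mode β k t f := by
  rw [mode_eq_fourierCoeffOn, ← mul_assoc, osc, ← Complex.exp_add]
  simp

lemma represents_smul {s : ℝ} (β δ : ℝ) (ha : IsEvenOn S a) {f : Sobolev s}
    (hf : f = δ • evenSobolev s ha) : Represents f fun x => δ * cosPoly S β a 0 x := by
  intro k
  rw [fourierCoeffOn_eq_mode β k 0, mode_const_mul]
  have := ha.mode_cosPoly β k 0
  rw [this, hf]
  have h2 : (δ • evenSobolev s ha).coeff k = δ • (evenSobolev s ha).coeff k := rfl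
  rw [h2, coeff_evenSobolev, Complex.real_smul]
  simp [osc]

end Data

section SolutionMap

variable {α s T : ℝ} {U : Set (Data s)} {Φ : ℝ → Data s → Sobolev s × Sobolev s}
  {S : Finset ℤ} {a b : ℤ → ℝ} {t : ℝ}

lemma IsSolutionMap.exists_family (hΦ : IsSolutionMap α s T U Φ) (hU : U ∈ 𝓝 (0 : Data s))
    (ha : IsEvenOn S a) (hb : IsEvenOn S b) (ha0 : a 0 = 0) (ht : |t| < T) :
    ∃ δ₀ u v, SolutionFamily α T δ₀ S a b u v ∧ ∀ δ, |δ| < δ₀ →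
      Represents (Φ t (δ • evenData s ha hb ha0)).1 (u δ t) ∧
      Represents (Φ t (δ • evenData s ha hb ha0)).2 (v δ t) := by
  set w := evenData s ha hb ha0 with hw
  have h1 := (tendsto_smul_zero w 1).2.eventually hU
  obtain ⟨δ₀, hδ₀, hball⟩ := Metric.eventually_nhds_iff.mp h1
  have h2 : ∀ δ : ℝ, |δ| < δ₀ → ∃ u v : ℝ → ℝ → ℝ, IsSmoothSolution α T u v ∧
      (u 0 = fun x => δ * cosPoly S 1 a 0 x) ∧ (v 0 = fun x => δ * cosPoly S α b 0 x) ∧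
      ∀ t ∈ Ioo (-T) T, Represents (Φ t (δ • w)).1 (u t) ∧ Represents (Φ t (δ • w)).2 (v t) := by
    intro δ hδ
    exact hΦ (δ • w) (hball (by simpa using hδ)) _ _ (isSmoothPeriodic_cosPoly 1 δ)
      (isSmoothPeriodic_cosPoly α δ) (represents_smul 1 δ ha rfl) (represents_smul α δ hb rfl)
  choose! u v h3 using h2
  exact ⟨δ₀, u, v, ⟨hδ₀, ha, hb, fun δ hδ => (h3 δ hδ).1, fun δ hδ => (h3 δ hδ).2.1,
    fun δ hδ => (h3 δ hδ).2.2.1⟩, fun δ hδ => (h3 δ hδ).2.2.2 t (abs_lt.mp ht)⟩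

lemma isBigO_slice {F : ℝ × ℝ → ℂ} {n : ℕ}
    (hF : F =O[𝓝 0 ×ˢ 𝓟 (uIcc 0 t)] fun p => p.1 ^ n) :
    (fun δ => F (δ, t)) =O[𝓝 0] fun δ => δ ^ n := by
  have h : Tendsto (fun δ : ℝ => (δ, t)) (𝓝 0) (𝓝 0 ×ˢ 𝓟 (uIcc 0 t)) :=
    tendsto_id.prodMk (tendsto_principal.mpr (Eventually.of_forall fun _ => right_mem_uIcc))
  exact hF.comp_tendsto h

/-- The functional `(f, g) ↦ ⟨k⟩^s f̂(k)`. -/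
noncomputable def coeffFst (s : ℝ) (k : ℤ) : Sobolev s × Sobolev s →ₗ[ℝ] ℂ where
  toFun y := (jb k ^ s : ℝ) * y.1.coeff k
  map_add' y z := mul_add _ (y.1.coeff k) (z.1.coeff k)
  map_smul' c y := by
    have h : (c • y).1.coeff k = c • y.1.coeff k := rfl
    rw [h, mul_smul_comm]
    rfl

/-- The functional `(f, g) ↦ ⟨k⟩^s ĝ(k)`. -/
noncomputable def coeffSnd (s : ℝ) (k : ℤ) : Sobolev s × Sobolev s →ₗ[ℝ] ℂ where
  toFun y := (jb k ^ s : ℝ) * y.2.coeff k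
  map_add' y z := mul_add _ (y.2.coeff k) (z.2.coeff k)
  map_smul' c y := by
    have h : (c • y).2.coeff k = c • y.2.coeff k := rfl
    rw [h, mul_smul_comm]
    rfl

lemma norm_coeffFst_le (k : ℤ) (y : Sobolev s × Sobolev s) : ‖coeffFst s k y‖ ≤ ‖y‖ := by
  change ‖((jb k ^ s : ℝ) : ℂ) * y.1.coeff k‖ ≤ _
  rw [norm_mul, Complex.norm_real, Real.norm_of_nonneg (Real.rpow_pos_of_pos (jb_pos k) s).le]
  exact (norm_coeff_le y.1 k).trans (norm_fst_le y)

lemma norm_coeffSnd_le (k : ℤ) (y : Sobolev s × Sobolev s) : ‖coeffSnd s k y‖ ≤ ‖y‖ := by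
  change ‖((jb k ^ s : ℝ) : ℂ) * y.2.coeff k‖ ≤ _
  rw [norm_mul, Complex.norm_real, Real.norm_of_nonneg (Real.rpow_pos_of_pos (jb_pos k) s).le]
  exact (norm_coeff_le y.2 k).trans (norm_snd_le y)

/-- If `Φ_t` is `C²` at the origin, the second Picard iterates are bounded in `H^s`. -/
lemma IsSolutionMap.exists_second_le (hΦ : IsSolutionMap α s T U Φ) (hU : U ∈ 𝓝 (0 : Data s))
    (ht : |t| < T) (hC : ContDiffAt ℝ 2 (Φ t) 0) :
    ∃ C, 0 ≤ C ∧ ∀ (S : Finset ℤ) (a b : ℤ → ℝ) (ha : IsEvenOn S a) (hb : IsEvenOn S b)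
      (ha0 : a 0 = 0) (k : ℤ),
      jb k ^ s * ‖secondU α S b k t‖ ≤ C * ‖evenData s ha hb ha0‖ ^ 2 ∧
      jb k ^ s * ‖secondV α S a b k t‖ ≤ C * ‖evenData s ha hb ha0‖ ^ 2 := by
  obtain ⟨C, hC0, hC⟩ := exists_norm_second_difference_le hC
  refine ⟨C, hC0, fun S a b ha hb ha0 k => ?_⟩
  obtain ⟨δ₀, u, v, hfam, hrep⟩ := hΦ.exists_family hU ha hb ha0 ht
  have hev : ∀ᶠ δ in 𝓝 (0 : ℝ), |δ| < δ₀ := by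
    filter_upwards [Metric.ball_mem_nhds (0 : ℝ) hfam.pos] with δ hδ
    simpa using hδ
  have hjb := (Real.rpow_pos_of_pos (jb_pos k) s).le
  have hw := sq_nonneg ‖evenData s ha hb ha0‖
  constructor
  · have h1 := isBigO_slice (hfam.isBigO_mode_u_second ht k)
    have h2 := norm_second_coeff_le hC (coeffFst s k) (norm_coeffFst_le k) (evenData s ha hb ha0)
      (c₁ := (jb k ^ s : ℝ) * osc (1 * k ^ 3) t * a k)
      (c₂ := (jb k ^ s : ℝ) * osc (1 * k ^ 3) t * secondU α S b k t) ?_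
    · rw [norm_mul, norm_mul, norm_osc, Complex.norm_real, Real.norm_of_nonneg hjb, mul_one] at h2
      have := norm_nonneg (secondU α S b k t)
      nlinarith [mul_nonneg hjb this]
    · refine (h1.const_mul_left ((jb k ^ s : ℝ) * osc (1 * k ^ 3) t)).congr' ?_ EventuallyEq.rfl
      filter_upwards [hev] with δ hδ
      have e : coeffFst s k (Φ t (δ • evenData s ha hb ha0))
          = (jb k ^ s : ℝ) * (osc (1 * k ^ 3) t * mode 1 k t (u δ t)) := by
        rw [← fourierCoeffOn_eq_mode, ← (hrep δ hδ).1 k]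
        rfl
      rw [e]
      ring
  · have h1 := isBigO_slice (hfam.isBigO_mode_v_second ht k)
    have h2 := norm_second_coeff_le hC (coeffSnd s k) (norm_coeffSnd_le k) (evenData s ha hb ha0)
      (c₁ := (jb k ^ s : ℝ) * osc (α * k ^ 3) t * b k)
      (c₂ := (jb k ^ s : ℝ) * osc (α * k ^ 3) t * secondV α S a b k t) ?_
    · rw [norm_mul, norm_mul, norm_osc, Complex.norm_real, Real.norm_of_nonneg hjb, mul_one] at h2
      have := norm_nonneg (secondV α S a b k t)
      nlinarith [mul_nonneg hjb this]
    · refine (h1.const_mul_left ((jb k ^ s : ℝ) * osc (α * k ^ 3) t)).congr' ?_ EventuallyEq.rfl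
      filter_upwards [hev] with δ hδ
      have e : coeffSnd s k (Φ t (δ • evenData s ha hb ha0))
          = (jb k ^ s : ℝ) * (osc (α * k ^ 3) t * mode α k t (v δ t)) := by
        rw [← fourierCoeffOn_eq_mode, ← (hrep δ hδ).2 k]
        rfl
      rw [e]
      ring

/-- If `Φ_t` is `C³` at the origin, the third Picard iterate of `v` is bounded in `H^s`. -/
lemma IsSolutionMap.exists_third_le (hΦ : IsSolutionMap α s T U Φ) (hU : U ∈ 𝓝 (0 : Data s))
    (ht : |t| < T) (hC : ContDiffAt ℝ 3 (Φ t) 0) :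
    ∃ C, 0 ≤ C ∧ ∀ (S : Finset ℤ) (a b : ℤ → ℝ) (ha : IsEvenOn S a) (hb : IsEvenOn S b)
      (ha0 : a 0 = 0) (k : ℤ),
      jb k ^ s * ‖thirdV α S a b k t‖ ≤ C * ‖evenData s ha hb ha0‖ ^ 3 := by
  obtain ⟨C, hC0, hC⟩ := exists_norm_third_difference_le hC
  refine ⟨C, hC0, fun S a b ha hb ha0 k => ?_⟩
  obtain ⟨δ₀, u, v, hfam, hrep⟩ := hΦ.exists_family hU ha hb ha0 ht
  have hev : ∀ᶠ δ in 𝓝 (0 : ℝ), |δ| < δ₀ := by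
    filter_upwards [Metric.ball_mem_nhds (0 : ℝ) hfam.pos] with δ hδ
    simpa using hδ
  have hjb := (Real.rpow_pos_of_pos (jb_pos k) s).le
  have h1 := isBigO_slice (hfam.isBigO_mode_v_third ht k)
  have h2 := norm_third_coeff_le hC (coeffSnd s k) (norm_coeffSnd_le k) (evenData s ha hb ha0)
    (c₁ := (jb k ^ s : ℝ) * osc (α * k ^ 3) t * b k)
    (c₂ := (jb k ^ s : ℝ) * osc (α * k ^ 3) t * secondV α S a b k t)
    (c₃ := (jb k ^ s : ℝ) * osc (α * k ^ 3) t * thirdV α S a b k t) ?_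
  · rw [norm_mul, norm_mul, norm_osc, Complex.norm_real, Real.norm_of_nonneg hjb, mul_one] at h2
    have := norm_nonneg (thirdV α S a b k t)
    nlinarith [mul_nonneg hjb this]
  · refine (h1.const_mul_left ((jb k ^ s : ℝ) * osc (α * k ^ 3) t)).congr' ?_ EventuallyEq.rfl
    filter_upwards [hev] with δ hδ
    have e : coeffSnd s k (Φ t (δ • evenData s ha hb ha0))
        = (jb k ^ s : ℝ) * (osc (α * k ^ 3) t * mode α k t (v δ t)) := by
      rw [← fourierCoeffOn_eq_mode, ← (hrep δ hδ).2 k]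
      rfl
    rw [e]
    ring

end SolutionMap

end MajdaBiello

namespace MajdaBiello

open MeasureTheory Set intervalIntegral

/-! ### Oscillatory integrals -/

/-- `∫₀ᵗ e^{iθσ} dσ`. -/
noncomputable def oscInt (θ t : ℝ) : ℂ := ∫ σ in (0 : ℝ)..t, osc θ σ

/-- `∫₀ᵗ e^{-iθσ} ∫₀^σ e^{iθρ} dρ dσ`: the amplitude produced by an interaction of resonance
function `θ` followed by the reverse interaction. -/
noncomputable def returnInt (θ t : ℝ) : ℂ := ∫ σ in (0 : ℝ)..t, osc (-θ) σ * oscInt θ σ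

lemma continuous_oscInt (θ : ℝ) : Continuous (oscInt θ) :=
  continuous_primitive (fun _ _ => (continuous_osc θ).intervalIntegrable _ _) _

lemma osc_neg_mul (θ t : ℝ) : osc (-θ) t * osc θ t = 1 := by
  rw [osc, osc, ← Complex.exp_add]
  push_cast
  simp

lemma osc_zero_left (t : ℝ) : osc 0 t = 1 := by simp [osc]

lemma oscInt_eq {θ : ℝ} (hθ : θ ≠ 0) (t : ℝ) :
    oscInt θ t = (osc θ t - 1) / (Complex.I * θ) := by
  have h : Complex.I * (θ : ℂ) ≠ 0 := mul_ne_zero Complex.I_ne_zero (by exact_mod_cast hθ)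
  have h2 := integral_exp_mul_complex (a := 0) (b := t) h
  unfold oscInt osc
  push_cast at h2 ⊢
  simp_rw [← mul_assoc]
  rw [h2]
  simp

lemma norm_oscInt_le {θ : ℝ} (hθ : θ ≠ 0) (t : ℝ) : ‖oscInt θ t‖ ≤ 2 / |θ| := by
  rw [oscInt_eq hθ, norm_div, norm_mul, Complex.norm_I, one_mul, Complex.norm_real,
    Real.norm_eq_abs]
  gcongr
  refine (norm_sub_le _ _).trans ?_
  rw [norm_osc, norm_one]
  norm_num

lemma half_abs_le_norm_oscInt {θ t : ℝ} (h : |θ| * |t| ≤ 1 / 2) : |t| / 2 ≤ ‖oscInt θ t‖ := by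
  have h1 : ‖oscInt θ t - t‖ ≤ |t| / 2 := by
    have e : oscInt θ t - t = ∫ σ in (0 : ℝ)..t, (osc θ σ - 1) := by
      rw [integral_sub ((continuous_osc θ).intervalIntegrable _ _)
        (continuous_const.intervalIntegrable _ _)]
      simp [oscInt]
    rw [e]
    have h2 := norm_integral_le_of_norm_le_const (a := 0) (b := t)
      (f := fun σ => osc θ σ - 1) (C := 1 / 2) fun σ hσ => ?_
    · refine h2.trans (le_of_eq ?_)
      rw [sub_zero]; ring
    · have h3 : |σ| ≤ |t| := by
        have := abs_sub_left_of_mem_uIcc (uIoc_subset_uIcc hσ)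
        simpa using this
      have h4 := Real.norm_exp_I_mul_ofReal_sub_one_le (x := θ * σ)
      refine h4.trans ?_
      rw [Real.norm_eq_abs, abs_mul]
      exact (mul_le_mul_of_nonneg_left h3 (abs_nonneg _)).trans h
  have h5 : |t| ≤ ‖oscInt θ t‖ + ‖oscInt θ t - t‖ := by
    have := norm_sub_le (oscInt θ t) (oscInt θ t - t)
    rwa [sub_sub_cancel, Complex.norm_real, Real.norm_eq_abs] at this
  linarith

lemma norm_returnInt_le {θ : ℝ} (hθ : θ ≠ 0) (t : ℝ) : ‖returnInt θ t‖ ≤ 2 * |t| / |θ| := by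
  have h := norm_integral_le_of_norm_le_const (a := 0) (b := t)
    (f := fun σ => osc (-θ) σ * oscInt θ σ) (C := 2 / |θ|) fun σ _ => by
      rw [norm_mul, norm_osc, one_mul]
      exact norm_oscInt_le hθ σ
  refine h.trans (le_of_eq ?_)
  rw [sub_zero]; ring

lemma returnInt_eq {θ : ℝ} (hθ : θ ≠ 0) (t : ℝ) :
    returnInt θ t = (t - oscInt (-θ) t) / (Complex.I * θ) := by
  have hθ' : (θ : ℂ) ≠ 0 := by exact_mod_cast hθ
  have e : ∀ σ, osc (-θ) σ * oscInt θ σ = (1 - osc (-θ) σ) / (Complex.I * θ) := by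
    intro σ
    rw [oscInt_eq hθ, mul_div_assoc', mul_sub, osc_neg_mul, mul_one]
  unfold returnInt
  simp_rw [e]
  rw [intervalIntegral.integral_div, integral_sub (continuous_const.intervalIntegrable _ _)
    ((continuous_osc _).intervalIntegrable _ _)]
  simp [oscInt]

lemma returnInt_re {θ : ℝ} (hθ : θ ≠ 0) (t : ℝ) :
    (returnInt θ t).re = (1 - Real.cos (θ * t)) / θ ^ 2 := by
  have hθ' : (θ : ℂ) ≠ 0 := by exact_mod_cast hθ
  have e : returnInt θ t = ((-(t / θ) : ℝ) : ℂ) * Complex.I + ((1 / θ ^ 2 : ℝ) : ℂ) *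
      (1 - osc (-θ) t) := by
    rw [returnInt_eq hθ, oscInt_eq (neg_ne_zero.mpr hθ)]
    push_cast
    field_simp
    rw [Complex.I_sq]
    ring
  have h1 : (osc (-θ) t).re = Real.cos (θ * t) := by
    rw [osc, mul_comm, Complex.exp_ofReal_mul_I_re, neg_mul, Real.cos_neg]
  rw [e, Complex.add_re, Complex.re_ofReal_mul, Complex.re_ofReal_mul, Complex.I_re,
    Complex.sub_re, Complex.one_re, h1]
  ring

/-- The return amplitude is never much smaller than `1 / (1 + |θ|)`. -/
lemma exists_le_norm_returnInt {t : ℝ} (ht : t ≠ 0) :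
    ∃ c, 0 < c ∧ ∀ θ : ℝ, c / (1 + |θ|) ≤ ‖returnInt θ t‖ := by
  have hpi := Real.pi_gt_three
  have hpi2 : 2 / Real.pi < 1 := by rw [div_lt_one (by positivity)]; linarith
  have ht' : 0 < |t| := abs_pos.mpr ht
  have hc1 : 0 < 2 / Real.pi ^ 2 * t ^ 2 := by positivity
  have hc2 : 0 < |t| * (1 - 2 / Real.pi) := mul_pos ht' (by linarith)
  refine ⟨min (2 / Real.pi ^ 2 * t ^ 2) (|t| * (1 - 2 / Real.pi)), lt_min hc1 hc2, fun θ => ?_⟩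
  set c := min (2 / Real.pi ^ 2 * t ^ 2) (|t| * (1 - 2 / Real.pi)) with hc
  have hcpos : 0 < c := lt_min hc1 hc2
  by_cases hθ : θ = 0
  · subst hθ
    have e : returnInt 0 t = ((t ^ 2 / 2 : ℝ) : ℂ) := by
      have e1 : ∀ σ, oscInt 0 σ = σ := fun σ => by
        unfold oscInt
        simp [osc_zero_left]
      unfold returnInt
      simp_rw [e1, neg_zero, osc_zero_left, one_mul]
      rw [intervalIntegral.integral_ofReal, integral_id]
      simp
    rw [e, Complex.norm_real, Real.norm_of_nonneg (by positivity), abs_zero, add_zero, div_one]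
    refine (min_le_left _ _).trans ?_
    have : 2 / Real.pi ^ 2 ≤ 1 / 2 := by
      rw [div_le_div_iff₀ (by positivity) (by norm_num)]
      nlinarith
    nlinarith [sq_nonneg t]
  have hθ' : 0 < |θ| := abs_pos.mpr hθ
  rcases le_total (|θ * t|) Real.pi with h | h
  · -- here the real part `(1 - cos θt) / θ²` is bounded below
    have h1 := Real.cos_le_one_sub_mul_cos_sq h
    have h2 : 2 / Real.pi ^ 2 * t ^ 2 ≤ (returnInt θ t).re := by
      rw [returnInt_re hθ, le_div_iff₀ (by positivity)]
      nlinarith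
    calc c / (1 + |θ|) ≤ c := div_le_self hcpos.le (by linarith)
      _ ≤ 2 / Real.pi ^ 2 * t ^ 2 := min_le_left _ _
      _ ≤ (returnInt θ t).re := h2
      _ ≤ ‖returnInt θ t‖ := Complex.re_le_norm _
  · -- here the secular term `t / (iθ)` dominates
    rw [abs_mul] at h
    have h1 : |t| * (1 - 2 / Real.pi) ≤ ‖(t : ℂ) - oscInt (-θ) t‖ := by
      have h2 := norm_sub_norm_le (t : ℂ) (oscInt (-θ) t)
      have h3 := norm_oscInt_le (neg_ne_zero.mpr hθ) t
      rw [Complex.norm_real, Real.norm_eq_abs] at h2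
      rw [abs_neg] at h3
      have h4 : 2 / |θ| ≤ |t| * (2 / Real.pi) := by
        rw [mul_div_assoc', div_le_div_iff₀ hθ' Real.pi_pos]
        nlinarith
      linarith
    rw [returnInt_eq hθ, norm_div, norm_mul, Complex.norm_I, one_mul, Complex.norm_real,
      Real.norm_eq_abs]
    exact div_le_div₀ (norm_nonneg _) ((min_le_right _ _).trans h1) hθ' (by linarith)

/-! ### Picard iterates of two-mode data -/

/-- The Fourier coefficients of `2 cos (mx)`, for `m ≠ 0`. -/
def pairInd (m k : ℤ) : ℝ := if k = m ∨ k = -m then 1 else 0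

lemma pairInd_neg (m : ℤ) : pairInd (-m) = pairInd m := by
  funext k
  unfold pairInd
  exact if_congr (by rw [neg_neg, or_comm]) rfl rfl

lemma pairInd_self (m : ℤ) : pairInd m m = 1 := by simp [pairInd]

lemma pairInd_neg_self (m : ℤ) : pairInd m (-m) = 1 := by simp [pairInd]

lemma pairInd_of_ne {m k : ℤ} (h1 : k ≠ m) (h2 : k ≠ -m) : pairInd m k = 0 := by
  simp [pairInd, h1, h2]

lemma abs_pairInd_le (m k : ℤ) : |pairInd m k| ≤ 1 := by
  unfold pairInd
  split_ifs <;> simp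

/-- The frequencies `±m`, `±l`. -/
def quad (m l : ℤ) : Finset ℤ := {m, -m, l, -l}

lemma mem_quad {m l k : ℤ} : k ∈ quad m l ↔ k = m ∨ k = -m ∨ k = l ∨ k = -l := by
  simp [quad]

lemma card_quad_le (m l : ℤ) : (quad m l).card ≤ 4 := Finset.card_le_four

lemma isEvenOn_left (m l : ℤ) : IsEvenOn (quad m l) (pairInd m) where
  symm k hk := by rw [mem_quad] at hk ⊢; omega
  even k := by
    unfold pairInd
    exact if_congr (by omega) rfl rfl
  supp k hk := by
    rw [mem_quad] at hk
    exact pairInd_of_ne (by omega) (by omega)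

lemma isEvenOn_right (m l : ℤ) : IsEvenOn (quad m l) (pairInd l) where
  symm k hk := by rw [mem_quad] at hk ⊢; omega
  even k := by
    unfold pairInd
    exact if_congr (by omega) rfl rfl
  supp k hk := by
    rw [mem_quad] at hk
    exact pairInd_of_ne (by omega) (by omega)

lemma IsEvenOn.add {S : Finset ℤ} {a b : ℤ → ℝ} (ha : IsEvenOn S a) (hb : IsEvenOn S b) :
    IsEvenOn S (a + b) where
  symm := ha.symm
  even k := by simp [ha.even, hb.even]
  supp k hk := by simp [ha.supp k hk, hb.supp k hk]

lemma IsEvenOn.sub {S : Finset ℤ} {a b : ℤ → ℝ} (ha : IsEvenOn S a) (hb : IsEvenOn S b) :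
    IsEvenOn S (a - b) where
  symm := ha.symm
  even k := by simp [ha.even, hb.even]
  supp k hk := by simp [ha.supp k hk, hb.supp k hk]

lemma isEvenOn_zero (m l : ℤ) : IsEvenOn (quad m l) 0 where
  symm := (isEvenOn_left m l).symm
  even _ := rfl
  supp _ _ := rfl

lemma sum_pairInd {S : Finset ℤ} {m : ℤ} (hm : m ≠ 0) (h1 : m ∈ S) (h2 : -m ∈ S) (f : ℤ → ℂ) :
    ∑ j ∈ S, (pairInd m j : ℂ) * f j = f m + f (-m) := by
  have hne : m ≠ -m := by omega
  have h3 : ({m, -m} : Finset ℤ) ⊆ S := by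
    intro k hk
    simp only [Finset.mem_insert, Finset.mem_singleton] at hk
    rcases hk with rfl | rfl
    · exact h1
    · exact h2
  rw [← Finset.sum_subset h3, Finset.sum_pair hne, pairInd_self, pairInd_neg_self]
  · simp
  · intro k _ hk
    simp only [Finset.mem_insert, Finset.mem_singleton, not_or] at hk
    rw [pairInd_of_ne hk.1 hk.2]
    simp

section TwoModes

variable {α : ℝ} {S : Finset ℤ} {m l : ℤ}

/-- The interaction of `u` at the frequencies `±m` with `v` at `±l` feeds `v` at `m + l`. -/
lemma secondV_pairInd (hm : m ≠ 0) (hl : l ≠ 0) (hml : m + l ≠ 0) (h1 : m ∈ S) (h2 : -m ∈ S)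
    (t : ℝ) : secondV α S (pairInd m) (pairInd l) (m + l) t
      = -(Complex.I * (m + l)) * oscInt (res 1 α α m l) t := by
  unfold secondV oscInt
  rw [← intervalIntegral.integral_const_mul]
  refine integral_congr fun σ _ => ?_
  simp_rw [mul_assoc]
  rw [sum_pairInd hm h1 h2, add_sub_cancel_left, pairInd_self,
    pairInd_of_ne (m := l) (k := m + l - -m) (by omega) (by omega)]
  push_cast
  ring

/-- The interaction of `v` at the frequencies `±m` and `±l` feeds `u` at `m + l`; the difference
isolates the products of one `m`-mode and one `l`-mode. -/
lemma secondU_polar (hm : m ≠ 0) (hl : l ≠ 0) (hml : m + l ≠ 0) (h1 : m ∈ S) (h2 : -m ∈ S)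
    (h3 : l ∈ S) (h4 : -l ∈ S) (t : ℝ) :
    secondU α S (pairInd m + pairInd l) (m + l) t - secondU α S (pairInd m - pairInd l) (m + l) t
      = -(2 * Complex.I * (m + l)) * oscInt (res α α 1 m l) t := by
  unfold secondU oscInt
  have hosc := continuous_osc
  rw [← integral_sub (Continuous.intervalIntegrable (by fun_prop) _ _)
    (Continuous.intervalIntegrable (by fun_prop) _ _), ← intervalIntegral.integral_const_mul]
  refine integral_congr fun σ _ => ?_
  have e : ∀ k : ℤ, ∑ j ∈ S, (((pairInd m + pairInd l) j : ℝ) : ℂ) *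
        osc (res α α 1 j (k - j)) σ * ((pairInd m + pairInd l) (k - j) : ℝ) -
      ∑ j ∈ S, (((pairInd m - pairInd l) j : ℝ) : ℂ) *
        osc (res α α 1 j (k - j)) σ * ((pairInd m - pairInd l) (k - j) : ℝ)
      = 2 * (∑ j ∈ S, (pairInd m j : ℂ) * (osc (res α α 1 j (k - j)) σ * pairInd l (k - j)) +
          ∑ j ∈ S, (pairInd l j : ℂ) * (osc (res α α 1 j (k - j)) σ * pairInd m (k - j))) := by
    intro k
    rw [← Finset.sum_sub_distrib, ← Finset.sum_add_distrib, Finset.mul_sum]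
    refine Finset.sum_congr rfl fun j _ => ?_
    simp only [Pi.add_apply, Pi.sub_apply]
    push_cast
    ring
  have hsymm : res α α 1 l m = res α α 1 m l := by
    unfold res; ring
  rw [← mul_sub, e, sum_pairInd hm h1 h2, sum_pairInd hl h3 h4, add_sub_cancel_left,
    add_sub_cancel_right, pairInd_self, pairInd_self,
    pairInd_of_ne (m := l) (k := m + l - -m) (by omega) (by omega),
    pairInd_of_ne (m := m) (k := m + l - -l) (by omega) (by omega), hsymm]
  push_cast
  ring

lemma secondU_parallelogram (α : ℝ) (S : Finset ℤ) (x y : ℤ → ℝ) (k : ℤ) (t : ℝ) :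
    secondU α S (x + y) k t + secondU α S (x - y) k t
      = 2 * secondU α S x k t + 2 * secondU α S y k t := by
  unfold secondU
  have hosc := continuous_osc
  rw [← integral_add (Continuous.intervalIntegrable (by fun_prop) _ _)
    (Continuous.intervalIntegrable (by fun_prop) _ _), ← intervalIntegral.integral_const_mul,
    ← intervalIntegral.integral_const_mul,
    ← integral_add (Continuous.intervalIntegrable (by fun_prop) _ _)
    (Continuous.intervalIntegrable (by fun_prop) _ _)]
  refine integral_congr fun σ _ => ?_
  simp only [Finset.mul_sum, ← Finset.sum_add_distrib]
  refine Finset.sum_congr rfl fun j _ => ?_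
  simp only [Pi.add_apply, Pi.sub_apply]
  push_cast
  ring

lemma secondU_zero_freq (α : ℝ) (S : Finset ℤ) (b : ℤ → ℝ) (t : ℝ) : secondU α S b 0 t = 0 := by
  simp [secondU]

lemma secondU_pairInd_two_mul (hl : l ≠ 0) (h3 : l ∈ S) (h4 : -l ∈ S) (hm : m ≠ 0)
    (hml : m + l ≠ 0) (hml' : m - l ≠ 0) (t : ℝ) : secondU α S (pairInd l) (2 * m) t = 0 := by
  unfold secondU
  rw [integral_congr (g := fun _ => (0 : ℂ)), intervalIntegral.integral_zero]
  intro σ _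
  simp_rw [mul_assoc]
  rw [sum_pairInd hl h3 h4, pairInd_of_ne (m := l) (k := 2 * m - l) (by omega) (by omega),
    pairInd_of_ne (m := l) (k := 2 * m - -l) (by omega) (by omega)]
  simp

/-- The part of the third iterate of `v` at frequency `l` that is quadratic in `u` at `±m`: the
interaction with `u` at frequency `±m` is followed by the reverse interaction. -/
lemma thirdV_sub_pairInd (hm : m ≠ 0) (hl : l ≠ 0) (hml : m + l ≠ 0) (hml' : m - l ≠ 0) (t : ℝ) :
    thirdV α (quad m l) (pairInd m) (pairInd l) l t - thirdV α (quad m l) 0 (pairInd l) l t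
      = -(l * (m + l)) * returnInt (res 1 α α m l) t -
        l * (l - m) * returnInt (res 1 α α (-m) l) t := by
  have h1 : m ∈ quad m l := by simp [mem_quad]
  have h2 : -m ∈ quad m l := by simp [mem_quad]
  have hosc := continuous_osc
  have hV := continuous_secondV α (quad m l)
  have hU := continuous_secondU α (quad m l)
  have hE := continuous_oscInt
  unfold thirdV returnInt
  rw [← integral_sub (Continuous.intervalIntegrable (by fun_prop) _ _)
    (Continuous.intervalIntegrable (by fun_prop) _ _), ← intervalIntegral.integral_const_mul,
    ← intervalIntegral.integral_const_mul,
    ← integral_sub (Continuous.intervalIntegrable (by fun_prop) _ _)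
    (Continuous.intervalIntegrable (by fun_prop) _ _)]
  refine integral_congr fun σ _ => ?_
  have e1 : secondV α (quad m l) (pairInd m) (pairInd l) (l - m) σ
      = -(Complex.I * (l - m)) * oscInt (res 1 α α (-m) l) σ := by
    have := secondV_pairInd (α := α) (S := quad m l) (m := -m) (l := l) (by omega) hl (by omega) h2
      (by rwa [neg_neg]) σ
    rw [pairInd_neg, neg_add_eq_sub] at this
    rw [this]
    push_cast
    ring
  have e2 : secondV α (quad m l) (pairInd m) (pairInd l) (l - -m) σ
      = -(Complex.I * (m + l)) * oscInt (res 1 α α m l) σ := by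
    rw [sub_neg_eq_add, add_comm l m]
    exact secondV_pairInd hm hl hml h1 h2 σ
  have e3 : res 1 α α m (l - m) = -res 1 α α (-m) l := by
    unfold res; push_cast; ring
  have e4 : res 1 α α (-m) (l - -m) = -res 1 α α m l := by
    unfold res; push_cast; ring
  simp only [Pi.zero_apply, Complex.ofReal_zero, zero_mul, Finset.sum_const_zero, zero_add]
  simp_rw [mul_assoc]
  rw [sum_pairInd hm h1 h2, e1, e2, e3, e4]
  linear_combination (-(l : ℂ) *
    ((l - m) * (osc (-res 1 α α (-m) l) σ * oscInt (res 1 α α (-m) l) σ) +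
      (m + l) * (osc (-res 1 α α m l) σ * oscInt (res 1 α α m l) σ))) * (-Complex.I_sq)

/-- The part of the third iterate of `v` at frequency `m` that is linear in the data at `±m` and
quadratic in the data at `±l`, for data with vanishing `u`. -/
lemma thirdV_polar (hm : m ≠ 0) (hl : l ≠ 0) (hml : m + l ≠ 0) (hml' : m - l ≠ 0) (t : ℝ) :
    thirdV α (quad m l) 0 (pairInd m + pairInd l) m t +
        thirdV α (quad m l) 0 (pairInd m - pairInd l) m t -
        2 * thirdV α (quad m l) 0 (pairInd m) m t
      = -(2 * m * (m + l)) * returnInt (res α α 1 m l) t -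
        2 * m * (m - l) * returnInt (res α α 1 m (-l)) t := by
  have h1 : m ∈ quad m l := by simp [mem_quad]
  have h2 : -m ∈ quad m l := by simp [mem_quad]
  have h3 : l ∈ quad m l := by simp [mem_quad]
  have h4 : -l ∈ quad m l := by simp [mem_quad]
  have hosc := continuous_osc
  have hV := continuous_secondV α (quad m l)
  have hU := continuous_secondU α (quad m l)
  have hE := continuous_oscInt
  unfold thirdV returnInt
  rw [← integral_add (Continuous.intervalIntegrable (by fun_prop) _ _)
    (Continuous.intervalIntegrable (by fun_prop) _ _), ← intervalIntegral.integral_const_mul,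
    ← intervalIntegral.integral_const_mul, ← intervalIntegral.integral_const_mul,
    ← integral_sub (Continuous.intervalIntegrable (by fun_prop) _ _)
    (Continuous.intervalIntegrable (by fun_prop) _ _),
    ← integral_sub (Continuous.intervalIntegrable (by fun_prop) _ _)
    (Continuous.intervalIntegrable (by fun_prop) _ _)]
  refine integral_congr fun σ _ => ?_
  set x := pairInd m with hx
  set y := pairInd l with hy
  have e : ∑ j ∈ quad m l, (((x + y) j : ℝ) : ℂ) * osc (res α 1 α j (m - j)) σ *
        secondU α (quad m l) (x + y) (m - j) σ +
      ∑ j ∈ quad m l, (((x - y) j : ℝ) : ℂ) * osc (res α 1 α j (m - j)) σ *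
        secondU α (quad m l) (x - y) (m - j) σ -
      2 * ∑ j ∈ quad m l, (x j : ℂ) * osc (res α 1 α j (m - j)) σ *
        secondU α (quad m l) x (m - j) σ
      = ∑ j ∈ quad m l, (x j : ℂ) * (osc (res α 1 α j (m - j)) σ *
          (2 * secondU α (quad m l) y (m - j) σ)) +
        ∑ j ∈ quad m l, (y j : ℂ) * (osc (res α 1 α j (m - j)) σ *
          (secondU α (quad m l) (x + y) (m - j) σ - secondU α (quad m l) (x - y) (m - j) σ)) := by
    rw [Finset.mul_sum, ← Finset.sum_add_distrib, ← Finset.sum_sub_distrib,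
      ← Finset.sum_add_distrib]
    refine Finset.sum_congr rfl fun j _ => ?_
    have := secondU_parallelogram α (quad m l) x y (m - j) σ
    simp only [Pi.add_apply, Pi.sub_apply]
    push_cast
    linear_combination ((x j : ℂ) * osc (res α 1 α j (m - j)) σ) * this
  have e1 : secondU α (quad m l) (x + y) (m - l) σ - secondU α (quad m l) (x - y) (m - l) σ
      = -(2 * Complex.I * (m - l)) * oscInt (res α α 1 m (-l)) σ := by
    have := secondU_polar (α := α) (S := quad m l) (m := m) (l := -l) hm (by omega) (by omega) h1 h2
      h4 (by rwa [neg_neg]) σ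
    rw [pairInd_neg, ← sub_eq_add_neg] at this
    rw [this]
    push_cast
    ring
  have e2 : secondU α (quad m l) (x + y) (m - -l) σ - secondU α (quad m l) (x - y) (m - -l) σ
      = -(2 * Complex.I * (m + l)) * oscInt (res α α 1 m l) σ := by
    rw [sub_neg_eq_add]
    exact secondU_polar hm hl hml h1 h2 h3 h4 σ
  have e3 : res α 1 α l (m - l) = -res α α 1 m (-l) := by
    unfold res; push_cast; ring
  have e4 : res α 1 α (-l) (m - -l) = -res α α 1 m l := by
    unfold res; push_cast; ring
  have e5 : secondU α (quad m l) y (m - -m) σ = 0 := by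
    rw [sub_neg_eq_add, ← two_mul]
    exact secondU_pairInd_two_mul hl h3 h4 hm hml hml' σ
  simp only [Pi.zero_apply, Complex.ofReal_zero, zero_mul, Finset.sum_const_zero, zero_add]
  rw [← mul_add, mul_left_comm (2 : ℂ), ← mul_sub, e, sum_pairInd hm h1 h2, sum_pairInd hl h3 h4,
    sub_self, secondU_zero_freq, e1, e2, e3, e4, e5]
  linear_combination (-(2 * (m : ℂ)) * ((m - l) * (osc (-res α α 1 m (-l)) σ *
    oscInt (res α α 1 m (-l)) σ) + (m + l) * (osc (-res α α 1 m l) σ * oscInt (res α α 1 m l) σ)))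
      * (-Complex.I_sq)

end TwoModes

end MajdaBiello

namespace MajdaBiello

open Set Filter Topology Asymptotics

/-! ### Rational approximation -/

/-- There are fractions `m / n` with arbitrarily large `n` such that `|ρ - m / n| ≤ n^{-2-ν}`. -/
def Approximable (ρ ν : ℝ) : Prop :=
  ∀ N : ℕ, ∃ m n : ℤ, (N : ℤ) ≤ n ∧ 0 < n ∧ |ρ - m / n| ≤ (n : ℝ) ^ (-(2 + ν))

lemma approximable_of_rat {ρ : ℝ} (h : ∃ q : ℚ, (q : ℝ) = ρ) (ν : ℝ) : Approximable ρ ν := by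
  obtain ⟨q, rfl⟩ := h
  intro N
  have hd : 1 ≤ (q.den : ℤ) := by exact_mod_cast q.pos
  refine ⟨q.num * (N + 1), q.den * (N + 1), ?_, by positivity, ?_⟩
  · nlinarith
  · have h1 : ((q.num * (N + 1) : ℤ) : ℝ) / ((q.den * (N + 1) : ℤ) : ℝ) = q := by
      have h2 : (N : ℝ) + 1 ≠ 0 := by positivity
      have h3 : (q.den : ℝ) ≠ 0 := by exact_mod_cast q.den_ne_zero
      have h4 : (q : ℝ) = q.num / q.den := Rat.cast_def q
      rw [h4]
      push_cast
      field_simp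
    rw [h1, sub_self, abs_zero]
    have : 0 < ((q.den * (N + 1) : ℤ) : ℝ) := by exact_mod_cast (by positivity)
    positivity

/-- An irrational number keeps a positive distance from the fractions of bounded denominator. -/
lemma exists_pos_le_abs_sub {ρ : ℝ} (h : ¬∃ q : ℚ, (q : ℝ) = ρ) (N : ℕ) :
    ∃ c : ℝ, 0 < c ∧ ∀ m n : ℤ, 0 < n → n < N → c ≤ |ρ - m / n| := by
  have h1 : ∀ n ∈ Finset.Ioo (0 : ℤ) N, 0 < |ρ - round (n * ρ) / n| := by
    intro n _
    rw [abs_pos]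
    intro h0
    refine h ⟨(round (n * ρ) : ℚ) / n, ?_⟩
    push_cast
    linarith
  have h2 : ∀ᶠ c in 𝓝[>] (0 : ℝ), ∀ n ∈ Finset.Ioo (0 : ℤ) N, c ≤ |ρ - round (n * ρ) / n| := by
    rw [Filter.eventually_all_finset]
    intro n hn
    exact (eventually_le_nhds (h1 n hn)).filter_mono nhdsWithin_le_nhds
  obtain ⟨c, hc, hc0⟩ := (h2.and self_mem_nhdsWithin).exists
  refine ⟨c, hc0, fun m n hn hnN => (hc n (Finset.mem_Ioo.mpr ⟨hn, hnN⟩)).trans ?_⟩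
  have hn' : (0 : ℝ) < n := by exact_mod_cast hn
  have e : ∀ j : ℤ, |ρ - j / n| = |n * ρ - j| / n := by
    intro j
    rw [← abs_of_pos hn', ← abs_div, abs_of_pos hn']
    congr 1
    field_simp
  rw [e, e]
  exact div_le_div_of_nonneg_right (round_le ((n : ℝ) * ρ) m) hn'.le

lemma approximable_of_not_isOfType {ρ ν : ℝ} (h : ¬∃ q : ℚ, (q : ℝ) = ρ) (hν : 0 ≤ ν)
    (hty : ¬IsOfType ρ ν) : Approximable ρ ν := by
  by_contra hA
  unfold Approximable at hA
  push Not at hA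
  obtain ⟨N, hN⟩ := hA
  obtain ⟨c, hc, hc'⟩ := exists_pos_le_abs_sub h N
  have hpos : ∀ m n : ℤ, 0 < n → min c 1 / |(n : ℝ)| ^ (2 + ν) ≤ |ρ - m / n| := by
    intro m n hn
    have hn1 : (1 : ℝ) ≤ n := by exact_mod_cast hn
    have hpow : 1 ≤ (n : ℝ) ^ (2 + ν) := Real.one_le_rpow hn1 (by linarith)
    rw [abs_of_pos (by linarith : (0 : ℝ) < n)]
    rcases lt_or_ge n (N : ℤ) with hlt | hge
    · refine le_trans ?_ (hc' m n hn hlt)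
      exact (div_le_self (by positivity) hpow).trans (min_le_left _ _)
    · refine le_trans ?_ (hN m n hge hn).le
      rw [Real.rpow_neg (by linarith), ← one_div]
      gcongr
      exact min_le_right _ _
  refine hty ⟨min c 1, by positivity, fun m n hn => ?_⟩
  rcases lt_or_gt_of_ne hn with h0 | h0
  · have := hpos (-m) (-n) (by omega)
    push_cast at this
    rwa [abs_neg, neg_div_neg_eq] at this
  · exact hpos m n h0

/-- Dirichlet's approximation theorem. -/
lemma approximable_zero {ρ : ℝ} (h : ¬∃ q : ℚ, (q : ℝ) = ρ) : Approximable ρ 0 := by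
  intro N
  obtain ⟨c, hc, hc'⟩ := exists_pos_le_abs_sub h N
  obtain ⟨M, hM⟩ := exists_nat_gt (1 / c)
  have hM0 : (0 : ℝ) < M := (by positivity : (0 : ℝ) < 1 / c).trans hM
  obtain ⟨j, k, hk, hkM, hjk⟩ := Real.exists_int_int_abs_mul_sub_le ρ
    (n := M) (by exact_mod_cast hM0)
  have hk' : (0 : ℝ) < k := by exact_mod_cast hk
  have hk1 : (1 : ℝ) ≤ k := by exact_mod_cast hk
  have hkM' : (k : ℝ) ≤ M := by exact_mod_cast hkM
  have e : |ρ - j / k| = |k * ρ - j| / k := by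
    rw [← abs_of_pos hk', ← abs_div, abs_of_pos hk']
    congr 1
    field_simp
  refine ⟨j, k, ?_, hk, ?_⟩
  · by_contra hlt
    have h1 := hc' j k hk (by omega)
    rw [e] at h1
    rw [div_lt_iff₀ hc] at hM
    have h2 : |(k : ℝ) * ρ - j| / k ≤ 1 / (M + 1) := (div_le_self (abs_nonneg _) hk1).trans hjk
    have h3 := h1.trans h2
    rw [le_div_iff₀ (by positivity)] at h3
    nlinarith
  · rw [e, add_zero, Real.rpow_neg hk'.le, Real.rpow_two, div_le_iff₀ hk']
    refine hjk.trans ?_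
    have : ((k : ℝ) ^ 2)⁻¹ * k = 1 / k := by field_simp
    rw [this]
    gcongr
    linarith

lemma exists_approximable_of_one_lt {ρ : ℝ} (h : 1 < minimalTypeIndex ρ) :
    ∃ ν, 1 < ν ∧ Approximable ρ ν := by
  by_cases hq : ∃ q : ℚ, (q : ℝ) = ρ
  · exact ⟨2, by norm_num, approximable_of_rat hq 2⟩
  · obtain ⟨r, hr1, hr2⟩ := ENNReal.lt_iff_exists_nnreal_btwn.mp h
    have hr1' : (1 : ℝ) < r := by exact_mod_cast hr1
    refine ⟨r, hr1', approximable_of_not_isOfType hq r.2 fun hty => ?_⟩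
    rw [minimalTypeIndex, if_neg hq] at hr2
    refine absurd (sInf_le ?_) (not_le.mpr hr2)
    exact ⟨r, by linarith, hty, by simp⟩

/-- The value `ν = 0` is admitted even if the index is `0`. -/
lemma approximable_of_lt_toReal {ρ ν : ℝ} (h : minimalTypeIndex ρ ≤ 1) (hν : 0 ≤ ν)
    (hlt : ν = 0 ∨ ν < (minimalTypeIndex ρ).toReal) : Approximable ρ ν := by
  have hq : ¬∃ q : ℚ, (q : ℝ) = ρ := by
    intro hq
    rw [minimalTypeIndex, if_pos hq] at h
    exact absurd h (by simp)
  rcases hlt with rfl | hlt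
  · exact approximable_zero hq
  rcases hν.eq_or_lt with rfl | hν'
  · exact approximable_zero hq
  · refine approximable_of_not_isOfType hq hν fun hty => ?_
    have h1 : minimalTypeIndex ρ ≤ ENNReal.ofReal ν := by
      rw [minimalTypeIndex, if_neg hq]
      exact sInf_le ⟨ν, hν', hty, rfl⟩
    have h2 := ENNReal.toReal_mono ENNReal.ofReal_ne_top h1
    rw [ENNReal.toReal_ofReal hν] at h2
    linarith

/-! ### Nearly resonant frequencies -/

/-- Frequencies `m, l` of size comparable to `m + l` whose interaction is nearly resonant, while
that of `-m` and `l` is not. -/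
structure NearResonant (β γ δ ν κ K L : ℝ) (m l : ℤ) : Prop where
  pos : 0 < m + l
  left_ne : m ≠ 0
  right_ne : l ≠ 0
  left : κ * (m + l) ≤ jb m ∧ jb m ≤ K * (m + l)
  right : κ * (m + l) ≤ jb l ∧ jb l ≤ K * (m + l)
  sum : κ * (m + l) ≤ jb (m + l) ∧ jb (m + l) ≤ K * (m + l)
  abs_right : κ * (m + l) ≤ |(l : ℝ)| ∧ |(l : ℝ)| ≤ K * (m + l)
  abs_sub : |(l : ℝ) - m| ≤ K * (m + l)
  res_le : |res β γ δ m l| ≤ L * (m + l : ℝ) ^ (1 - ν)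
  le_res : κ * (m + l : ℝ) ^ 3 ≤ |res β γ δ (-m) l|

/-- Good rational approximations `m / n` of a root `ρ` of `βx³ + γ(1-x)³ = δ` give nearly resonant
frequencies `m` and `n - m`. -/
lemma exists_nearResonant {β γ δ ρ ν : ℝ} (hf : β * ρ ^ 3 + γ * (1 - ρ) ^ 3 - δ = 0)
    (hg : -β * ρ ^ 3 + γ * (1 - ρ) ^ 3 - δ * (1 - 2 * ρ) ^ 3 ≠ 0) (h0 : ρ ≠ 0) (h1 : 1 - ρ ≠ 0)
    (hν : 0 ≤ ν) (hA : Approximable ρ ν) :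
    ∃ κ K L, 0 < κ ∧ 0 < K ∧ 0 < L ∧ ∀ N : ℕ, ∃ m l : ℤ, (N : ℤ) ≤ m + l ∧
      NearResonant β γ δ ν κ K L m l ∧ (1 - 2 * ρ ≠ 0 → m - l ≠ 0) := by
  set f : ℝ → ℝ := fun x => β * x ^ 3 + γ * (1 - x) ^ 3 - δ with hfdef
  set g : ℝ → ℝ := fun x => -β * x ^ 3 + γ * (1 - x) ^ 3 - δ * (1 - 2 * x) ^ 3 with hgdef
  have hflip : ∃ L, 0 < L ∧ ∀ᶠ x in 𝓝 ρ, |f x| ≤ L * |x - ρ| := by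
    have hd : DifferentiableAt ℝ f ρ := by fun_prop
    obtain ⟨L, hL, hL'⟩ := hd.isBigO_sub.exists_pos
    refine ⟨L, hL, ?_⟩
    rw [isBigOWith_iff] at hL'
    filter_upwards [hL'] with x hx
    have hfρ : f ρ = 0 := hf
    simpa [hfρ] using hx
  obtain ⟨L, hL, hfL⟩ := hflip
  -- `κ` bounds from below, near `ρ`, all the quantities that must not vanish
  obtain ⟨κ, hκ, hκ0, hκ1, hκg, hκ'⟩ : ∃ κ : ℝ, 0 < κ ∧ κ < |ρ| ∧ κ < |1 - ρ| ∧
      κ < |g ρ| ∧ κ < 1 := by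
    have e : ∀ y : ℝ, 0 < y → ∀ᶠ κ in 𝓝[>] (0 : ℝ), κ < y := fun y hy =>
      (eventually_lt_nhds hy).filter_mono nhdsWithin_le_nhds
    have e0 : ∀ᶠ κ in 𝓝[>] (0 : ℝ), 0 < κ := eventually_mem_nhdsWithin
    obtain ⟨κ, a, b, c, d, e⟩ := (e0.and ((e _ (abs_pos.mpr h0)).and
      ((e _ (abs_pos.mpr h1)).and ((e _ (abs_pos.mpr hg)).and (e 1 one_pos))))).exists
    exact ⟨κ, a, b, c, d, e⟩
  have hnear : ∀ᶠ x in 𝓝 ρ, κ < |x| ∧ κ < |1 - x| ∧ (1 - 2 * ρ ≠ 0 → 1 - 2 * x ≠ 0) ∧ κ < |g x| ∧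
      |f x| ≤ L * |x - ρ| ∧ |x| < |ρ| + 1 := by
    have c1 : Continuous fun x : ℝ => |x| := by fun_prop
    have c2 : Continuous fun x : ℝ => |1 - x| := by fun_prop
    have c3 : ∀ᶠ x in 𝓝 ρ, (1 - 2 * ρ ≠ 0 → 1 - 2 * x ≠ 0) := by
      by_cases h2 : 1 - 2 * ρ = 0
      · exact Eventually.of_forall fun x h => absurd h2 h
      · have c : Continuous fun x : ℝ => 1 - 2 * x := by fun_prop
        filter_upwards [c.continuousAt.eventually_ne h2] with x hx _
        exact hx
    have c4 : Continuous fun x : ℝ => |g x| := by fun_prop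
    filter_upwards [c1.continuousAt.eventually_const_lt hκ0,
      c2.continuousAt.eventually_const_lt hκ1, c3,
      c4.continuousAt.eventually_const_lt hκg, hfL,
      c1.continuousAt.eventually_lt_const (lt_add_one |ρ|)] with x a b c d e f
    exact ⟨a, b, c, d, e, f⟩
  obtain ⟨ε, hε, hball⟩ := Metric.eventually_nhds_iff.mp hnear
  obtain ⟨N₀, hN₀⟩ := exists_nat_gt (1 / ε)
  refine ⟨κ, 2 * |ρ| + 4, L, hκ, by positivity, hL, fun N => ?_⟩
  -- the denominator exceeds `1 / ε`, so that `m / n` lies within `ε` of `ρ`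
  obtain ⟨m, n, hn, hn0, hmn⟩ := hA (max N (N₀ + 1))
  have hn1 : (1 : ℝ) ≤ n := by exact_mod_cast hn0
  have hnpos : (0 : ℝ) < n := by linarith
  have hnN : (N₀ : ℝ) < n := by
    have : ((N₀ + 1 : ℕ) : ℤ) ≤ n := le_trans (by exact_mod_cast le_max_right _ _) hn
    have : ((N₀ + 1 : ℕ) : ℝ) ≤ n := by exact_mod_cast this
    push_cast at this
    linarith
  set x : ℝ := m / n with hx
  have hm : (m : ℝ) = x * n := by rw [hx]; field_simp
  have hdist : dist x ρ < ε := by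
    rw [dist_comm, Real.dist_eq]
    refine hmn.trans_lt ?_
    calc (n : ℝ) ^ (-(2 + ν)) ≤ (n : ℝ) ^ (-1 : ℝ) :=
          Real.rpow_le_rpow_of_exponent_le hn1 (by linarith)
      _ = 1 / n := by rw [Real.rpow_neg_one, one_div]
      _ < ε := by
          rw [div_lt_comm₀ hnpos hε]
          linarith
  obtain ⟨a, b, c, d, e, k⟩ := hball hdist
  have hsum : ((m : ℝ) + ((n - m : ℤ) : ℝ)) = n := by push_cast; ring
  have habsm : |(m : ℝ)| = |x| * n := by rw [hm, abs_mul, abs_of_pos hnpos]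
  have habsl : |((n - m : ℤ) : ℝ)| = |1 - x| * n := by
    rw [show ((n - m : ℤ) : ℝ) = (1 - x) * n by push_cast; rw [hm]; ring, abs_mul,
      abs_of_pos hnpos]
  have habsd : |((n - m : ℤ) : ℝ) - m| = |1 - 2 * x| * n := by
    rw [show ((n - m : ℤ) : ℝ) - m = (1 - 2 * x) * n by push_cast; rw [hm]; ring, abs_mul,
      abs_of_pos hnpos]
  have hx1 : |1 - x| ≤ |ρ| + 2 := by
    have := abs_sub (1 : ℝ) x
    rw [abs_one] at this
    linarith
  have hx2 : |1 - 2 * x| ≤ 2 * |ρ| + 3 := by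
    have := abs_sub (1 : ℝ) (2 * x)
    rw [abs_one, abs_mul, abs_two] at this
    linarith
  have hρ := abs_nonneg ρ
  refine ⟨m, n - m, by have := le_max_left N (N₀ + 1); omega, ?_⟩
  have hjb : ∀ (j : ℤ) (y : ℝ), |(j : ℝ)| = y * n → κ ≤ y → y ≤ 2 * |ρ| + 3 →
      κ * n ≤ jb j ∧ jb j ≤ (2 * |ρ| + 4) * n := by
    intro j y hj h1 h2
    unfold jb
    rw [hj]
    have h3 := mul_le_mul_of_nonneg_right h1 hnpos.le
    have h4 := mul_le_mul_of_nonneg_right h2 hnpos.le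
    exact ⟨by linarith, by linarith⟩
  refine ⟨?_, fun h2 h => c h2 ?_⟩
  swap
  · have h' : ((n - m : ℤ) : ℝ) = m := by exact_mod_cast (by omega : n - m = m)
    rw [h', sub_self, abs_zero] at habsd
    exact abs_eq_zero.mp ((mul_eq_zero.mp habsd.symm).resolve_right hnpos.ne')
  constructor
  · omega
  · rintro rfl
    rw [Int.cast_zero, abs_zero] at habsm
    exact (mul_pos (hκ.trans a) hnpos).ne habsm
  · intro h
    rw [h, Int.cast_zero, abs_zero] at habsl
    exact (mul_pos (hκ.trans b) hnpos).ne habsl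
  all_goals rw [hsum]
  · exact hjb m _ habsm a.le (by linarith)
  · exact hjb (n - m) _ habsl b.le (by linarith)
  · refine hjb _ 1 ?_ hκ'.le (by linarith)
    rw [Int.cast_add, hsum, abs_of_pos hnpos, one_mul]
  · rw [habsl]
    exact ⟨mul_le_mul_of_nonneg_right b.le hnpos.le,
      mul_le_mul_of_nonneg_right (by linarith) hnpos.le⟩
  · rw [habsd]
    exact mul_le_mul_of_nonneg_right (by linarith) hnpos.le
  · have e1 : res β γ δ m (n - m) = n ^ 3 * f x := by
      unfold res
      push_cast
      rw [hfdef, hm]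
      ring
    rw [e1, abs_mul, abs_of_pos (by positivity)]
    have e2 : (n : ℝ) ^ (1 - ν) = n ^ 3 * (n : ℝ) ^ (-(2 + ν)) := by
      rw [← Real.rpow_natCast, ← Real.rpow_add hnpos]
      congr 1
      push_cast
      ring
    rw [e2]
    have e3 : |x - ρ| ≤ (n : ℝ) ^ (-(2 + ν)) := by rw [abs_sub_comm]; exact hmn
    calc (n : ℝ) ^ 3 * |f x| ≤ n ^ 3 * (L * |x - ρ|) := by gcongr
      _ ≤ n ^ 3 * (L * (n : ℝ) ^ (-(2 + ν))) := by gcongr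
      _ = _ := by ring
  · have e1 : res β γ δ (-m) (n - m) = n ^ 3 * g x := by
      unfold res
      push_cast
      rw [hgdef, hm]
      ring
    rw [e1, abs_mul, abs_of_pos (by positivity), mul_comm]
    gcongr

/-! ### Growth of the Picard iterates -/

lemma rpow_bounds {κ K y z : ℝ} (hκ : 0 < κ) (hy : 0 < y) (h1 : κ * y ≤ z) (h2 : z ≤ K * y)
    (s : ℝ) : min (κ ^ s) (K ^ s) * y ^ s ≤ z ^ s ∧ z ^ s ≤ max (κ ^ s) (K ^ s) * y ^ s := by
  have hz : 0 < z := (by positivity : 0 < κ * y).trans_le h1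
  have hK : 0 < K := pos_of_mul_pos_left (hz.trans_le h2) hy.le
  have hys := (Real.rpow_pos_of_pos hy s).le
  rcases le_total 0 s with hs | hs
  · have a := Real.rpow_le_rpow (by positivity) h1 hs
    have b := Real.rpow_le_rpow hz.le h2 hs
    rw [Real.mul_rpow hκ.le hy.le] at a
    rw [Real.mul_rpow hK.le hy.le] at b
    exact ⟨(mul_le_mul_of_nonneg_right (min_le_left _ _) hys).trans a,
      b.trans (mul_le_mul_of_nonneg_right (le_max_right _ _) hys)⟩
  · have a := Real.rpow_le_rpow_of_nonpos (by positivity) h1 hs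
    have b := Real.rpow_le_rpow_of_nonpos hz h2 hs
    rw [Real.mul_rpow hκ.le hy.le] at a
    rw [Real.mul_rpow hK.le hy.le] at b
    exact ⟨(mul_le_mul_of_nonneg_right (min_le_right _ _) hys).trans b,
      a.trans (mul_le_mul_of_nonneg_right (le_max_left _ _) hys)⟩

lemma le_of_frequently_rpow_le {a b C : ℝ}
    (h : ∀ N : ℕ, ∃ y : ℝ, (N : ℝ) ≤ y ∧ 1 ≤ y ∧ y ^ a ≤ C * y ^ b) : a ≤ b := by
  by_contra hab
  push Not at hab
  have h1 : Tendsto (fun y : ℝ => y ^ (a - b)) atTop atTop :=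
    tendsto_rpow_atTop (by linarith)
  obtain ⟨Y, hY⟩ := eventually_atTop.mp (h1.eventually_gt_atTop C)
  obtain ⟨N, hN⟩ := exists_nat_ge Y
  obtain ⟨y, hy1, hy2, hy3⟩ := h N
  have hy0 : 0 < y := by linarith
  have h2 := hY y (hN.trans hy1)
  rw [Real.rpow_sub hy0, lt_div_iff₀ (Real.rpow_pos_of_pos hy0 b)] at h2
  linarith

/-- A near resonance of order `ν > 1` makes the second iterate as large as `n = m + l` for modes
of unit amplitude; this contradicts its bound in `H^s` for large `n`, unless `s ≥ 1`. -/
lemma one_le_of_second_le {β γ δ ν κ K L s t C : ℝ} (hκ : 0 < κ) (hν : 1 < ν)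
    (ht : t ≠ 0)
    (hres : ∀ N : ℕ, ∃ m l : ℤ, (N : ℤ) ≤ m + l ∧ NearResonant β γ δ ν κ K L m l)
    (hC : 0 ≤ C)
    (h : ∀ m l : ℤ, m ≠ 0 → l ≠ 0 → m + l ≠ 0 → jb (m + l) ^ s * (|(m + l : ℝ)| *
      ‖oscInt (res β γ δ m l) t‖) ≤ C * (max (jb m ^ s) (jb l ^ s)) ^ 2) : 1 ≤ s := by
  have ht' : 0 < |t| := abs_pos.mpr ht
  have hlim : Tendsto (fun y : ℝ => L * y ^ (1 - ν) * |t|) atTop (𝓝 0) := by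
    have := (tendsto_rpow_neg_atTop (y := ν - 1) (by linarith)).const_mul L |>.mul_const |t|
    simpa using this
  obtain ⟨Y, hY⟩ := eventually_atTop.mp (hlim.eventually_le_const (by norm_num : (0 : ℝ) < 1 / 2))
  obtain ⟨N₀, hN₀⟩ := exists_nat_ge Y
  have key : s + 1 ≤ 2 * s := by
    refine le_of_frequently_rpow_le
      (C := C * max (κ ^ s) (K ^ s) ^ 2 / (min (κ ^ s) (K ^ s) * (|t| / 2))) fun N => ?_
    obtain ⟨m, l, hN, hr⟩ := hres (max N N₀)
    have hy1 : (1 : ℝ) ≤ m + l := by exact_mod_cast hr.pos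
    have hN1 : (max N N₀ : ℕ) ≤ (m + l : ℝ) := by exact_mod_cast hN
    have hNy : (N : ℝ) ≤ m + l := le_trans (by exact_mod_cast le_max_left _ _) hN1
    have hN₀y : Y ≤ m + l := hN₀.trans (le_trans (by exact_mod_cast le_max_right _ _) hN1)
    refine ⟨m + l, hNy, hy1, ?_⟩
    have hb := h m l hr.left_ne hr.right_ne hr.pos.ne'
    set y : ℝ := m + l with hy
    have hy0 : 0 < y := by linarith
    have hK : 0 < K := pos_of_mul_pos_left (lt_of_lt_of_le (jb_pos m) hr.left.2) hy0.le
    have hE := half_abs_le_norm_oscInt (θ := res β γ δ m l) (t := t)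
      ((mul_le_mul_of_nonneg_right hr.res_le (abs_nonneg t)).trans (hY y hN₀y))
    have b1 := (rpow_bounds hκ hy0 hr.sum.1 hr.sum.2 s).1
    have b2 := (rpow_bounds hκ hy0 hr.left.1 hr.left.2 s).2
    have b3 := (rpow_bounds hκ hy0 hr.right.1 hr.right.2 s).2
    have hmin : 0 < min (κ ^ s) (K ^ s) :=
      lt_min (Real.rpow_pos_of_pos hκ s) (Real.rpow_pos_of_pos hK s)
    have hm0 := (Real.rpow_pos_of_pos (jb_pos m) s).le
    have hs0 := (Real.rpow_pos_of_pos (jb_pos (m + l)) s).le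
    have hys := Real.rpow_pos_of_pos hy0 s
    rw [abs_of_pos hy0] at hb
    have l1 : min (κ ^ s) (K ^ s) * y ^ s * (y * (|t| / 2))
        ≤ C * (max (κ ^ s) (K ^ s) * y ^ s) ^ 2 := by
      refine le_trans ?_ (hb.trans ?_)
      · gcongr
      · have : 0 ≤ max (jb m ^ s) (jb l ^ s) := hm0.trans (le_max_left _ _)
        gcongr
        exact max_le b2 b3
    rw [div_mul_eq_mul_div, le_div_iff₀ (by positivity), Real.rpow_add hy0, Real.rpow_one,
      mul_comm 2 s, Real.rpow_mul hy0.le, Real.rpow_two]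
    linarith
  linarith

/-- A near resonance of order `0 ≤ ν ≤ 1` makes the third iterate as large as `n^{1+ν}`, `n = m +
l`, for modes of unit amplitude, the contribution of `-m` and `l` staying bounded. -/
lemma le_of_third_le {β γ δ ν κ K L s t C : ℝ} (hκ : 0 < κ) (hK : 0 < K) (hL : 0 < L)
    (hν0 : 0 ≤ ν) (hν1 : ν ≤ 1) (ht : t ≠ 0)
    (hres : ∀ N : ℕ, ∃ m l : ℤ, (N : ℤ) ≤ m + l ∧ NearResonant β γ δ ν κ K L m l ∧
      m - l ≠ 0)
    (hC : 0 ≤ C)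
    (h : ∀ m l : ℤ, m ≠ 0 → l ≠ 0 → m + l ≠ 0 → m - l ≠ 0 → jb l ^ s *
      (|(l : ℝ)| * |(m + l : ℝ)| * ‖returnInt (res β γ δ m l) t‖ -
        |(l : ℝ)| * |(l : ℝ) - m| * ‖returnInt (res β γ δ (-m) l) t‖)
      ≤ C * (max (jb m ^ s) (jb l ^ s)) ^ 3) : 1 / 2 + 1 / 2 * ν ≤ s := by
  have ht' : 0 < |t| := abs_pos.mpr ht
  obtain ⟨c, hc, hc'⟩ := exists_le_norm_returnInt ht
  set A : ℝ := κ * (c / (1 + L)) with hA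
  set B : ℝ := K * K * (2 * |t| / κ) with hB
  have hA0 : 0 < A := by positivity
  have hB0 : 0 < B := by positivity
  obtain ⟨N₀, hN₀⟩ := exists_nat_ge (2 * B / A)
  have key : s + (1 + ν) ≤ 3 * s := by
    refine le_of_frequently_rpow_le
      (C := C * max (κ ^ s) (K ^ s) ^ 3 / (min (κ ^ s) (K ^ s) * (A / 2))) fun N => ?_
    obtain ⟨m, l, hN, hr, hsub⟩ := hres (max N N₀)
    have hy1 : (1 : ℝ) ≤ m + l := by exact_mod_cast hr.pos
    have hN1 : (max N N₀ : ℕ) ≤ (m + l : ℝ) := by exact_mod_cast hN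
    have hNy : (N : ℝ) ≤ m + l := le_trans (by exact_mod_cast le_max_left _ _) hN1
    have hN₀y : 2 * B / A ≤ m + l := hN₀.trans (le_trans (by exact_mod_cast le_max_right _ _) hN1)
    refine ⟨m + l, hNy, hy1, ?_⟩
    have hb := h m l hr.left_ne hr.right_ne hr.pos.ne' hsub
    have hle := hr.res_le
    have hge := hr.le_res
    have hl := hr.abs_right
    have hd := hr.abs_sub
    have hsum := hr.right
    have hleft := hr.left
    set y : ℝ := m + l with hy
    have hy0 : 0 < y := by linarith
    rw [abs_of_pos hy0] at hb
    have hyν : 1 ≤ y ^ (1 - ν) := Real.one_le_rpow hy1 (by linarith)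
    have e1 : c / (1 + L) * y ^ (ν - 1) ≤ ‖returnInt (res β γ δ m l) t‖ := by
      refine le_trans ?_ (hc' _)
      have : y ^ (ν - 1) = (y ^ (1 - ν))⁻¹ := by rw [← Real.rpow_neg hy0.le, neg_sub]
      rw [this, ← div_eq_mul_inv, div_div]
      gcongr
      nlinarith
    have hres0 : res β γ δ (-m) l ≠ 0 := by
      intro h0
      rw [h0, abs_zero] at hge
      have : 0 < κ * y ^ 3 := by positivity
      linarith
    have e2 : ‖returnInt (res β γ δ (-m) l) t‖ ≤ 2 * |t| / (κ * y ^ 3) :=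
      (norm_returnInt_le hres0 t).trans (by gcongr)
    have e3 : A * y ^ (1 + ν) ≤ |(l : ℝ)| * y * ‖returnInt (res β γ δ m l) t‖ := by
      calc A * y ^ (1 + ν) = κ * y * y * (c / (1 + L) * y ^ (ν - 1)) := by
            rw [show 1 + ν = 1 + 1 + (ν - 1) by ring, Real.rpow_add hy0, Real.rpow_add hy0,
              Real.rpow_one, hA]
            ring
        _ ≤ _ := by
            have := hl.1
            gcongr
    have e4 : |(l : ℝ)| * |(l : ℝ) - m| * ‖returnInt (res β γ δ (-m) l) t‖ ≤ B := by
      calc |(l : ℝ)| * |(l : ℝ) - m| * ‖returnInt (res β γ δ (-m) l) t‖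
          ≤ K * y * (K * y) * (2 * |t| / (κ * y ^ 3)) := by
            have := hl.2
            gcongr
        _ = B / y := by
            rw [hB]
            field_simp
        _ ≤ B := div_le_self hB0.le hy1
    have e5 : 2 * B ≤ A * y ^ (1 + ν) := by
      rw [div_le_iff₀ hA0] at hN₀y
      have : y ≤ y ^ (1 + ν) := by
        calc y = y ^ (1 : ℝ) := (Real.rpow_one y).symm
          _ ≤ _ := Real.rpow_le_rpow_of_exponent_le hy1 (by linarith)
      nlinarith
    have b1 := (rpow_bounds hκ hy0 hsum.1 hsum.2 s).1
    have b2 := (rpow_bounds hκ hy0 hleft.1 hleft.2 s).2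
    have b3 := (rpow_bounds hκ hy0 hsum.1 hsum.2 s).2
    have hmin : 0 < min (κ ^ s) (K ^ s) :=
      lt_min (Real.rpow_pos_of_pos hκ s) (Real.rpow_pos_of_pos hK s)
    have hm0 := (Real.rpow_pos_of_pos (jb_pos m) s).le
    have hl0 := (Real.rpow_pos_of_pos (jb_pos l) s).le
    have hys := Real.rpow_pos_of_pos hy0 s
    have hyν' := Real.rpow_pos_of_pos hy0 (1 + ν)
    have l1 : min (κ ^ s) (K ^ s) * y ^ s * (A / 2 * y ^ (1 + ν))
        ≤ C * (max (κ ^ s) (K ^ s) * y ^ s) ^ 3 := by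
      refine le_trans ?_ (hb.trans ?_)
      · exact mul_le_mul b1 (by linarith) (by positivity) hl0
      · have : 0 ≤ max (jb m ^ s) (jb l ^ s) := hm0.trans (le_max_left _ _)
        gcongr
        exact max_le b2 b3
    have e6 : y ^ (3 * s) = (y ^ s) ^ 3 := by
      rw [mul_comm, Real.rpow_mul hy0.le]
      exact Real.rpow_natCast _ 3
    rw [div_mul_eq_mul_div, le_div_iff₀ (by positivity), Real.rpow_add hy0, e6]
    linarith
  linarith

end MajdaBiello

namespace MajdaBiello

open Set Filter Topology

/-! ### The resonances of the Majda–Biello system -/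

/-- `c₁` is a root of `αx³ + α(1-x)³ = 1`, and replacing `m` by `-m` destroys the resonance of the
frequencies `m` and `n - m` with `m / n` close to `c₁`. -/
lemma c₁_properties {α : ℝ} (h0 : 0 < α) (h1 : α < 1) :
    α * c₁ α ^ 3 + α * (1 - c₁ α) ^ 3 - 1 = 0 ∧
    -α * c₁ α ^ 3 + α * (1 - c₁ α) ^ 3 - 1 * (1 - 2 * c₁ α) ^ 3 ≠ 0 ∧
    c₁ α ≠ 0 ∧ 1 - c₁ α ≠ 0 := by
  have hinv : 1 < α⁻¹ := (one_lt_inv₀ h0).mpr h1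
  have hs3 : 3 < √(-3 + 12 * α⁻¹) := by
    rw [Real.lt_sqrt (by norm_num)]
    linarith
  have hsq : √(-3 + 12 * α⁻¹) ^ 2 = -3 + 12 * α⁻¹ := Real.sq_sqrt (by linarith)
  have hc : 1 < c₁ α := by
    unfold c₁
    linarith
  have hquad : 3 * α * c₁ α ^ 2 - 3 * α * c₁ α + α - 1 = 0 := by
    have : α * α⁻¹ = 1 := mul_inv_cancel₀ h0.ne'
    unfold c₁
    linear_combination (α / 12) * hsq + this
  generalize c₁ α = c at *
  refine ⟨by linear_combination hquad, ?_, by linarith, by linarith⟩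
  have e : -α * c ^ 3 + α * (1 - c) ^ 3 - 1 * (1 - 2 * c) ^ 3
      = (1 - 2 * c) * (α * (1 - c + c ^ 2) - (1 - 2 * c) ^ 2) := by ring
  rw [e]
  refine mul_ne_zero (by linarith) (ne_of_lt ?_)
  nlinarith [mul_pos h0 (sub_pos.mpr hc)]

/-- The analogue of `c₁_properties` for the two nonzero roots of `x³ + α(1-x)³ = α`. -/
lemma d_properties {α d : ℝ} (h0 : 0 < α) (h1 : α < 1)
    (hquad : (1 - α) * d ^ 2 + 3 * α * d - 3 * α = 0) :
    1 * d ^ 3 + α * (1 - d) ^ 3 - α = 0 ∧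
    -1 * d ^ 3 + α * (1 - d) ^ 3 - α * (1 - 2 * d) ^ 3 ≠ 0 ∧
    d ≠ 0 ∧ 1 - d ≠ 0 := by
  have hd0 : d ≠ 0 := by
    rintro rfl
    simp at hquad
    linarith
  have hd1 : 1 - d ≠ 0 := by
    intro h
    obtain rfl : d = 1 := by linarith
    linarith
  refine ⟨by linear_combination d * hquad, ?_, hd0, hd1⟩
  have e : -1 * d ^ 3 + α * (1 - d) ^ 3 - α * (1 - 2 * d) ^ 3 = -(6 * α * d ^ 2 * (1 - d)) := by
    linear_combination (-d) * hquad
  rw [e]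
  have := h0.ne'
  simp [hd0, hd1, this]

lemma quad_d₁ {α : ℝ} (h0 : 0 < α) (h1 : α < 1) :
    (1 - α) * d₁ α ^ 2 + 3 * α * d₁ α - 3 * α = 0 := by
  have hsq : √(3 * α * (4 - α)) ^ 2 = 3 * α * (4 - α) := Real.sq_sqrt (by nlinarith)
  have hne : 1 - α ≠ 0 := by linarith
  unfold d₁
  generalize √(3 * α * (4 - α)) = r at *
  field_simp
  linear_combination hsq

lemma quad_d₂ {α : ℝ} (h0 : 0 < α) (h1 : α < 1) :
    (1 - α) * d₂ α ^ 2 + 3 * α * d₂ α - 3 * α = 0 := by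
  have hsq : √(3 * α * (4 - α)) ^ 2 = 3 * α * (4 - α) := Real.sq_sqrt (by nlinarith)
  have hne : 1 - α ≠ 0 := by linarith
  unfold d₂
  generalize √(3 * α * (4 - α)) = r at *
  field_simp
  linear_combination hsq

/-! ### Lower bounds on the regularity -/

lemma norm_evenData_quad_le {a b : ℤ → ℝ} {m l : ℤ} (s : ℝ) (ha : IsEvenOn (quad m l) a)
    (hb : IsEvenOn (quad m l) b) (ha0 : a 0 = 0) (ha2 : ∀ k, |a k| ≤ 2) (hb2 : ∀ k, |b k| ≤ 2) :
    ‖evenData s ha hb ha0‖ ≤ 4 * max (jb m ^ s) (jb l ^ s) := by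
  have hneg : ∀ k : ℤ, jb (-k) = jb k := fun k => by simp [jb]
  have hm0 := (Real.rpow_pos_of_pos (jb_pos m) s).le
  have hW0 : 0 ≤ max (jb m ^ s) (jb l ^ s) := hm0.trans (le_max_left _ _)
  have hW : ∀ k ∈ quad m l, jb k ^ s ≤ max (jb m ^ s) (jb l ^ s) := by
    intro k hk
    rw [mem_quad] at hk
    rcases hk with rfl | rfl | rfl | rfl <;> simp [hneg]
  have hcard : √((quad m l).card : ℝ) ≤ 2 := by
    rw [Real.sqrt_le_left (by norm_num)]
    have := card_quad_le m l
    norm_num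
    exact_mod_cast this
  refine (norm_evenData_le s ha hb ha0 (B := max (jb m ^ s) (jb l ^ s) * 2) (by positivity)
    (fun k hk => mul_le_mul (hW k hk) (ha2 k) (abs_nonneg _) hW0)
    (fun k hk => mul_le_mul (hW k hk) (hb2 k) (abs_nonneg _) hW0)).trans ?_
  nlinarith

lemma abs_pairInd_le_two (m k : ℤ) : |pairInd m k| ≤ 2 :=
  (abs_pairInd_le m k).trans (by norm_num)

lemma abs_pairInd_add_le (m l k : ℤ) : |(pairInd m + pairInd l) k| ≤ 2 :=
  (abs_add_le _ _).trans (by linarith [abs_pairInd_le m k, abs_pairInd_le l k])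

lemma abs_pairInd_sub_le (m l k : ℤ) : |(pairInd m - pairInd l) k| ≤ 2 :=
  (abs_sub _ _).trans (by linarith [abs_pairInd_le m k, abs_pairInd_le l k])

lemma pairInd_zero_right {m : ℤ} (hm : m ≠ 0) : pairInd m 0 = 0 :=
  pairInd_of_ne (by omega) (by omega)

section Bounds

variable {α s T : ℝ} {U : Set (Data s)} {Φ : ℝ → Data s → Sobolev s × Sobolev s} {t : ℝ}

/-- Bounds on the second iterates fed by the interactions `v v → u` and `u v → v`. -/
lemma IsSolutionMap.exists_oscInt_le (hΦ : IsSolutionMap α s T U Φ) (hU : U ∈ 𝓝 (0 : Data s))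
    (ht : |t| < T) (hC : ContDiffAt ℝ 2 (Φ t) 0) :
    ∃ C, 0 ≤ C ∧ ∀ m l : ℤ, m ≠ 0 → l ≠ 0 → m + l ≠ 0 →
      jb (m + l) ^ s * (|(m + l : ℝ)| * ‖oscInt (res α α 1 m l) t‖)
        ≤ C * (max (jb m ^ s) (jb l ^ s)) ^ 2 ∧
      jb (m + l) ^ s * (|(m + l : ℝ)| * ‖oscInt (res 1 α α m l) t‖)
        ≤ C * (max (jb m ^ s) (jb l ^ s)) ^ 2 := by
  obtain ⟨C, hC0, hC⟩ := hΦ.exists_second_le hU ht hC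
  refine ⟨16 * C, by positivity, fun m l hm hl hml => ?_⟩
  have h1 : m ∈ quad m l := by simp [mem_quad]
  have h2 : -m ∈ quad m l := by simp [mem_quad]
  have h3 : l ∈ quad m l := by simp [mem_quad]
  have h4 : -l ∈ quad m l := by simp [mem_quad]
  have hjb := (Real.rpow_pos_of_pos (jb_pos (m + l)) s).le
  have hsq : ∀ {a b : ℤ → ℝ} (ha : IsEvenOn (quad m l) a) (hb : IsEvenOn (quad m l) b)
      (ha0 : a 0 = 0), (∀ k, |a k| ≤ 2) → (∀ k, |b k| ≤ 2) →
      C * ‖evenData s ha hb ha0‖ ^ 2 ≤ 16 * C * (max (jb m ^ s) (jb l ^ s)) ^ 2 := by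
    intro a b ha hb ha0 ha2 hb2
    have := pow_le_pow_left₀ (norm_nonneg _) (norm_evenData_quad_le s ha hb ha0 ha2 hb2) 2
    nlinarith
  have hnorm : ‖(m + l : ℂ)‖ = |(m + l : ℝ)| := by
    rw [← Real.norm_eq_abs, ← Complex.norm_real]
    push_cast
    rfl
  constructor
  · have e := secondU_polar (α := α) (S := quad m l) hm hl hml h1 h2 h3 h4 t
    have b1 := (hC (quad m l) 0 _ (isEvenOn_zero m l) ((isEvenOn_left m l).add (isEvenOn_right m l))
      rfl (m + l)).1.trans (hsq _ _ _ (by simp) (abs_pairInd_add_le m l))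
    have b2 := (hC (quad m l) 0 _ (isEvenOn_zero m l) ((isEvenOn_left m l).sub (isEvenOn_right m l))
      rfl (m + l)).1.trans (hsq _ _ _ (by simp) (abs_pairInd_sub_le m l))
    have e2 : 2 * (|(m + l : ℝ)| * ‖oscInt (res α α 1 m l) t‖) ≤
        ‖secondU α (quad m l) (pairInd m + pairInd l) (m + l) t‖ +
          ‖secondU α (quad m l) (pairInd m - pairInd l) (m + l) t‖ := by
      refine le_trans (le_of_eq ?_) (norm_sub_le _ _)
      rw [e, norm_mul, norm_neg, norm_mul, norm_mul, Complex.norm_I, hnorm]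
      norm_num
      ring
    nlinarith [mul_le_mul_of_nonneg_left e2 hjb]
  · have e := secondV_pairInd (α := α) (S := quad m l) hm hl hml h1 h2 t
    have b := (hC (quad m l) _ _ (isEvenOn_left m l) (isEvenOn_right m l)
      (pairInd_zero_right hm) (m + l)).2.trans
        (hsq _ _ _ (abs_pairInd_le_two m) (abs_pairInd_le_two l))
    rwa [e, norm_mul, norm_neg, norm_mul, Complex.norm_I, hnorm, one_mul] at b

/-- Bounds on the parts of the third iterate of `v` fed by the interactions `v v → u` and `u v → v`
followed by the reverse interactions. -/
lemma IsSolutionMap.exists_returnInt_le (hΦ : IsSolutionMap α s T U Φ) (hU : U ∈ 𝓝 (0 : Data s))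
    (ht : |t| < T) (hC : ContDiffAt ℝ 3 (Φ t) 0) :
    ∃ C, 0 ≤ C ∧ ∀ m l : ℤ, m ≠ 0 → l ≠ 0 → m + l ≠ 0 → m - l ≠ 0 →
      jb l ^ s * (|(l : ℝ)| * |(m + l : ℝ)| * ‖returnInt (res α α 1 m l) t‖ -
        |(l : ℝ)| * |(l : ℝ) - m| * ‖returnInt (res α α 1 (-m) l) t‖)
        ≤ C * (max (jb m ^ s) (jb l ^ s)) ^ 3 ∧
      jb l ^ s * (|(l : ℝ)| * |(m + l : ℝ)| * ‖returnInt (res 1 α α m l) t‖ -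
        |(l : ℝ)| * |(l : ℝ) - m| * ‖returnInt (res 1 α α (-m) l) t‖)
        ≤ C * (max (jb m ^ s) (jb l ^ s)) ^ 3 := by
  obtain ⟨C, hC0, hC⟩ := hΦ.exists_third_le hU ht hC
  refine ⟨128 * C, by positivity, fun m l hm hl hml hml' => ?_⟩
  have hjb := (Real.rpow_pos_of_pos (jb_pos l) s).le
  have hcube : ∀ (m l : ℤ) {a b : ℤ → ℝ} (ha : IsEvenOn (quad m l) a) (hb : IsEvenOn (quad m l) b)
      (ha0 : a 0 = 0), (∀ k, |a k| ≤ 2) → (∀ k, |b k| ≤ 2) →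
      C * ‖evenData s ha hb ha0‖ ^ 3 ≤ 64 * C * (max (jb m ^ s) (jb l ^ s)) ^ 3 := by
    intro m l a b ha hb ha0 ha2 hb2
    have := pow_le_pow_left₀ (norm_nonneg _) (norm_evenData_quad_le s ha hb ha0 ha2 hb2) 3
    nlinarith
  have hnorm : ∀ x : ℝ, ‖(x : ℂ)‖ = |x| := fun x => by rw [Complex.norm_real, Real.norm_eq_abs]
  constructor
  · have e := thirdV_polar (α := α) hl hm (by omega) (by omega) t
    have b1 := (hC (quad l m) 0 _ (isEvenOn_zero l m) ((isEvenOn_left l m).add (isEvenOn_right l m))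
      rfl l).trans (hcube _ _ _ _ _ (by simp) (abs_pairInd_add_le l m))
    have b2 := (hC (quad l m) 0 _ (isEvenOn_zero l m) ((isEvenOn_left l m).sub (isEvenOn_right l m))
      rfl l).trans (hcube _ _ _ _ _ (by simp) (abs_pairInd_sub_le l m))
    have b3 := (hC (quad l m) 0 _ (isEvenOn_zero l m) (isEvenOn_left l m)
      rfl l).trans (hcube _ _ _ _ _ (by simp) (abs_pairInd_le_two l))
    rw [max_comm] at b1 b2 b3
    have r1 : res α α 1 l m = res α α 1 m l := by unfold res; ring
    have r2 : res α α 1 l (-m) = res α α 1 (-m) l := by unfold res; ring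
    have e2 : 2 * (|(l : ℝ)| * |(m + l : ℝ)| * ‖returnInt (res α α 1 m l) t‖ -
        |(l : ℝ)| * |(l : ℝ) - m| * ‖returnInt (res α α 1 (-m) l) t‖)
        ≤ ‖thirdV α (quad l m) 0 (pairInd l + pairInd m) l t‖ +
          ‖thirdV α (quad l m) 0 (pairInd l - pairInd m) l t‖ +
          2 * ‖thirdV α (quad l m) 0 (pairInd l) l t‖ := by
      have n1 := (norm_sub_le (thirdV α (quad l m) 0 (pairInd l + pairInd m) l t +
          thirdV α (quad l m) 0 (pairInd l - pairInd m) l t)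
          (2 * thirdV α (quad l m) 0 (pairInd l) l t)).trans
            (add_le_add (norm_add_le _ _) (le_of_eq (norm_mul _ _)))
      have n2 := norm_sub_norm_le (-(2 * (l : ℂ) * (l + m)) * returnInt (res α α 1 l m) t)
        (2 * (l : ℂ) * (l - m) * returnInt (res α α 1 l (-m)) t)
      rw [← e] at n2
      have n3 : ‖-(2 * (l : ℂ) * (l + m)) * returnInt (res α α 1 l m) t‖
          = 2 * (|(l : ℝ)| * |(m + l : ℝ)| * ‖returnInt (res α α 1 m l) t‖) := by
        rw [r1, ← hnorm, ← hnorm]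
        push_cast
        simp only [norm_mul, norm_neg, Complex.norm_ofNat]
        rw [add_comm (l : ℂ)]
        ring
      have n4 : ‖2 * (l : ℂ) * (l - m) * returnInt (res α α 1 l (-m)) t‖
          = 2 * (|(l : ℝ)| * |(l : ℝ) - m| * ‖returnInt (res α α 1 (-m) l) t‖) := by
        rw [r2, ← hnorm, ← hnorm]
        push_cast
        simp only [norm_mul, Complex.norm_ofNat]
        ring
      rw [n3, n4] at n2
      rw [Complex.norm_ofNat] at n1
      linarith
    linarith [mul_le_mul_of_nonneg_left e2 hjb]
  · have e := thirdV_sub_pairInd (α := α) hm hl hml hml' t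
    have b1 := (hC (quad m l) _ _ (isEvenOn_left m l) (isEvenOn_right m l)
      (pairInd_zero_right hm) l).trans
        (hcube _ _ _ _ _ (abs_pairInd_le_two m) (abs_pairInd_le_two l))
    have b2 := (hC (quad m l) 0 _ (isEvenOn_zero m l) (isEvenOn_right m l)
      rfl l).trans (hcube _ _ _ _ _ (by simp) (abs_pairInd_le_two l))
    have e2 : |(l : ℝ)| * |(m + l : ℝ)| * ‖returnInt (res 1 α α m l) t‖ -
        |(l : ℝ)| * |(l : ℝ) - m| * ‖returnInt (res 1 α α (-m) l) t‖
        ≤ ‖thirdV α (quad m l) (pairInd m) (pairInd l) l t‖ +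
          ‖thirdV α (quad m l) 0 (pairInd l) l t‖ := by
      have n1 := norm_sub_le (thirdV α (quad m l) (pairInd m) (pairInd l) l t)
        (thirdV α (quad m l) 0 (pairInd l) l t)
      have n2 := norm_sub_norm_le (-((l : ℂ) * (m + l)) * returnInt (res 1 α α m l) t)
        ((l : ℂ) * (l - m) * returnInt (res 1 α α (-m) l) t)
      rw [← e] at n2
      have n3 : ‖-((l : ℂ) * (m + l)) * returnInt (res 1 α α m l) t‖
          = |(l : ℝ)| * |(m + l : ℝ)| * ‖returnInt (res 1 α α m l) t‖ := by
        rw [← hnorm, ← hnorm]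
        push_cast
        simp only [norm_mul, norm_neg]
      have n4 : ‖(l : ℂ) * (l - m) * returnInt (res 1 α α (-m) l) t‖
          = |(l : ℝ)| * |(l : ℝ) - m| * ‖returnInt (res 1 α α (-m) l) t‖ := by
        rw [← hnorm, ← hnorm]
        push_cast
        simp only [norm_mul]
      rw [n3, n4] at n2
      linarith
    linarith [mul_le_mul_of_nonneg_left e2 hjb]

/-- An index exceeding `1` forces `s ≥ 1` if `Φ_t` is `C²`. -/
lemma IsSolutionMap.one_le (hΦ : IsSolutionMap α s T U Φ) (hU : U ∈ 𝓝 (0 : Data s))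
    (hα₀ : 0 < α) (hα₁ : α < 1) (ht₀ : t ≠ 0) (ht : |t| < T) (hmax : 1 < maxTypeIndex α)
    (hC : ContDiffAt ℝ 2 (Φ t) 0) : 1 ≤ s := by
  obtain ⟨C, hC0, hC⟩ := hΦ.exists_oscInt_le hU ht hC
  have hd : ∀ d, (1 - α) * d ^ 2 + 3 * α * d - 3 * α = 0 → 1 < minimalTypeIndex d → 1 ≤ s := by
    intro d hquad hd
    obtain ⟨ν, hν, hA⟩ := exists_approximable_of_one_lt hd
    obtain ⟨p1, p2, p3, p4⟩ := d_properties hα₀ hα₁ hquad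
    obtain ⟨κ, K, L, hκ, -, -, hres⟩ := exists_nearResonant p1 p2 p3 p4 (by linarith) hA
    refine one_le_of_second_le (K := K) (L := L) hκ hν ht₀ (fun N => ?_) hC0
      (fun m l hm hl hml => (hC m l hm hl hml).2)
    obtain ⟨m, l, h1, h2, -⟩ := hres N
    exact ⟨m, l, h1, h2⟩
  rw [maxTypeIndex, lt_max_iff, lt_max_iff] at hmax
  rcases hmax with h | h | h
  · obtain ⟨ν, hν, hA⟩ := exists_approximable_of_one_lt h
    obtain ⟨p1, p2, p3, p4⟩ := c₁_properties hα₀ hα₁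
    obtain ⟨κ, K, L, hκ, -, -, hres⟩ := exists_nearResonant p1 p2 p3 p4 (by linarith) hA
    refine one_le_of_second_le (K := K) (L := L) hκ hν ht₀ (fun N => ?_) hC0
      (fun m l hm hl hml => (hC m l hm hl hml).1)
    obtain ⟨m, l, h1, h2, -⟩ := hres N
    exact ⟨m, l, h1, h2⟩
  · exact hd _ (quad_d₁ hα₀ hα₁) h
  · exact hd _ (quad_d₂ hα₀ hα₁) h

/-- If no index exceeds `1`, each of them gives a lower bound for `s` if `Φ_t` is `C³`. -/
lemma IsSolutionMap.half_add_le (hΦ : IsSolutionMap α s T U Φ) (hU : U ∈ 𝓝 (0 : Data s))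
    (hα₀ : 0 < α) (hα₁ : α < 1) (ht₀ : t ≠ 0) (ht : |t| < T) (hmax : maxTypeIndex α ≤ 1)
    (hC : ContDiffAt ℝ 3 (Φ t) 0) : 1 / 2 + 1 / 2 * (maxTypeIndex α).toReal ≤ s := by
  obtain ⟨C, hC0, hC⟩ := hΦ.exists_returnInt_le hU ht hC
  have hlim : ∀ ρ, minimalTypeIndex ρ ≤ 1 → (∀ ν, 0 ≤ ν → ν ≤ 1 → 1 - 2 * ρ ≠ 0 →
      Approximable ρ ν → 1 / 2 + 1 / 2 * ν ≤ s) →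
      1 / 2 + 1 / 2 * (minimalTypeIndex ρ).toReal ≤ s := by
    intro ρ hρ h
    have htop : (minimalTypeIndex ρ).toReal ≤ 1 := by
      have := ENNReal.toReal_mono ENNReal.one_ne_top hρ
      simpa using this
    have hhalf : 1 - 2 * ρ ≠ 0 := by
      -- `1 / 2` is rational, hence of infinite index
      intro h2
      rw [minimalTypeIndex, if_pos ⟨1 / 2, by push_cast; linarith⟩] at hρ
      exact absurd hρ (by simp)
    by_contra hlt
    push Not at hlt
    -- the case `ν = 0` ensures that the exponent `ν` chosen below is nonnegative
    have h0 := h 0 le_rfl zero_le_one hhalf (approximable_of_lt_toReal hρ le_rfl (Or.inl rfl))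
    have hν0 : 0 ≤ s * 2 - 1 := by linarith
    obtain ⟨ν, hν1, hν2⟩ := exists_between (by linarith : s * 2 - 1 < (minimalTypeIndex ρ).toReal)
    have := h ν (by linarith) (by linarith) hhalf
      (approximable_of_lt_toReal hρ (by linarith) (Or.inr hν2))
    linarith
  have hd : ∀ d, (1 - α) * d ^ 2 + 3 * α * d - 3 * α = 0 → minimalTypeIndex d ≤ 1 →
      1 / 2 + 1 / 2 * (minimalTypeIndex d).toReal ≤ s := by
    intro d hquad hd
    refine hlim d hd fun ν hν0 hν1 hhalf hA => ?_
    obtain ⟨p1, p2, p3, p4⟩ := d_properties hα₀ hα₁ hquad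
    obtain ⟨κ, K, L, hκ, hK, hL, hres⟩ := exists_nearResonant p1 p2 p3 p4 hν0 hA
    refine le_of_third_le hκ hK hL hν0 hν1 ht₀ (fun N => ?_) hC0
      (fun m l hm hl hml hml' => (hC m l hm hl hml hml').2)
    obtain ⟨m, l, h1, h2, h3⟩ := hres N
    exact ⟨m, l, h1, h2, h3 hhalf⟩
  have hc : minimalTypeIndex (c₁ α) ≤ 1 →
      1 / 2 + 1 / 2 * (minimalTypeIndex (c₁ α)).toReal ≤ s := by
    intro hc
    refine hlim _ hc fun ν hν0 hν1 hhalf hA => ?_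
    obtain ⟨p1, p2, p3, p4⟩ := c₁_properties hα₀ hα₁
    obtain ⟨κ, K, L, hκ, hK, hL, hres⟩ := exists_nearResonant p1 p2 p3 p4 hν0 hA
    refine le_of_third_le hκ hK hL hν0 hν1 ht₀ (fun N => ?_) hC0
      (fun m l hm hl hml hml' => (hC m l hm hl hml hml').1)
    obtain ⟨m, l, h1, h2, h3⟩ := hres N
    exact ⟨m, l, h1, h2, h3 hhalf⟩
  have hmax' := hmax
  rw [maxTypeIndex, max_le_iff, max_le_iff] at hmax'
  rw [maxTypeIndex]
  rcases max_choice (minimalTypeIndex (c₁ α))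
    (max (minimalTypeIndex (d₁ α)) (minimalTypeIndex (d₂ α))) with h | h
  · rw [h]
    exact hc hmax'.1
  · rw [h]
    rcases max_choice (minimalTypeIndex (d₁ α)) (minimalTypeIndex (d₂ α)) with h | h
    · rw [h]
      exact hd _ (quad_d₁ hα₀ hα₁) hmax'.2.1
    · rw [h]
      exact hd _ (quad_d₂ hα₀ hα₁) hmax'.2.2

lemma one_lt_maxTypeIndex {α : ℝ}
    (h : ∃ q : ℚ, (q : ℝ) = c₁ α ∨ (q : ℝ) = d₁ α ∨ (q : ℝ) = d₂ α) : 1 < maxTypeIndex α := by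
  have htop : ∀ ρ : ℝ, (∃ q : ℚ, (q : ℝ) = ρ) → 1 < minimalTypeIndex ρ := by
    intro ρ hρ
    rw [minimalTypeIndex, if_pos hρ]
    exact ENNReal.one_lt_top
  rw [maxTypeIndex, lt_max_iff, lt_max_iff]
  obtain ⟨q, h | h | h⟩ := h
  · exact Or.inl (htop _ ⟨q, h⟩)
  · exact Or.inr (Or.inl (htop _ ⟨q, h⟩))
  · exact Or.inr (Or.inr (htop _ ⟨q, h⟩))

end Bounds

end MajdaBiello

theorem mainTheorem2 (α : ℝ) (hα₀ : 0 < α) (hα₁ : α < 1) (s : ℝ)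
    (T : ℝ) (U : Set (Data s)) (hU : IsOpen U) (hU₀ : (0 : Data s) ∈ U)
    (Φ : ℝ → Data s → Sobolev s × Sobolev s) (hΦ : IsSolutionMap α s T U Φ)
    (t : ℝ) (ht₀ : t ≠ 0) (htT : |t| < T) :
    (1 < maxTypeIndex α → ContDiffOn ℝ 2 (Φ t) U → 1 ≤ s) ∧
    ((∃ q : ℚ, (q : ℝ) = c₁ α ∨ (q : ℝ) = d₁ α ∨ (q : ℝ) = d₂ α) →
      1 < maxTypeIndex α ∧ (ContDiffOn ℝ 2 (Φ t) U → 1 ≤ s)) ∧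
    (maxTypeIndex α ≤ 1 → ContDiffOn ℝ 3 (Φ t) U →
      1 / 2 + 1 / 2 * (maxTypeIndex α).toReal ≤ s) := by
  have hU' := hU.mem_nhds hU₀
  have h2 : 1 < maxTypeIndex α → ContDiffOn ℝ 2 (Φ t) U → 1 ≤ s := fun hmax hC =>
    hΦ.one_le hU' hα₀ hα₁ ht₀ htT hmax (hC.contDiffAt hU')
  exact ⟨h2, fun h => ⟨one_lt_maxTypeIndex h, h2 (one_lt_maxTypeIndex h)⟩, fun hmax hC =>
    hΦ.half_add_le hU' hα₀ hα₁ ht₀ htT hmax (hC.contDiffAt hU')⟩
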